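/- **Setting.** Let $m\ge 1$, let $\Gamma=\boldsymbol\mu_m\subset\mathbb C^\times$ be the group of $m$-th roots of unity, let $\epsilon:\Gamma\hookrightarrow\mathbb C^\times$ be a faithful (primitive) character, let $\tau\in\mathbb C\Gamma$, and let $W$ be a finite-dimensional $\mathbb C\Gamma$-module. (As $\Gamma$ is commutative, left and right $\Gamma$-modules are the same.) *The affine plane.* Let $B=\mathbb C\langle x,y\rangle\#\Gamma/\langle yx-xy=\tau\rangle$, where $\gamma x\gamma^{-1}=\epsilon(\gamma)x$ and $\gamma y\gamma^{-1}=\epsilon(\gamma)^{-1}y$ for $\gamma\in\Gamma$, and let $B_{\mathrm{rat}}$ be the Ore localization of $B$ at $\mathbb C[x]^\Gamma\smallsetminus\{0\}$. A right $B$-submodule $N\subset W\otimes_\Gamma B_{\mathrm{rat}}$ is *fat* if there is a nonzero $p\in\mathbb C[x]^\Gamma$ with $p\cdot(W\otimes_\Gamma B)\subset N\subset \frac1p\cdot(W\otimes_\Gamma B)$. Let $\mathrm{Gr}^B(W)$ be the set of fat right $B$-submodules of $W\otimes_\Gamma B_{\mathrm{rat}}$. *The quadric.* Let $Q=\mathbb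 C\langle x,z,y,w\rangle\#\Gamma/\langle [x,z]=[y,z]=[z,w]=[y,w]=[x,w]=0,\ yx-xy=\tau zw\rangle$, where $\Gamma$ acts on $x,y$ as above and trivially on $z,w$; it is bigraded by $\deg x=\deg z=(1,0)$, $\deg y=\deg w=(0,1)$, $\deg\gamma=(0,0)$. A bigraded $Q$-module $M$ is torsion if there are $i_0,j_0$ with $M_{i,j}=0$ for all $i>i_0$, $j>j_0$. The category $\mathrm{coh}(\mathbb P)$ of coherent sheaves on the noncommutative quadric $\mathbb P$ is the quotient of the category of finitely generated $\mathbb Z^2$-graded right $Q$-modules by the torsion modules; $\pi$ is the quotient functor, and for a $\Gamma$-module $V$ we put $V\otimes_\Gamma\mathcal O(k,l)=\pi(V\otimes_\Gamma Q(k,l))$ with $Q(k,l)_{i,j}=Q_{i+k,j+l}$. The elements $z,w$ are central; $\mathrm{coh}(\mathbb P^1_z)$ and $\mathrm{coh}(\mathbb P^1_w)$ are the analogous quotient categories for $Q/zQ$ and $Q/wQ$, and $i_z^*,i_w^*$ are the functors induced by $M\mapsto M/Mz$ and $M\mapsto M/Mw$. One has $B\cong Q/((z-1)Q+(w-1)Q)$,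 and $j^*:\mathrm{coh}(\mathbb P)\to\mathrm{mod}(B)$ is the functor induced by $M\mapsto M/(M(z-1)+M(w-1))$. *Trivialized sheaves.* A polynomial in $\mathbb C[x,z]$ is *semi-invariant* if it spans a $\Gamma$-stable line ($\Gamma$ acting by $x\mapsto\epsilon(\gamma)x$, $z\mapsto z$). A sheaf *trivialized in a neighbourhood of $\mathbb P^1_z$* consists of a coherent sheaf $E$ on $\mathbb P$ with $i_z^*E\cong i_z^*(W\otimes_\Gamma\mathcal O)=W\otimes_\Gamma\mathcal O_{\mathbb P^1_z}$, an integer $n\ge0$, a semi-invariant homogeneous polynomial $P(x,z)$ of degree $n$ with $P(1,0)=1$, and monomorphisms $$(W\otimes\epsilon^{-n})\otimes_\Gamma\mathcal O(-n,0)\xrightarrow{\ \phi\ }E\xrightarrow{\ \psi\ }(W\otimes\epsilon^{n})\otimes_\Gamma\mathcal O(n,0)$$ such that $\psi\circ\phi$ is multiplication by $P(x,z)^2$ and such that $i_w^*\psi$ is a monomorphism (equivalently, $L^1i_w^*\,\mathrm{Coker}\,\psi=0$, i.e. multiplication by $w$ is injective on $\mathrm{Coker}\,\psi$). Two such data $(E,n,P,\phi,\psi)$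 and $(E',n',P',\phi',\psi')$ are *equivalent* if there are an isomorphism $e:E\to E'$ and semi-invariant homogeneous polynomials $q,q'$ in $x,z$ with $q(1,0)=q'(1,0)=1$ and $n+\deg q=n'+\deg q'$ such that $$e\circ\phi\circ q=\phi'\circ q',\qquad q\circ\psi=q'\circ\psi'\circ e .$$ Let $\mathrm{Gr}^{\mathbb P}(W)$ be the set of equivalence classes. **Theorem.** The restriction functor $j^*$ induces a bijection $$\mathrm{Gr}^{\mathbb P}(W)\ \xrightarrow{\ \sim\ }\ \mathrm{Gr}^B(W).$$ Explicitly, let $(E,n,P,\phi,\psi)$ be a trivialized sheaf and $p(x)=P(x,1)$. Identify $j^*\big((W\otimes\epsilon^n)\otimes_\Gamma\mathcal O(n,0)\big)=(W\otimes\epsilon^n)\otimes_\Gamma B$ with a submodule of $W\otimes_\Gamma B_{\mathrm{rat}}$ through multiplication by $p^{-1}$. Then the class of $(E,n,P,\phi,\psi)$ is sent to the image of $j^*E$ under $p^{-1}\cdot j^*\psi$, that is, to $\{u\in W\otimes_\Gamma B_{\mathrm{rat}} : p\,u\in (j^*\psi)(j^*E)\}$; this is a fat submodule that depends only on the class, and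 every fat submodule arises from exactly one class. -/

import Mathlib

open CategoryTheory MulOpposite TensorProduct

universe u

noncomputable section

namespace NCQuadric

section Algebras

variable {G : Type} [CommGroup G]

/-- Generators of the bigraded algebra: the group elements and `x, z, y, w`. -/
inductive QGen (G : Type) : Type
  | grp (g : G) : QGen G
  | x : QGen G
  | z : QGen G
  | y : QGen G
  | w : QGen G

/-- Generators of the algebra of the noncommutative affine plane. -/
inductive BGen (G : Type) : Type
  | grp (g : G) : BGen G
  | x : BGen G
  | y : BGen G

/-- An element of the group algebra as a linear combination of generators `j g` of a free algebra. -/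
def liftGrp {X : Type} (j : G → X) (t : MonoidAlgebra ℂ G) : FreeAlgebra ℂ X :=
  t.coeff.sum fun g a => a • FreeAlgebra.ι ℂ (j g)

open QGen in
/-- The defining relations of `ℂ⟨x,z,y,w⟩ # G / ⟨[x,z] = [y,z] = [z,w] = [y,w] = [x,w] = 0,
[y,x] = τ z w⟩`, where `g x g⁻¹ = ε(g) x`, `g y g⁻¹ = ε(g)⁻¹ y`, and `g` commutes with `z, w`. -/
inductive QRel (ε : G →* ℂˣ) (τ : MonoidAlgebra ℂ G) :
    FreeAlgebra ℂ (QGen G) → FreeAlgebra ℂ (QGen G) → Prop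
  | grp_one : QRel ε τ (FreeAlgebra.ι ℂ (grp 1)) 1
  | grp_mul (g h : G) : QRel ε τ (FreeAlgebra.ι ℂ (grp (g * h)))
      (FreeAlgebra.ι ℂ (grp g) * FreeAlgebra.ι ℂ (grp h))
  | grp_x (g : G) : QRel ε τ
      (FreeAlgebra.ι ℂ (grp g) * FreeAlgebra.ι ℂ x * FreeAlgebra.ι ℂ (grp g⁻¹))
      ((ε g : ℂ) • FreeAlgebra.ι ℂ x)
  | grp_y (g : G) : QRel ε τ
      (FreeAlgebra.ι ℂ (grp g) * FreeAlgebra.ι ℂ y * FreeAlgebra.ι ℂ (grp g⁻¹))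
      (((ε g)⁻¹ : ℂ) • FreeAlgebra.ι ℂ y)
  | grp_z (g : G) : QRel ε τ
      (FreeAlgebra.ι ℂ (grp g) * FreeAlgebra.ι ℂ z * FreeAlgebra.ι ℂ (grp g⁻¹))
      (FreeAlgebra.ι ℂ z)
  | grp_w (g : G) : QRel ε τ
      (FreeAlgebra.ι ℂ (grp g) * FreeAlgebra.ι ℂ w * FreeAlgebra.ι ℂ (grp g⁻¹))
      (FreeAlgebra.ι ℂ w)
  | xz : QRel ε τ (FreeAlgebra.ι ℂ x * FreeAlgebra.ι ℂ z) (FreeAlgebra.ι ℂ z * FreeAlgebra.ι ℂ x)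
  | yz : QRel ε τ (FreeAlgebra.ι ℂ y * FreeAlgebra.ι ℂ z) (FreeAlgebra.ι ℂ z * FreeAlgebra.ι ℂ y)
  | zw : QRel ε τ (FreeAlgebra.ι ℂ z * FreeAlgebra.ι ℂ w) (FreeAlgebra.ι ℂ w * FreeAlgebra.ι ℂ z)
  | yw : QRel ε τ (FreeAlgebra.ι ℂ y * FreeAlgebra.ι ℂ w) (FreeAlgebra.ι ℂ w * FreeAlgebra.ι ℂ y)
  | xw : QRel ε τ (FreeAlgebra.ι ℂ x * FreeAlgebra.ι ℂ w) (FreeAlgebra.ι ℂ w * FreeAlgebra.ι ℂ x)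
  | yx : QRel ε τ
      (FreeAlgebra.ι ℂ y * FreeAlgebra.ι ℂ x - FreeAlgebra.ι ℂ x * FreeAlgebra.ι ℂ y)
      (liftGrp grp τ * (FreeAlgebra.ι ℂ z * FreeAlgebra.ι ℂ w))

/-- The homogeneous coordinate algebra `Q` of the noncommutative quadric. -/
def Qu (ε : G →* ℂˣ) (τ : MonoidAlgebra ℂ G) : Type := RingQuot (QRel ε τ)

open BGen in
/-- The defining relations of `ℂ⟨x,y⟩ # G / ⟨[y,x] = τ⟩`. -/
inductive BRel (ε : G →* ℂˣ) (τ : MonoidAlgebra ℂ G) :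
    FreeAlgebra ℂ (BGen G) → FreeAlgebra ℂ (BGen G) → Prop
  | grp_one : BRel ε τ (FreeAlgebra.ι ℂ (grp 1)) 1
  | grp_mul (g h : G) : BRel ε τ (FreeAlgebra.ι ℂ (grp (g * h)))
      (FreeAlgebra.ι ℂ (grp g) * FreeAlgebra.ι ℂ (grp h))
  | grp_x (g : G) : BRel ε τ
      (FreeAlgebra.ι ℂ (grp g) * FreeAlgebra.ι ℂ x * FreeAlgebra.ι ℂ (grp g⁻¹))
      ((ε g : ℂ) • FreeAlgebra.ι ℂ x)
  | grp_y (g : G) : BRel ε τ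
      (FreeAlgebra.ι ℂ (grp g) * FreeAlgebra.ι ℂ y * FreeAlgebra.ι ℂ (grp g⁻¹))
      (((ε g)⁻¹ : ℂ) • FreeAlgebra.ι ℂ y)
  | yx : BRel ε τ
      (FreeAlgebra.ι ℂ y * FreeAlgebra.ι ℂ x - FreeAlgebra.ι ℂ x * FreeAlgebra.ι ℂ y)
      (liftGrp grp τ)

/-- The algebra `B = B_τ` of the noncommutative affine plane. -/
def Bt (ε : G →* ℂˣ) (τ : MonoidAlgebra ℂ G) : Type := RingQuot (BRel ε τ)

variable (ε : G →* ℂˣ) (τ : MonoidAlgebra ℂ G)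

instance : Ring (Qu ε τ) := inferInstanceAs (Ring (RingQuot (QRel ε τ)))
instance : Algebra ℂ (Qu ε τ) := inferInstanceAs (Algebra ℂ (RingQuot (QRel ε τ)))
instance : Ring (Bt ε τ) := inferInstanceAs (Ring (RingQuot (BRel ε τ)))
instance : Algebra ℂ (Bt ε τ) := inferInstanceAs (Algebra ℂ (RingQuot (BRel ε τ)))

/-- The quotient map from the free algebra. -/
def Qu.mk : FreeAlgebra ℂ (QGen G) →ₐ[ℂ] Qu ε τ := RingQuot.mkAlgHom ℂ (QRel ε τ)
/-- The quotient map from the free algebra. -/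
def Bt.mk : FreeAlgebra ℂ (BGen G) →ₐ[ℂ] Bt ε τ := RingQuot.mkAlgHom ℂ (BRel ε τ)

/-- The class of a generator. -/
def Qu.gen (t : QGen G) : Qu ε τ := Qu.mk ε τ (FreeAlgebra.ι ℂ t)
/-- The class of a generator. -/
def Bt.gen (t : BGen G) : Bt ε τ := Bt.mk ε τ (FreeAlgebra.ι ℂ t)

variable {ε τ}

theorem Qu.mk_surj : Function.Surjective (Qu.mk ε τ) := RingQuot.mkAlgHom_surjective ℂ _
theorem Bt.mk_surj : Function.Surjective (Bt.mk ε τ) := RingQuot.mkAlgHom_surjective ℂ _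

theorem Qu.mk_rel {a b} (h : QRel ε τ a b) : Qu.mk ε τ a = Qu.mk ε τ b :=
  RingQuot.mkAlgHom_rel ℂ h
theorem Bt.mk_rel {a b} (h : BRel ε τ a b) : Bt.mk ε τ a = Bt.mk ε τ b :=
  RingQuot.mkAlgHom_rel ℂ h

variable (ε τ)

/-- The group elements inside `Q`. -/
def Qu.grp : G →* Qu ε τ where
  toFun g := Qu.gen ε τ (.grp g)
  map_one' := by simpa [Qu.gen] using Qu.mk_rel (ε := ε) (τ := τ) QRel.grp_one
  map_mul' g h := by simpa [Qu.gen] using Qu.mk_rel (ε := ε) (τ := τ) (QRel.grp_mul g h)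

/-- The group elements inside `B`. -/
def Bt.grp : G →* Bt ε τ where
  toFun g := Bt.gen ε τ (.grp g)
  map_one' := by simpa [Bt.gen] using Bt.mk_rel (ε := ε) (τ := τ) BRel.grp_one
  map_mul' g h := by simpa [Bt.gen] using Bt.mk_rel (ε := ε) (τ := τ) (BRel.grp_mul g h)

theorem Qu.grp_apply (g : G) : Qu.grp ε τ g = Qu.gen ε τ (.grp g) := rfl
theorem Bt.grp_apply (g : G) : Bt.grp ε τ g = Bt.gen ε τ (.grp g) := rfl

/-- The embedding of the group algebra into `Q`. -/
def Qu.ofCG : MonoidAlgebra ℂ G →ₐ[ℂ] Qu ε τ := MonoidAlgebra.lift ℂ _ G (Qu.grp ε τ)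
/-- The embedding of the group algebra into `B`. -/
def Bt.ofCG : MonoidAlgebra ℂ G →ₐ[ℂ] Bt ε τ := MonoidAlgebra.lift ℂ _ G (Bt.grp ε τ)

theorem Qu.mk_liftGrp (t : MonoidAlgebra ℂ G) :
    Qu.mk ε τ (liftGrp .grp t) = Qu.ofCG ε τ t := by
  simp [liftGrp, Qu.ofCG, MonoidAlgebra.lift_apply, Finsupp.sum, map_sum, Qu.grp, Qu.gen]

theorem Bt.mk_liftGrp (t : MonoidAlgebra ℂ G) :
    Bt.mk ε τ (liftGrp .grp t) = Bt.ofCG ε τ t := by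
  simp [liftGrp, Bt.ofCG, MonoidAlgebra.lift_apply, Finsupp.sum, map_sum, Bt.grp, Bt.gen]

/-- The class of `x` in `Q`. -/
abbrev Qu.x : Qu ε τ := Qu.gen ε τ .x
/-- The class of `z` in `Q`. -/
abbrev Qu.z : Qu ε τ := Qu.gen ε τ .z
/-- The class of `y` in `Q`. -/
abbrev Qu.y : Qu ε τ := Qu.gen ε τ .y
/-- The class of `w` in `Q`. -/
abbrev Qu.w : Qu ε τ := Qu.gen ε τ .w
/-- The class of `x` in `B`. -/
abbrev Bt.x : Bt ε τ := Bt.gen ε τ .x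
/-- The class of `y` in `B`. -/
abbrev Bt.y : Bt ε τ := Bt.gen ε τ .y

section relations

theorem conj_to_comm {A : Type*} [Ring A] (f : G →* A) (g : G) (a b : A)
    (h : f g * a * f g⁻¹ = b) : f g * a = b * f g := by
  have : f g⁻¹ * f g = 1 := by rw [← map_mul]; simp
  rw [← h, mul_assoc, this, mul_one]

theorem Qu.grp_x (g : G) : Qu.grp ε τ g * Qu.x ε τ = ((ε g : ℂ) • Qu.x ε τ) * Qu.grp ε τ g := by
  apply conj_to_comm
  simpa [Qu.gen, Qu.grp_apply] using Qu.mk_rel (ε := ε) (τ := τ) (QRel.grp_x g)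

theorem Qu.grp_z (g : G) : Qu.grp ε τ g * Qu.z ε τ = Qu.z ε τ * Qu.grp ε τ g := by
  apply conj_to_comm
  simpa [Qu.gen, Qu.grp_apply] using Qu.mk_rel (ε := ε) (τ := τ) (QRel.grp_z g)

theorem Qu.grp_w (g : G) : Qu.grp ε τ g * Qu.w ε τ = Qu.w ε τ * Qu.grp ε τ g := by
  apply conj_to_comm
  simpa [Qu.gen, Qu.grp_apply] using Qu.mk_rel (ε := ε) (τ := τ) (QRel.grp_w g)

theorem Qu.xz : Qu.x ε τ * Qu.z ε τ = Qu.z ε τ * Qu.x ε τ := by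
  simpa [Qu.gen] using Qu.mk_rel (ε := ε) (τ := τ) QRel.xz
theorem Qu.yz : Qu.y ε τ * Qu.z ε τ = Qu.z ε τ * Qu.y ε τ := by
  simpa [Qu.gen] using Qu.mk_rel (ε := ε) (τ := τ) QRel.yz
theorem Qu.zw : Qu.z ε τ * Qu.w ε τ = Qu.w ε τ * Qu.z ε τ := by
  simpa [Qu.gen] using Qu.mk_rel (ε := ε) (τ := τ) QRel.zw
theorem Qu.yw : Qu.y ε τ * Qu.w ε τ = Qu.w ε τ * Qu.y ε τ := by
  simpa [Qu.gen] using Qu.mk_rel (ε := ε) (τ := τ) QRel.yw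
theorem Qu.xw : Qu.x ε τ * Qu.w ε τ = Qu.w ε τ * Qu.x ε τ := by
  simpa [Qu.gen] using Qu.mk_rel (ε := ε) (τ := τ) QRel.xw
theorem Qu.yx : Qu.y ε τ * Qu.x ε τ - Qu.x ε τ * Qu.y ε τ =
    Qu.ofCG ε τ τ * (Qu.z ε τ * Qu.w ε τ) := by
  simpa [Qu.gen, Qu.mk_liftGrp] using Qu.mk_rel (ε := ε) (τ := τ) QRel.yx

theorem Bt.grp_x (g : G) : Bt.grp ε τ g * Bt.x ε τ = ((ε g : ℂ) • Bt.x ε τ) * Bt.grp ε τ g := by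
  apply conj_to_comm
  simpa [Bt.gen, Bt.grp_apply] using Bt.mk_rel (ε := ε) (τ := τ) (BRel.grp_x g)

theorem Bt.yx : Bt.y ε τ * Bt.x ε τ - Bt.x ε τ * Bt.y ε τ = Bt.ofCG ε τ τ := by
  simpa [Bt.gen, Bt.mk_liftGrp] using Bt.mk_rel (ε := ε) (τ := τ) BRel.yx

/-- Induction on generators. -/
theorem Qu.gen_induction {C : Qu ε τ → Prop} (hs : ∀ c : ℂ, C (algebraMap ℂ _ c))
    (hg : ∀ t, C (Qu.gen ε τ t)) (hm : ∀ a b, C a → C b → C (a * b))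
    (ha : ∀ a b, C a → C b → C (a + b)) (q : Qu ε τ) : C q := by
  obtain ⟨t, rfl⟩ := Qu.mk_surj q
  induction t using FreeAlgebra.induction with
  | grade0 r => simpa using hs r
  | grade1 t => exact hg t
  | mul a b h1 h2 => rw [map_mul]; exact hm _ _ h1 h2
  | add a b h1 h2 => rw [map_add]; exact ha _ _ h1 h2

/-- Induction on generators. -/
theorem Bt.gen_induction {C : Bt ε τ → Prop} (hs : ∀ c : ℂ, C (algebraMap ℂ _ c))
    (hg : ∀ t, C (Bt.gen ε τ t)) (hm : ∀ a b, C a → C b → C (a * b))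
    (ha : ∀ a b, C a → C b → C (a + b)) (q : Bt ε τ) : C q := by
  obtain ⟨t, rfl⟩ := Bt.mk_surj q
  induction t using FreeAlgebra.induction with
  | grade0 r => simpa using hs r
  | grade1 t => exact hg t
  | mul a b h1 h2 => rw [map_mul]; exact hm _ _ h1 h2
  | add a b h1 h2 => rw [map_add]; exact ha _ _ h1 h2

theorem Qu.z_comm (q : Qu ε τ) : Commute (Qu.z ε τ) q := by
  induction q using Qu.gen_induction with
  | hs c => exact (Algebra.commutes c _).symm
  | hg t =>
    cases t with
    | grp g => exact (Qu.grp_z ε τ g).symm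
    | x => exact (Qu.xz ε τ).symm
    | z => exact Commute.refl _
    | y => exact (Qu.yz ε τ).symm
    | w => exact Qu.zw ε τ
  | hm a b h1 h2 => exact h1.mul_right h2
  | ha a b h1 h2 => exact h1.add_right h2

theorem Qu.w_comm (q : Qu ε τ) : Commute (Qu.w ε τ) q := by
  induction q using Qu.gen_induction with
  | hs c => exact (Algebra.commutes c _).symm
  | hg t =>
    cases t with
    | grp g => exact (Qu.grp_w ε τ g).symm
    | x => exact (Qu.xw ε τ).symm
    | z => exact (Qu.zw ε τ).symm
    | y => exact (Qu.yw ε τ).symm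
    | w => exact Commute.refl _
  | hm a b h1 h2 => exact h1.mul_right h2
  | ha a b h1 h2 => exact h1.add_right h2

end relations

/-- The canonical surjection `Q → B`, `z ↦ 1`, `w ↦ 1`. -/
def theta : Qu ε τ →ₐ[ℂ] Bt ε τ :=
  RingQuot.liftAlgHom ℂ ⟨FreeAlgebra.lift ℂ fun t => match t with
    | .grp g => Bt.gen ε τ (.grp g)
    | .x => Bt.x ε τ
    | .z => 1
    | .y => Bt.y ε τ
    | .w => 1, by
    have hG : ∀ g : G, Bt.gen ε τ (.grp g) = Bt.grp ε τ g := fun g => rfl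
    intro a b h
    cases h with
    | grp_one => simp [hG]
    | grp_mul g h => simp [hG]
    | grp_x g => simpa [Bt.gen] using Bt.mk_rel (ε := ε) (τ := τ) (BRel.grp_x g)
    | grp_y g => simpa [Bt.gen] using Bt.mk_rel (ε := ε) (τ := τ) (BRel.grp_y g)
    | grp_z g =>
      have : Bt.grp ε τ g * Bt.grp ε τ g⁻¹ = 1 := by rw [← map_mul]; simp
      simpa [hG] using this
    | grp_w g =>
      have : Bt.grp ε τ g * Bt.grp ε τ g⁻¹ = 1 := by rw [← map_mul]; simp
      simpa [hG] using this
    | xz => simp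
    | yz => simp
    | zw => simp
    | yw => simp
    | xw => simp
    | yx =>
      have := Bt.yx ε τ
      simpa [liftGrp, Finsupp.sum, map_sum, hG, Bt.ofCG, MonoidAlgebra.lift_apply] using this⟩

theorem theta_gen (t : QGen G) : theta ε τ (Qu.gen ε τ t) = match t with
    | .grp g => Bt.gen ε τ (.grp g)
    | .x => Bt.x ε τ
    | .z => 1
    | .y => Bt.y ε τ
    | .w => 1 := by
  refine (RingQuot.liftAlgHom_mkAlgHom_apply ℂ _ _ _).trans ?_
  simp

end Algebras

section Grading

variable {G : Type} [CommGroup G] (ε : G →* ℂˣ) (τ : MonoidAlgebra ℂ G)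

/-- The bidegree of a generator: `deg x = deg z = (1,0)`, `deg y = deg w = (0,1)`,
`deg g = (0,0)`. -/
def QGen.deg : QGen G → ℤ × ℤ
  | .grp _ => 0
  | .x => (1, 0)
  | .z => (1, 0)
  | .y => (0, 1)
  | .w => (0, 1)

/-- The homogeneous component `Q_d`: the span of the words in the generators of total degree `d`. -/
def Qu.grading (d : ℤ × ℤ) : Submodule ℂ (Qu ε τ) :=
  Submodule.span ℂ ((fun l : List (QGen G) => (l.map (Qu.gen ε τ)).prod) ''
    {l | (l.map QGen.deg).sum = d})

theorem Qu.word_mem (l : List (QGen G)) :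
    (l.map (Qu.gen ε τ)).prod ∈ Qu.grading ε τ (l.map QGen.deg).sum :=
  Submodule.subset_span ⟨l, rfl, rfl⟩

theorem Qu.gen_mem (t : QGen G) : Qu.gen ε τ t ∈ Qu.grading ε τ t.deg := by
  simpa using Qu.word_mem ε τ [t]

theorem Qu.one_mem : (1 : Qu ε τ) ∈ Qu.grading ε τ 0 := by
  simpa using Qu.word_mem ε τ []

theorem Qu.mul_mem {d e : ℤ × ℤ} {a b : Qu ε τ} (ha : a ∈ Qu.grading ε τ d)
    (hb : b ∈ Qu.grading ε τ e) : a * b ∈ Qu.grading ε τ (d + e) := by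
  induction ha using Submodule.span_induction with
  | mem a h =>
    obtain ⟨l, hl, rfl⟩ := h
    induction hb using Submodule.span_induction with
    | mem b h =>
      obtain ⟨l', hl', rfl⟩ := h
      have := Qu.word_mem ε τ (l ++ l')
      rw [Set.mem_ofPred_eq] at hl hl'
      simpa [hl, hl'] using this
    | zero => simp
    | add b b' _ _ h h' => rw [mul_add]; exact add_mem h h'
    | smul c b _ h => rw [mul_smul_comm]; exact Submodule.smul_mem _ _ h
  | zero => simp
  | add b b' _ _ h h' => rw [add_mul]; exact add_mem h h'
  | smul c b _ h => rw [smul_mul_assoc]; exact Submodule.smul_mem _ _ h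

theorem Qu.iSup_grading : ⨆ d, Qu.grading ε τ d = ⊤ := by
  rw [eq_top_iff]
  rintro q -
  have hle := fun d => le_iSup (Qu.grading ε τ) d
  induction q using Qu.gen_induction with
  | hs c =>
    rw [Algebra.algebraMap_eq_smul_one]
    exact Submodule.smul_mem _ _ (hle 0 (Qu.one_mem ε τ))
  | hg t => exact hle _ (Qu.gen_mem ε τ t)
  | hm a b h1 h2 =>
    induction h1 using Submodule.iSup_induction' with
    | mem d a ha =>
      induction h2 using Submodule.iSup_induction' with
      | mem e b hb => exact hle _ (Qu.mul_mem ε τ ha hb)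
      | zero => simp
      | add b b' _ _ h h' => rw [mul_add]; exact add_mem h h'
    | zero => simp
    | add b b' _ _ h h' => rw [add_mul]; exact add_mem h h'
  | ha a b h1 h2 => exact add_mem h1 h2

/-- The coaction `Q → Q[ℤ²]` describing the grading. -/
def Qu.coact : Qu ε τ →ₐ[ℂ] AddMonoidAlgebra (Qu ε τ) (ℤ × ℤ) :=
  RingQuot.liftAlgHom ℂ ⟨FreeAlgebra.lift ℂ fun t =>
      AddMonoidAlgebra.single t.deg (Qu.gen ε τ t), by
    have key : ∀ {a b}, QRel ε τ a b → Qu.mk ε τ a = Qu.mk ε τ b := fun h => Qu.mk_rel h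
    have hG : ∀ c : MonoidAlgebra ℂ G, (FreeAlgebra.lift ℂ fun t : QGen G =>
        AddMonoidAlgebra.single t.deg (Qu.gen ε τ t)) (liftGrp .grp c) =
        AddMonoidAlgebra.single 0 (Qu.ofCG ε τ c) := by
      intro c
      simp [liftGrp, Finsupp.sum, map_sum, Qu.ofCG, MonoidAlgebra.lift_apply, QGen.deg,
        Qu.grp_apply, ← AddMonoidAlgebra.singleAddHom_apply]
      refine Finset.sum_congr rfl fun g _ => ?_
      simp
    intro a b h
    have hk := key h
    cases h with
    | grp_one =>
      rw [map_one] at hk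
      simp [QGen.deg, Qu.gen, hk, AddMonoidAlgebra.one_def]
    | grp_mul g h =>
      simpa [QGen.deg, Qu.gen, AddMonoidAlgebra.single_mul_single]
        using congrArg (AddMonoidAlgebra.single 0) hk
    | grp_x g =>
      simpa [QGen.deg, Qu.gen, AddMonoidAlgebra.single_mul_single]
        using congrArg (AddMonoidAlgebra.single (1, 0)) hk
    | grp_y g =>
      simpa [QGen.deg, Qu.gen, AddMonoidAlgebra.single_mul_single]
        using congrArg (AddMonoidAlgebra.single (0, 1)) hk
    | grp_z g =>
      simpa [QGen.deg, Qu.gen, AddMonoidAlgebra.single_mul_single]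
        using congrArg (AddMonoidAlgebra.single (1, 0)) hk
    | grp_w g =>
      simpa [QGen.deg, Qu.gen, AddMonoidAlgebra.single_mul_single]
        using congrArg (AddMonoidAlgebra.single (0, 1)) hk
    | xz =>
      simpa [QGen.deg, Qu.gen, AddMonoidAlgebra.single_mul_single]
        using congrArg (AddMonoidAlgebra.single (2, 0)) hk
    | yz =>
      simpa [QGen.deg, Qu.gen, AddMonoidAlgebra.single_mul_single]
        using congrArg (AddMonoidAlgebra.single (1, 1)) hk
    | zw =>
      simpa [QGen.deg, Qu.gen, AddMonoidAlgebra.single_mul_single]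
        using congrArg (AddMonoidAlgebra.single (1, 1)) hk
    | yw =>
      simpa [QGen.deg, Qu.gen, AddMonoidAlgebra.single_mul_single]
        using congrArg (AddMonoidAlgebra.single (0, 2)) hk
    | xw =>
      simpa [QGen.deg, Qu.gen, AddMonoidAlgebra.single_mul_single]
        using congrArg (AddMonoidAlgebra.single (1, 1)) hk
    | yx =>
      rw [map_mul, hG]
      have := congrArg (AddMonoidAlgebra.singleAddHom (R := Qu ε τ) ((1, 1) : ℤ × ℤ)) hk
      rw [map_mul, Qu.mk_liftGrp, map_sub, map_sub] at this
      simpa [QGen.deg, Qu.gen, AddMonoidAlgebra.single_mul_single] using this⟩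

theorem Qu.coact_gen (t : QGen G) :
    Qu.coact ε τ (Qu.gen ε τ t) = AddMonoidAlgebra.single t.deg (Qu.gen ε τ t) := by
  refine (RingQuot.liftAlgHom_mkAlgHom_apply ℂ _ _ _).trans ?_
  simp

theorem Qu.coact_of_mem {d : ℤ × ℤ} {q : Qu ε τ} (hq : q ∈ Qu.grading ε τ d) :
    Qu.coact ε τ q = AddMonoidAlgebra.single d q := by
  induction hq using Submodule.span_induction with
  | mem a h =>
    obtain ⟨l, rfl, rfl⟩ := h
    induction l with
    | nil => simp [AddMonoidAlgebra.one_def]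
    | cons t l ih =>
      simp only [List.map_cons, List.prod_cons, List.sum_cons] at ih ⊢
      rw [map_mul, Qu.coact_gen, ih, AddMonoidAlgebra.single_mul_single]
  | zero => simp
  | add b b' _ _ h h' => rw [map_add, h, h', AddMonoidAlgebra.single_add]
  | smul c b _ h => rw [map_smul, h, AddMonoidAlgebra.smul_single]

end Grading

section Polys

variable {G : Type} [CommGroup G]

/-- Evaluation of a polynomial in two variables at a pair of commuting elements. -/
def evalAt {A : Type} [Ring A] [Algebra ℂ A] (a b : A) (h : Commute a b) :
    MvPolynomial (Fin 2) ℂ →ₐ[ℂ] A :=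
  AddMonoidAlgebra.lift ℂ A (Fin 2 →₀ ℕ)
    { toFun := fun s => a ^ (Multiplicative.toAdd s) 0 * b ^ (Multiplicative.toAdd s) 1
      map_one' := by simp
      map_mul' := fun s t => by
        simp only [toAdd_mul, Finsupp.add_apply, pow_add]
        have := (h.symm.pow_pow ((Multiplicative.toAdd s) 1) ((Multiplicative.toAdd t) 0)).eq
        simp only [mul_assoc]
        rw [← mul_assoc (b ^ _) (a ^ _), this]
        simp only [mul_assoc] }

theorem evalAt_X0 {A : Type} [Ring A] [Algebra ℂ A] (a b : A) (h : Commute a b) :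
    evalAt a b h (MvPolynomial.X 0) = a := by
  refine (AddMonoidAlgebra.lift_single _ _ _).trans ?_
  simp

theorem evalAt_X1 {A : Type} [Ring A] [Algebra ℂ A] (a b : A) (h : Commute a b) :
    evalAt a b h (MvPolynomial.X 1) = b := by
  refine (AddMonoidAlgebra.lift_single _ _ _).trans ?_
  simp

theorem evalAt_monomial {A : Type} [Ring A] [Algebra ℂ A] (a b : A) (h : Commute a b)
    (s : Fin 2 →₀ ℕ) (c : ℂ) :
    evalAt a b h (MvPolynomial.monomial s c) = c • (a ^ s 0 * b ^ s 1) :=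
  AddMonoidAlgebra.lift_single _ _ _

/-- The action of `g` on `ℂ[x,z]`: `x ↦ ε(g) x`, `z ↦ z`. -/
def polyAct (ε : G →* ℂˣ) (g : G) : MvPolynomial (Fin 2) ℂ →ₐ[ℂ] MvPolynomial (Fin 2) ℂ :=
  MvPolynomial.aeval ![MvPolynomial.C (ε g : ℂ) * MvPolynomial.X 0, MvPolynomial.X 1]

theorem evalAt_conj {A : Type} [Ring A] [Algebra ℂ A] (ε : G →* ℂˣ) (f : G →* A) (a b : A)
    (h : Commute a b) (g : G) (ha : f g * a = ((ε g : ℂ) • a) * f g) (hb : f g * b = b * f g)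
    (P : MvPolynomial (Fin 2) ℂ) :
    f g * evalAt a b h P = evalAt a b h (polyAct ε g P) * f g := by
  induction P using MvPolynomial.induction_on with
  | C c =>
    have : (MvPolynomial.C c : MvPolynomial (Fin 2) ℂ) = algebraMap ℂ _ c := rfl
    simp only [this, AlgHom.commutes]
    exact (Algebra.commutes c _).symm
  | add p q hp hq => simp only [map_add, mul_add, add_mul, hp, hq]
  | mul_X p i hp =>
    rw [map_mul, ← mul_assoc, hp, map_mul, map_mul, mul_assoc, mul_assoc]
    congr 1
    fin_cases i
    · have hC : (MvPolynomial.C (ε g : ℂ) : MvPolynomial (Fin 2) ℂ) = algebraMap ℂ _ (ε g : ℂ) := rfl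
      simp only [polyAct, Fin.zero_eta, evalAt_X0, MvPolynomial.aeval_X, Matrix.cons_val_zero,
        map_mul, hC, AlgHom.commutes, ha, Algebra.smul_def]
    · simp only [polyAct, Fin.mk_one, evalAt_X1, MvPolynomial.aeval_X, Matrix.cons_val_one,
        Matrix.cons_val_fin_one, hb]

/-- A `G`-semiinvariant homogeneous polynomial `P(x,z)` of degree `n` with `P(1,0) = 1`. -/
structure SemiInv (ε : G →* ℂˣ) (n : ℕ) where
  poly : MvPolynomial (Fin 2) ℂ
  homog : poly.IsHomogeneous n
  semi : ∃ c : G → ℂ, ∀ g, polyAct ε g poly = MvPolynomial.C (c g) * poly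
  normalized : MvPolynomial.eval ![1, 0] poly = 1

theorem SemiInv.act {ε : G →* ℂˣ} {n : ℕ} (P : SemiInv ε n) (g : G) :
    polyAct ε g P.poly = MvPolynomial.C ((ε g : ℂ) ^ n) * P.poly := by
  obtain ⟨c, hc⟩ := P.semi
  have h1 : MvPolynomial.eval ![(1 : ℂ), 0] (polyAct ε g P.poly) = (ε g : ℂ) ^ n := by
    have : MvPolynomial.eval ![(1 : ℂ), 0] (polyAct ε g P.poly) =
        MvPolynomial.eval ((ε g : ℂ) • ![(1 : ℂ), 0]) P.poly := by
      rw [polyAct, MvPolynomial.aeval_def, ← MvPolynomial.coe_eval₂Hom]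
      have : (MvPolynomial.eval ![(1 : ℂ), 0]).comp (MvPolynomial.eval₂Hom
          (algebraMap ℂ (MvPolynomial (Fin 2) ℂ))
          ![MvPolynomial.C (ε g : ℂ) * MvPolynomial.X 0, MvPolynomial.X 1]) =
          MvPolynomial.eval ((ε g : ℂ) • ![(1 : ℂ), 0]) := by
        apply MvPolynomial.ringHom_ext
        · intro r; simp
        · intro i; fin_cases i <;> simp
      exact congrArg (fun f => f P.poly) this
    rw [this]
    have hn := P.normalized
    rw [MvPolynomial.eval_eq] at hn ⊢
    calc _ = ∑ d ∈ P.poly.support, (ε g : ℂ) ^ n *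
          (P.poly.coeff d * ∏ i ∈ d.support, ![(1 : ℂ), 0] i ^ d i) := by
          refine Finset.sum_congr rfl fun d hd => ?_
          have hdeg := P.homog (MvPolynomial.mem_support_iff.mp hd)
          simp only [Pi.smul_apply, smul_eq_mul, mul_pow, Finset.prod_mul_distrib]
          rw [Finset.prod_pow_eq_pow_sum]
          have : ∑ i ∈ d.support, d i = n := by
            rw [← hdeg]; simp [Finsupp.weight_apply, Finsupp.sum]
          rw [this]; ring
      _ = _ := by rw [← Finset.mul_sum, hn, mul_one]
  rw [hc] at h1
  simp [P.normalized] at h1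
  rw [hc, h1]

/-- The product of two normalized semiinvariant polynomials. -/
def SemiInv.mul {ε : G →* ℂˣ} {n k : ℕ} (P : SemiInv ε n) (R : SemiInv ε k) :
    SemiInv ε (n + k) where
  poly := P.poly * R.poly
  homog := P.homog.mul R.homog
  semi := ⟨fun g => (ε g : ℂ) ^ n * (ε g : ℂ) ^ k, fun g => by
    rw [map_mul, P.act, R.act, map_mul]; ring⟩
  normalized := by rw [map_mul, P.normalized, R.normalized, mul_one]

/-- The constant polynomial `1`. -/
def SemiInv.one (ε : G →* ℂˣ) : SemiInv ε 0 where
  poly := 1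
  homog := MvPolynomial.isHomogeneous_one _ _
  semi := ⟨fun _ => 1, fun g => by simp⟩
  normalized := by simp

variable (ε : G →* ℂˣ) (τ : MonoidAlgebra ℂ G)

/-- The element `P(x,z)` of `Q`. -/
def Qu.evalPoly : MvPolynomial (Fin 2) ℂ →ₐ[ℂ] Qu ε τ :=
  evalAt (Qu.x ε τ) (Qu.z ε τ) (Qu.xz ε τ)

/-- The element `P(x,1)` of `B`. -/
def Bt.evalPoly : MvPolynomial (Fin 2) ℂ →ₐ[ℂ] Bt ε τ :=
  evalAt (Bt.x ε τ) 1 (Commute.one_right _)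

variable {ε} in
theorem Qu.grp_evalPoly {n : ℕ} (P : SemiInv ε n) (g : G) :
    Qu.grp ε τ g * Qu.evalPoly ε τ P.poly =
      ((ε g : ℂ) ^ n) • (Qu.evalPoly ε τ P.poly * Qu.grp ε τ g) := by
  have := evalAt_conj ε (Qu.grp ε τ) _ _ (Qu.xz ε τ) g (Qu.grp_x ε τ g) (Qu.grp_z ε τ g) P.poly
  rw [P.act, map_mul] at this
  refine this.trans ?_
  have hC : (MvPolynomial.C ((ε g : ℂ) ^ n) : MvPolynomial (Fin 2) ℂ) =
    algebraMap ℂ _ ((ε g : ℂ) ^ n) := rfl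
  rw [hC, AlgHom.commutes, ← Algebra.smul_def, smul_mul_assoc]
  rfl

variable {ε} in
theorem Bt.grp_evalPoly {n : ℕ} (P : SemiInv ε n) (g : G) :
    Bt.grp ε τ g * Bt.evalPoly ε τ P.poly =
      ((ε g : ℂ) ^ n) • (Bt.evalPoly ε τ P.poly * Bt.grp ε τ g) := by
  have := evalAt_conj ε (Bt.grp ε τ) (Bt.x ε τ) 1 (Commute.one_right _) g (Bt.grp_x ε τ g)
    (by simp) P.poly
  rw [P.act, map_mul] at this
  refine this.trans ?_
  have hC : (MvPolynomial.C ((ε g : ℂ) ^ n) : MvPolynomial (Fin 2) ℂ) =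
    algebraMap ℂ _ ((ε g : ℂ) ^ n) := rfl
  rw [hC, AlgHom.commutes, ← Algebra.smul_def, smul_mul_assoc]
  rfl

variable {ε} in
theorem Qu.evalPoly_mem {n : ℕ} (P : SemiInv ε n) :
    Qu.evalPoly ε τ P.poly ∈ Qu.grading ε τ ((n : ℤ), 0) := by
  rw [P.poly.as_sum, map_sum]
  refine Submodule.sum_mem _ fun s hs => ?_
  have hdeg := P.homog (MvPolynomial.mem_support_iff.mp hs)
  have hdeg' : s 0 + s 1 = n := by
    rw [← hdeg]
    simp [Finsupp.weight_apply, Finsupp.sum_fintype]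
  have he : Qu.evalPoly ε τ (MvPolynomial.monomial s (P.poly.coeff s)) =
      P.poly.coeff s • (Qu.x ε τ ^ s 0 * Qu.z ε τ ^ s 1) := evalAt_monomial _ _ _ _ _
  rw [he]
  refine Submodule.smul_mem _ _ ?_
  have := Qu.word_mem ε τ (List.replicate (s 0) .x ++ List.replicate (s 1) .z)
  have h2 : ((List.replicate (s 0) (QGen.x : QGen G) ++ List.replicate (s 1) (QGen.z : QGen G)).map
      QGen.deg).sum = ((n : ℤ), (0 : ℤ)) := by
    simp [QGen.deg, ← hdeg']
  rw [h2] at this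
  simpa using this

end Polys

section Rat

variable {G : Type} [CommGroup G] (ε : G →* ℂˣ) (τ : MonoidAlgebra ℂ G)

/-- Nonzero `G`-invariant polynomials in `x`. -/
def IsInvPoly (p : Polynomial ℂ) : Prop :=
  p ≠ 0 ∧ ∀ g, p.comp (Polynomial.C (ε g : ℂ) * Polynomial.X) = p

/-- The multiplicative system `ℂ[x]^G ∖ {0}` in `B`. -/
def invS : Submonoid (Bt ε τ) where
  carrier := {b | ∃ p, IsInvPoly ε p ∧ Polynomial.aeval (Bt.x ε τ) p = b}
  one_mem' := ⟨1, ⟨one_ne_zero, by simp⟩, by simp⟩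
  mul_mem' := by
    rintro _ _ ⟨p, hp, rfl⟩ ⟨q, hq, rfl⟩
    exact ⟨p * q, ⟨mul_ne_zero hp.1 hq.1, fun g => by rw [Polynomial.mul_comp, hp.2, hq.2]⟩,
      by simp⟩

theorem Bt.grp_aeval (g : G) (p : Polynomial ℂ) :
    Bt.grp ε τ g * Polynomial.aeval (Bt.x ε τ) p =
      Polynomial.aeval (Bt.x ε τ) (p.comp (Polynomial.C (ε g : ℂ) * Polynomial.X)) *
        Bt.grp ε τ g := by
  induction p using Polynomial.induction_on with
  | C c =>
    simp only [Polynomial.aeval_C, Polynomial.C_comp]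
    exact (Algebra.commutes c _).symm
  | add p q hp hq => simp only [map_add, mul_add, add_mul, hp, hq, Polynomial.add_comp]
  | monomial n c ih =>
    rw [pow_succ, ← mul_assoc, map_mul, ← mul_assoc, ih, Polynomial.mul_comp, map_mul, mul_assoc,
      mul_assoc, Polynomial.aeval_X, Bt.grp_x]
    simp [Algebra.smul_def, mul_assoc]

variable {ε τ}

theorem IsInvPoly.grp_comm {p : Polynomial ℂ} (hp : IsInvPoly ε p) (g : G) :
    Commute (Bt.grp ε τ g) (Polynomial.aeval (Bt.x ε τ) p) := by
  have := Bt.grp_aeval ε τ g p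
  rwa [hp.2] at this

theorem IsInvPoly.ofCG_comm {p : Polynomial ℂ} (hp : IsInvPoly ε p) (t : MonoidAlgebra ℂ G) :
    Commute (Bt.ofCG ε τ t) (Polynomial.aeval (Bt.x ε τ) p) := by
  induction t using MonoidAlgebra.induction_linear with
  | zero => rw [map_zero]; exact Commute.zero_left _
  | add r t hr ht => rw [map_add]; exact hr.add_left ht
  | single g c =>
    rw [Bt.ofCG, MonoidAlgebra.lift_single]
    have h := (hp.grp_comm (τ := τ) g).eq
    rw [Commute, SemiconjBy, smul_mul_assoc, mul_smul_comm, h]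

theorem Bt.x_comm (p : Polynomial ℂ) :
    Commute (Bt.x ε τ) (Polynomial.aeval (Bt.x ε τ) p) := by
  have h : Polynomial.aeval (Bt.x ε τ) ((Polynomial.X : Polynomial ℂ) * p) =
      Polynomial.aeval (Bt.x ε τ) (p * Polynomial.X) := by rw [mul_comm]
  simpa [Commute, SemiconjBy] using h

/-- Local nilpotency of `ad s`. -/
def AdNil (s r : Bt ε τ) : Prop := ∃ n : ℕ, (fun r => s * r - r * s)^[n] r = 0

theorem adNil_mul_aux (s : Bt ε τ) : ∀ N n m : ℕ, n + m ≤ N → ∀ a b : Bt ε τ,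
    (fun r => s * r - r * s)^[n] a = 0 → (fun r => s * r - r * s)^[m] b = 0 →
    (fun r => s * r - r * s)^[N] (a * b) = 0 := by
  have h0 : ∀ N : ℕ, (fun r : Bt ε τ => s * r - r * s)^[N] 0 = 0 := by
    intro N; induction N with
    | zero => rfl
    | succ N ih => rw [Function.iterate_succ_apply]; simpa using ih
  have hadd : ∀ (N : ℕ) (a b : Bt ε τ), (fun r : Bt ε τ => s * r - r * s)^[N] (a + b) =
      (fun r : Bt ε τ => s * r - r * s)^[N] a + (fun r : Bt ε τ => s * r - r * s)^[N] b := by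
    intro N; induction N with
    | zero => intro a b; rfl
    | succ N ih =>
      intro a b
      rw [Function.iterate_succ_apply, Function.iterate_succ_apply, Function.iterate_succ_apply,
        ← ih]
      congr 1; noncomm_ring
  intro N
  induction N with
  | zero =>
    intro n m h a b ha hb
    obtain rfl : n = 0 := by omega
    have : a = 0 := ha
    simp [this]
  | succ N ih =>
    intro n m h a b ha hb
    rw [Function.iterate_succ_apply]
    have : s * (a * b) - a * b * s = (s * a - a * s) * b + a * (s * b - b * s) := by noncomm_ring
    rw [this, hadd]
    cases n with
    | zero =>
      have : a = 0 := ha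
      simp [this, h0]
    | succ n =>
      cases m with
      | zero =>
        have : b = 0 := hb
        simp [this, h0]
      | succ m =>
        rw [ih n (m + 1) (by omega) _ _ ha hb, ih (n + 1) m (by omega) _ _ ha hb, add_zero]

theorem adNil {s : Bt ε τ} (hs : s ∈ invS ε τ) (r : Bt ε τ) : AdNil s r := by
  obtain ⟨p, hp, rfl⟩ := hs
  set s := Polynomial.aeval (Bt.x ε τ) p with hsdef
  have hcomm : ∀ r : Bt ε τ, Commute r s → AdNil s r := fun r h => ⟨1, by
    simp [h.eq]⟩
  induction r using Bt.gen_induction with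
  | hs c => exact hcomm _ (Algebra.commutes c _)
  | hg t =>
    cases t with
    | grp g => exact hcomm _ (hp.grp_comm g)
    | x => exact hcomm _ (Bt.x_comm p)
    | y =>
      have key : ∀ q : Polynomial ℂ, Commute
          (Polynomial.aeval (Bt.x ε τ) q * Bt.y ε τ - Bt.y ε τ * Polynomial.aeval (Bt.x ε τ) q)
          s := by
        intro q
        induction q using Polynomial.induction_on with
        | C c =>
          rw [Polynomial.aeval_C, Algebra.commutes, sub_self]
          exact Commute.zero_left _
        | add a b ha hb =>
          have := ha.add_left hb
          convert this using 1
          rw [map_add]; noncomm_ring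
        | monomial n c ih =>
          rw [pow_succ, ← mul_assoc, map_mul, Polynomial.aeval_X]
          set a := Polynomial.aeval (Bt.x ε τ) (Polynomial.C c * Polynomial.X ^ n)
          have h1 : a * Bt.x ε τ * Bt.y ε τ - Bt.y ε τ * (a * Bt.x ε τ) =
            (a * Bt.y ε τ - Bt.y ε τ * a) * Bt.x ε τ
              - a * (Bt.y ε τ * Bt.x ε τ - Bt.x ε τ * Bt.y ε τ) := by noncomm_ring
          rw [h1, Bt.yx]
          refine (ih.mul_left (Bt.x_comm p)).sub_left (Commute.mul_left ?_ (hp.ofCG_comm τ))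
          rw [hsdef, Commute, SemiconjBy, ← map_mul, ← map_mul, mul_comm]
      refine ⟨2, ?_⟩
      simp only [Function.iterate_succ_apply, Function.iterate_zero, id]
      exact sub_eq_zero.mpr (key p).symm.eq
  | hm a b h1 h2 =>
    obtain ⟨n, hn⟩ := h1
    obtain ⟨m, hm⟩ := h2
    exact ⟨n + m, adNil_mul_aux s _ n m le_rfl a b hn hm⟩
  | ha a b h1 h2 =>
    obtain ⟨n, hn⟩ := h1
    obtain ⟨m, hm⟩ := h2
    have hlin : ∀ N : ℕ, ∀ a b : Bt ε τ, (fun r : Bt ε τ => s * r - r * s)^[N] (a + b) =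
      (fun r : Bt ε τ => s * r - r * s)^[N] a + (fun r : Bt ε τ => s * r - r * s)^[N] b := by
      intro N; induction N with
      | zero => intro a b; rfl
      | succ N ih =>
        intro a b
        rw [Function.iterate_succ_apply, Function.iterate_succ_apply, Function.iterate_succ_apply,
          ← ih]
        congr 1; noncomm_ring
    have hz : ∀ N : ℕ, (fun r : Bt ε τ => s * r - r * s)^[N] 0 = 0 := by
      intro N; induction N with
      | zero => rfl
      | succ N ih => rw [Function.iterate_succ_apply]; simpa using ih
    refine ⟨n + m, ?_⟩
    rw [hlin, Function.iterate_add_apply _ n m b, hm, hz, add_comm n m,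
      Function.iterate_add_apply _ m n a, hn, hz, add_zero]

theorem ore_aux (s : Bt ε τ) : ∀ (n : ℕ) (r : Bt ε τ), (fun r => s * r - r * s)^[n] r = 0 →
    ∃ r', s ^ n * r = r' * s := by
  intro n
  induction n with
  | zero => intro r h; exact ⟨0, by have : r = 0 := h; simp [this]⟩
  | succ n ih =>
    intro r h
    obtain ⟨r', hr'⟩ := ih _ h
    refine ⟨r' + s ^ n * r, ?_⟩
    rw [add_mul, ← hr', pow_succ]
    noncomm_ring

theorem ore_cancel_aux (s : Bt ε τ) : ∀ (n : ℕ) (r : Bt ε τ),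
    (fun r => s * r - r * s)^[n] r = 0 → r * s = 0 → s ^ n * r = 0 := by
  intro n
  induction n with
  | zero => intro r h _; have : r = 0 := h; simp [this]
  | succ n ih =>
    intro r h hr
    have h2 : s ^ n * (s * r - r * s) = 0 :=
      ih _ h (by show (s * r - r * s) * s = 0; rw [hr, sub_zero, mul_assoc, hr, mul_zero])
    rw [hr, sub_zero] at h2
    rw [pow_succ, mul_assoc, h2]

variable (ε τ)

instance : OreLocalization.OreSet (invS ε τ) :=
  Classical.choice <| OreLocalization.nonempty_oreSet_iff.mpr ⟨fun r₁ r₂ s h => by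
    obtain ⟨n, hn⟩ := adNil s.2 (r₁ - r₂)
    refine ⟨s ^ n, ?_⟩
    have := ore_cancel_aux (s : Bt ε τ) n _ hn (by rw [sub_mul, h, sub_self])
    rw [mul_sub, sub_eq_zero] at this
    simpa using this, fun r s => by
    obtain ⟨n, hn⟩ := adNil s.2 r
    obtain ⟨r', hr'⟩ := ore_aux (s : Bt ε τ) n r hn
    exact ⟨r', s ^ n, by simpa using hr'⟩⟩

/-- The Ore localization `B_rat` of `B` at the nonzero invariant polynomials in `x`. -/
def BRat : Type := OreLocalization (invS ε τ) (Bt ε τ)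

instance : Ring (BRat ε τ) := inferInstanceAs (Ring (OreLocalization (invS ε τ) (Bt ε τ)))

/-- The canonical map `B → B_rat`. -/
def BRat.num : Bt ε τ →+* BRat ε τ := OreLocalization.numeratorRingHom

end Rat

section Tensor

variable {G : Type} [CommGroup G] (ε : G →* ℂˣ) (τ : MonoidAlgebra ℂ G)

/-- `Q` as a left module over the group algebra. -/
instance : Module (MonoidAlgebra ℂ G) (Qu ε τ) :=
  Module.compHom (Qu ε τ) (Qu.ofCG ε τ).toRingHom

instance : SMulCommClass (MonoidAlgebra ℂ G) (Qu ε τ)ᵐᵒᵖ (Qu ε τ) where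
  smul_comm r s q := (mul_assoc (Qu.ofCG ε τ r) q s.unop).symm

theorem Qu.cg_smul (r : MonoidAlgebra ℂ G) (q : Qu ε τ) : r • q = Qu.ofCG ε τ r * q := rfl

/-- The embedding of the group algebra into `B_rat`. -/
def BRat.ofCG : MonoidAlgebra ℂ G →+* BRat ε τ := (BRat.num ε τ).comp (Bt.ofCG ε τ).toRingHom

/-- `B_rat` as a left module over the group algebra. -/
instance : Module (MonoidAlgebra ℂ G) (BRat ε τ) := Module.compHom (BRat ε τ) (BRat.ofCG ε τ)

/-- `B_rat` as a right module over `B`. -/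
instance : Module (Bt ε τ)ᵐᵒᵖ (BRat ε τ) := Module.compHom (BRat ε τ) (RingHom.op (BRat.num ε τ))

theorem BRat.op_smul (b : Bt ε τ) (q : BRat ε τ) : op b • q = q * BRat.num ε τ b := rfl
theorem BRat.cg_smul (r : MonoidAlgebra ℂ G) (q : BRat ε τ) : r • q = BRat.ofCG ε τ r * q := rfl

instance : SMulCommClass (MonoidAlgebra ℂ G) (Bt ε τ)ᵐᵒᵖ (BRat ε τ) where
  smul_comm r s q := (mul_assoc (BRat.ofCG ε τ r) q (BRat.num ε τ s.unop)).symm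

instance : SMulCommClass (BRat ε τ) (Bt ε τ)ᵐᵒᵖ (BRat ε τ) where
  smul_comm r s q := (mul_assoc r q (BRat.num ε τ s.unop)).symm

variable {W : Type u} [AddCommGroup W] [Module ℂ W]

/-- The twist `W ⊗ χ` of a representation by a character. -/
def twist (ρ : Representation ℂ G W) (χ : G →* ℂˣ) : Representation ℂ G W where
  toFun g := (χ g : ℂ) • ρ g
  map_one' := by simp
  map_mul' g h := by
    ext v
    simp only [map_mul, Units.val_mul, LinearMap.smul_apply, Module.End.mul_apply, map_smul,
      mul_smul]
    exact smul_comm _ _ _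

/-- Left multiplication by an element `a` with `g a g⁻¹ = χ(g) a`, as a map
`W ⊗_G A → (W ⊗ χ) ⊗_G A`; here `ρ' = ρ ⊗ χ`, and the tensor factors
are written in the order `A ⊗ W`. -/
def lmulAdd {A : Type} [Ring A] [Module (MonoidAlgebra ℂ G) A]
    (i : MonoidAlgebra ℂ G →+* A) (hi : ∀ r (q : A), r • q = i r * q) (a : A) (χ : G → ℂˣ)
    (H : ∀ g c, a * i (.single g c) = i (.single g (c * ((χ g)⁻¹ : ℂˣ))) * a)
    (ρ ρ' : Representation ℂ G W) (hW : ∀ g w, ρ' g w = (χ g : ℂ) • ρ g w) :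
    A ⊗[MonoidAlgebra ℂ G] ρ.asModule →+ A ⊗[MonoidAlgebra ℂ G] ρ'.asModule :=
  TensorProduct.liftAddHom
    (AddMonoidHom.mk' (fun q => AddMonoidHom.mk' (fun w =>
        (a * q) ⊗ₜ[MonoidAlgebra ℂ G] ρ'.asModuleEquiv.symm (ρ.asModuleEquiv w))
        (fun w w' => by rw [map_add, map_add, tmul_add]))
      (fun q q' => by
        ext w
        simp only [AddMonoidHom.mk'_apply, AddMonoidHom.add_apply, mul_add, add_tmul]))
    (fun r q w => by
      simp only [AddMonoidHom.mk'_apply]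
      induction r using MonoidAlgebra.induction_linear with
      | zero => rw [zero_smul, zero_smul, mul_zero, zero_tmul, map_zero, map_zero, tmul_zero]
      | add r s hr hs => rw [add_smul, add_smul, mul_add, add_tmul, hr, hs, map_add, map_add,
          tmul_add]
      | single g c =>
        rw [hi, ← mul_assoc, H, mul_assoc, ← hi, smul_tmul]
        congr 1
        have h1 : ρ.asModuleEquiv (MonoidAlgebra.single g c • w) = c • ρ g (ρ.asModuleEquiv w) := by
          rw [Representation.single_smul]; rfl
        rw [h1, Representation.single_smul]
        show (c * ((χ g)⁻¹ : ℂˣ)) • ρ' g (ρ.asModuleEquiv w) = c • ρ g (ρ.asModuleEquiv w)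
        rw [hW, smul_smul, mul_assoc, Units.inv_mul, mul_one])

/-- `lmulAdd` as a map of right modules. -/
def lmul {A R : Type} [Ring A] [Ring R] [Module (MonoidAlgebra ℂ G) A] [Module Rᵐᵒᵖ A]
    [SMulCommClass (MonoidAlgebra ℂ G) Rᵐᵒᵖ A] [SMulCommClass A Rᵐᵒᵖ A]
    (i : MonoidAlgebra ℂ G →+* A) (hi : ∀ r (q : A), r • q = i r * q) (a : A) (χ : G → ℂˣ)
    (H : ∀ g c, a * i (.single g c) = i (.single g (c * ((χ g)⁻¹ : ℂˣ))) * a)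
    (ρ ρ' : Representation ℂ G W) (hW : ∀ g w, ρ' g w = (χ g : ℂ) • ρ g w) :
    A ⊗[MonoidAlgebra ℂ G] ρ.asModule →ₗ[Rᵐᵒᵖ] A ⊗[MonoidAlgebra ℂ G] ρ'.asModule where
  toFun := lmulAdd i hi a χ H ρ ρ' hW
  map_add' := map_add _
  map_smul' r t := by
    rw [RingHom.id_apply]
    induction t using TensorProduct.induction_on with
    | zero => rw [smul_zero, map_zero, smul_zero]
    | add t t' h h' => rw [smul_add, map_add, h, h', map_add, smul_add]
    | tmul q w =>
      have h1 : ∀ q' : A, lmulAdd i hi a χ H ρ ρ' hW (q' ⊗ₜ w) =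
        (a * q') ⊗ₜ[MonoidAlgebra ℂ G] ρ'.asModuleEquiv.symm (ρ.asModuleEquiv w) := fun _ => rfl
      rw [smul_tmul', h1, h1, smul_tmul']
      congr 1
      exact smul_comm a r q

variable {ε}

theorem Qu.lmul_aux {n : ℕ} (P : SemiInv ε n) (g : G) (c : ℂ) :
    Qu.evalPoly ε τ P.poly * (Qu.ofCG ε τ).toRingHom (.single g c) =
      (Qu.ofCG ε τ).toRingHom (.single g (c * ((ε g ^ n)⁻¹ : ℂˣ))) * Qu.evalPoly ε τ P.poly := by
  have h : ∀ c, (Qu.ofCG ε τ).toRingHom (.single g c) = c • Qu.grp ε τ g := fun c => by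
    simp [Qu.ofCG]
  rw [h, h, smul_mul_assoc, Qu.grp_evalPoly, smul_smul, mul_smul_comm]
  congr 1
  rw [mul_assoc, ← Units.val_pow_eq_pow_val, Units.inv_mul, mul_one]

theorem Bt.lmul_aux {n : ℕ} (P : SemiInv ε n) (g : G) (c : ℂ) :
    Bt.evalPoly ε τ P.poly * (Bt.ofCG ε τ) (.single g c) =
      (Bt.ofCG ε τ) (.single g (c * ((ε g ^ n)⁻¹ : ℂˣ))) * Bt.evalPoly ε τ P.poly := by
  have h : ∀ c, (Bt.ofCG ε τ) (.single g c) = c • Bt.grp ε τ g := fun c => by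
    simp [Bt.ofCG]
  rw [h, h, smul_mul_assoc, Bt.grp_evalPoly, smul_smul, mul_smul_comm]
  congr 1
  rw [mul_assoc, ← Units.val_pow_eq_pow_val, Units.inv_mul, mul_one]

/-- Multiplication by `P(x,z)`, `W ⊗_G Q → (W ⊗ ε^n) ⊗_G Q`. -/
def Qu.lmulPoly {n : ℕ} (P : SemiInv ε n) (ρ ρ' : Representation ℂ G W)
    (hW : ∀ g w, ρ' g w = ((ε g ^ n : ℂˣ) : ℂ) • ρ g w) :
    Qu ε τ ⊗[MonoidAlgebra ℂ G] ρ.asModule →ₗ[(Qu ε τ)ᵐᵒᵖ]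
      Qu ε τ ⊗[MonoidAlgebra ℂ G] ρ'.asModule :=
  lmul (Qu.ofCG ε τ).toRingHom (fun _ _ => rfl) (Qu.evalPoly ε τ P.poly) (fun g => ε g ^ n)
    (Qu.lmul_aux τ P) ρ ρ' hW

/-- Multiplication by `P(x,1)`, `W ⊗_G B_rat → (W ⊗ ε^n) ⊗_G B_rat`. -/
def BRat.lmulPoly {n : ℕ} (P : SemiInv ε n) (ρ ρ' : Representation ℂ G W)
    (hW : ∀ g w, ρ' g w = ((ε g ^ n : ℂˣ) : ℂ) • ρ g w) :
    BRat ε τ ⊗[MonoidAlgebra ℂ G] ρ.asModule →ₗ[(Bt ε τ)ᵐᵒᵖ]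
      BRat ε τ ⊗[MonoidAlgebra ℂ G] ρ'.asModule :=
  lmul (BRat.ofCG ε τ) (fun _ _ => rfl) (BRat.num ε τ (Bt.evalPoly ε τ P.poly))
    (fun g => ε g ^ n)
    (fun g c => by
      have := congrArg (BRat.num ε τ) (Bt.lmul_aux τ P g c)
      rwa [map_mul, map_mul] at this) ρ ρ' hW

/-- Multiplication by an invariant polynomial `p(x)` on `W ⊗_G B_rat`. -/
def BRat.lmulInv {p : Polynomial ℂ} (hp : IsInvPoly ε p) (ρ : Representation ℂ G W) :
    BRat ε τ ⊗[MonoidAlgebra ℂ G] ρ.asModule →ₗ[(Bt ε τ)ᵐᵒᵖ]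
      BRat ε τ ⊗[MonoidAlgebra ℂ G] ρ.asModule :=
  lmul (BRat.ofCG ε τ) (fun _ _ => rfl) (BRat.num ε τ (Polynomial.aeval (Bt.x ε τ) p)) (fun _ => 1)
    (fun g c => by
      have := congrArg (BRat.num ε τ) (hp.ofCG_comm (τ := τ) (.single g c)).symm.eq
      rw [map_mul, map_mul] at this
      simpa [BRat.ofCG] using this) ρ ρ (fun g w => by simp)

variable (ε)

/-- The lattice `W ⊗_G B` inside `W ⊗_G B_rat`. -/
def lattice (ρ : Representation ℂ G W) :
    Submodule (Bt ε τ)ᵐᵒᵖ (BRat ε τ ⊗[MonoidAlgebra ℂ G] ρ.asModule) :=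
  Submodule.span _ (Set.range fun w : ρ.asModule => (1 : BRat ε τ) ⊗ₜ[MonoidAlgebra ℂ G] w)

/-- A right `B`-submodule `N ⊆ W ⊗_G B_rat` is fat if `p (W ⊗_G B) ⊆ N ⊆ p⁻¹ (W ⊗_G B)` for some
nonzero invariant polynomial `p(x)`. -/
def IsFat {ρ : Representation ℂ G W}
    (N : Submodule (Bt ε τ)ᵐᵒᵖ (BRat ε τ ⊗[MonoidAlgebra ℂ G] ρ.asModule)) : Prop :=
  ∃ (p : Polynomial ℂ) (hp : IsInvPoly ε p),
    (lattice ε τ ρ).map (BRat.lmulInv τ hp ρ) ≤ N ∧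
      N ≤ (lattice ε τ ρ).comap (BRat.lmulInv τ hp ρ)

/-- `Gr^B(W)`, the set of fat right `B`-submodules of `W ⊗_G B_rat`. -/
def GrB (ρ : Representation ℂ G W) : Type u :=
  {N : Submodule (Bt ε τ)ᵐᵒᵖ (BRat ε τ ⊗[MonoidAlgebra ℂ G] ρ.asModule) // IsFat ε τ N}

end Tensor

section Graded

/-- A criterion for an internal direct sum decomposition. -/
theorem isInternal_of_proj {ι M : Type*} [DecidableEq ι] [AddCommGroup M] (gr : ι → AddSubgroup M)
    (p : ι → M →+ M) (h1 : ∀ d, ∀ m ∈ gr d, p d m = m) (h2 : ∀ d e, e ≠ d → ∀ m ∈ gr e, p d m = 0)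
    (h3 : ∀ m, m ∈ AddSubgroup.closure (⋃ d, (gr d : Set M))) : DirectSum.IsInternal gr := by
  constructor
  · rw [injective_iff_map_eq_zero]
    intro x hx
    have key : ∀ (d : ι) (x : DirectSum ι fun d => gr d),
        p d (DirectSum.coeAddMonoidHom gr x) = x d := by
      intro d x
      induction x using DirectSum.induction_on with
      | zero => simp
      | of e y =>
        rw [DirectSum.coeAddMonoidHom_of]
        by_cases h : e = d
        · subst h
          rw [h1 e _ y.2, DirectSum.of_eq_same]
        · rw [h2 d e h _ y.2, DirectSum.of_eq_of_ne _ _ _ (Ne.symm h)]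
          rfl
      | add x y hx hy => simp [hx, hy]
    ext d
    rw [← key, hx]
    simp
  · intro m
    have := h3 m
    induction this using AddSubgroup.closure_induction with
    | mem m hm =>
      obtain ⟨d, hd⟩ := Set.mem_iUnion.mp hm
      exact ⟨DirectSum.of (fun d => gr d) d ⟨m, hd⟩, DirectSum.coeAddMonoidHom_of gr d _⟩
    | zero => exact ⟨0, map_zero _⟩
    | add a b _ _ ha hb =>
      obtain ⟨a, rfl⟩ := ha
      obtain ⟨b, rfl⟩ := hb
      exact ⟨a + b, map_add _ _ _⟩
    | neg a _ ha =>
      obtain ⟨a, rfl⟩ := ha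
      exact ⟨-a, map_neg _ _⟩

variable {G : Type} [CommGroup G] (ε : G →* ℂˣ) (τ : MonoidAlgebra ℂ G)

/-- Finitely generated bigraded right `Q`-modules `M = ⊕ M_{i,j}`. -/
structure GrMod : Type (u + 1) where
  carrier : Type u
  [addCommGroup : AddCommGroup carrier]
  [module : Module (Qu ε τ)ᵐᵒᵖ carrier]
  gr : ℤ × ℤ → AddSubgroup carrier
  isInternal : DirectSum.IsInternal gr
  smul_mem : ∀ {d e : ℤ × ℤ} {q : Qu ε τ} {m : carrier}, q ∈ Qu.grading ε τ e → m ∈ gr d →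
    op q • m ∈ gr (d + e)
  finite : Module.Finite (Qu ε τ)ᵐᵒᵖ carrier

attribute [instance] GrMod.addCommGroup GrMod.module

variable {ε τ}

/-- Morphisms of bigraded modules: linear maps preserving the bidegree. -/
@[ext]
structure GrMod.Hom (M N : GrMod.{u} ε τ) : Type u where
  lin : M.carrier →ₗ[(Qu ε τ)ᵐᵒᵖ] N.carrier
  map_gr : ∀ {d : ℤ × ℤ} {m : M.carrier}, m ∈ M.gr d → lin m ∈ N.gr d

instance : Category (GrMod.{u} ε τ) where
  Hom := GrMod.Hom
  id M := ⟨LinearMap.id, fun h => h⟩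
  comp f g := ⟨g.lin.comp f.lin, fun h => g.map_gr (f.map_gr h)⟩

theorem GrMod.hom_ext {M N : GrMod.{u} ε τ} {f g : M ⟶ N} (h : f.lin = g.lin) : f = g :=
  GrMod.Hom.ext h

theorem GrMod.id_lin (M : GrMod.{u} ε τ) : (𝟙 M : M ⟶ M).lin = LinearMap.id := rfl
theorem GrMod.comp_lin {M N K : GrMod.{u} ε τ} (f : M ⟶ N) (g : N ⟶ K) :
    (f ≫ g).lin = g.lin.comp f.lin := rfl

/-- The homogeneous components span. -/
theorem GrMod.mem_closure (M : GrMod.{u} ε τ) (m : M.carrier) :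
    m ∈ AddSubgroup.closure (⋃ d, (M.gr d : Set M.carrier)) := by
  obtain ⟨x, rfl⟩ := M.isInternal.2 m
  induction x using DirectSum.induction_on with
  | zero => rw [map_zero]; exact zero_mem _
  | of d y =>
    rw [DirectSum.coeAddMonoidHom_of]
    exact AddSubgroup.subset_closure (Set.mem_iUnion.mpr ⟨d, y.2⟩)
  | add x y hx hy => rw [map_add]; exact add_mem hx hy

/-- Induction on homogeneous elements. -/
theorem GrMod.gr_induction (M : GrMod.{u} ε τ) {C : M.carrier → Prop} (h0 : C 0)
    (hg : ∀ d, ∀ m ∈ M.gr d, C m) (ha : ∀ m n, C m → C n → C (m + n)) (m : M.carrier) : C m := by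
  obtain ⟨x, rfl⟩ := M.isInternal.2 m
  induction x using DirectSum.induction_on with
  | zero => rw [map_zero]; exact h0
  | of d y => rw [DirectSum.coeAddMonoidHom_of]; exact hg d _ y.2
  | add x y hx hy => rw [map_add]; exact ha _ _ hx hy

/-- The projection onto a homogeneous component. -/
def GrMod.proj (M : GrMod.{u} ε τ) (d : ℤ × ℤ) : M.carrier →+ M.carrier :=
  (M.gr d).subtype.comp ((DirectSum.component ℤ (ℤ × ℤ) (fun d => M.gr d) d).toAddMonoidHom.comp
    (AddEquiv.ofBijective (DirectSum.coeAddMonoidHom M.gr) M.isInternal).symm.toAddMonoidHom)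

theorem GrMod.proj_mem (M : GrMod.{u} ε τ) (d : ℤ × ℤ) (m : M.carrier) : M.proj d m ∈ M.gr d :=
  Subtype.property _

theorem GrMod.proj_of_mem_gen (M : GrMod.{u} ε τ) (d e : ℤ × ℤ) {m : M.carrier} (hm : m ∈ M.gr e) :
    M.proj d m = if e = d then m else 0 := by
  have h : (AddEquiv.ofBijective (DirectSum.coeAddMonoidHom M.gr) M.isInternal).symm m =
      DirectSum.of (fun d => M.gr d) e ⟨m, hm⟩ := by
    rw [AddEquiv.symm_apply_eq]
    exact (DirectSum.coeAddMonoidHom_of M.gr e ⟨m, hm⟩).symm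
  show ((AddEquiv.ofBijective (DirectSum.coeAddMonoidHom M.gr) M.isInternal).symm m d :
    M.carrier) = _
  rw [h]
  split_ifs with hed
  · subst hed; rw [DirectSum.of_eq_same]
  · rw [DirectSum.of_eq_of_ne _ _ _ (Ne.symm hed)]; rfl

/-- Right multiplication by a central element. -/
def rmul {M : Type u} [AddCommGroup M] [Module (Qu ε τ)ᵐᵒᵖ M] (g : Qu ε τ)
    (hg : ∀ q, Commute g q) : M →ₗ[(Qu ε τ)ᵐᵒᵖ] M where
  toFun m := op g • m
  map_add' := smul_add _
  map_smul' q m := by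
    rw [RingHom.id_apply, smul_smul, smul_smul, ← op_unop q, ← op_mul, ← op_mul,
      (hg q.unop).eq]

theorem rmul_apply {M : Type u} [AddCommGroup M] [Module (Qu ε τ)ᵐᵒᵖ M] (g : Qu ε τ)
    (hg : ∀ q, Commute g q) (m : M) : rmul g hg m = op g • m := rfl

theorem GrMod.proj_rmul (M : GrMod.{u} ε τ) {g : Qu ε τ} {e : ℤ × ℤ}
    (he : g ∈ Qu.grading ε τ e) (d : ℤ × ℤ) (m : M.carrier) :
    M.proj d (op g • m) = op g • M.proj (d - e) m := by
  induction m using M.gr_induction with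
  | h0 => simp
  | hg c m hm =>
    rw [M.proj_of_mem_gen _ _ hm, M.proj_of_mem_gen _ _ (M.smul_mem he hm)]
    by_cases h : c + e = d
    · rw [if_pos h, if_pos (eq_sub_of_add_eq h)]
    · rw [if_neg h, if_neg (fun h' => h (by rw [h']; abel)), smul_zero]
  | ha m n h h' => rw [smul_add, map_add, h, h', map_add, smul_add]

/-- The bigraded module `M / M g` for a homogeneous central element `g`. -/
abbrev GrMod.quot (g : Qu ε τ) (hg : ∀ q, Commute g q) (e : ℤ × ℤ) (he : g ∈ Qu.grading ε τ e)
    (M : GrMod.{u} ε τ) : GrMod.{u} ε τ where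
  carrier := M.carrier ⧸ LinearMap.range (rmul (M := M.carrier) g hg)
  gr d := (M.gr d).map (Submodule.mkQ (LinearMap.range (rmul (M := M.carrier) g hg))).toAddMonoidHom
  isInternal := by
    have hp : ∀ d, (LinearMap.range (rmul (M := M.carrier) g hg)).toAddSubgroup ≤
        ((QuotientAddGroup.mk' (LinearMap.range (rmul (M := M.carrier) g hg)).toAddSubgroup).comp
          (M.proj d)).ker := by
      rintro d _ ⟨m, rfl⟩
      rw [AddMonoidHom.mem_ker, AddMonoidHom.comp_apply, rmul_apply, M.proj_rmul he]
      exact (QuotientAddGroup.eq_zero_iff _).mpr ⟨M.proj (d - e) m, rfl⟩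
    refine isInternal_of_proj _ (fun d => QuotientAddGroup.lift _ _ (hp d)) ?_ ?_ ?_
    · rintro d _ ⟨m, hm, rfl⟩
      show Submodule.Quotient.mk (M.proj d m) = Submodule.Quotient.mk m
      rw [M.proj_of_mem_gen _ _ hm, if_pos rfl]
    · rintro d c hcd _ ⟨m, hm, rfl⟩
      show Submodule.Quotient.mk (M.proj d m) = 0
      rw [M.proj_of_mem_gen _ _ hm, if_neg hcd, Submodule.Quotient.mk_zero]
    · intro m
      obtain ⟨m, rfl⟩ := Submodule.mkQ_surjective _ m
      induction m using M.gr_induction with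
      | h0 => rw [map_zero]; exact zero_mem _
      | hg d m hm =>
        exact AddSubgroup.subset_closure (Set.mem_iUnion.mpr ⟨d, m, hm, rfl⟩)
      | ha m n h h' => rw [map_add]; exact add_mem h h'
  smul_mem := by
    rintro d c q _ hq ⟨m, hm, rfl⟩
    exact ⟨op q • m, M.smul_mem hq hm, map_smul (Submodule.mkQ _) _ _⟩
  finite := by
    have := M.finite
    infer_instance

/-- The map `M / M g → N / N g` induced by `M → N`. -/
def GrMod.quotMap (g : Qu ε τ) (hg : ∀ q, Commute g q) (e : ℤ × ℤ) (he : g ∈ Qu.grading ε τ e)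
    {M N : GrMod.{u} ε τ} (f : M ⟶ N) :
    GrMod.quot g hg e he M ⟶ GrMod.quot g hg e he N where
  lin := Submodule.mapQ _ _ f.lin (by
    rintro _ ⟨m, rfl⟩
    exact ⟨f.lin m, (map_smul f.lin _ _).symm⟩)
  map_gr := by
    rintro d _ ⟨m, hm, rfl⟩
    exact ⟨f.lin m, f.map_gr hm, rfl⟩

/-- A bigraded module is torsion if `M_{i,j} = 0` for `i, j` large. For a morphism this says
that its kernel and cokernel are torsion, i.e. vanish in bidegrees `(i,j)`
with `i > i₀` and `j > j₀`. -/
def torIso : MorphismProperty (GrMod.{u} ε τ) := fun M N f =>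
  (∃ c : ℤ × ℤ, ∀ d : ℤ × ℤ, c.1 < d.1 → c.2 < d.2 → ∀ m ∈ M.gr d, f.lin m = 0 → m = 0) ∧
  (∃ c : ℤ × ℤ, ∀ d : ℤ × ℤ, c.1 < d.1 → c.2 < d.2 → ∀ n ∈ N.gr d, n ∈ LinearMap.range f.lin)

theorem torIso.surj_deg {M N : GrMod.{u} ε τ} (f : M ⟶ N) {d : ℤ × ℤ} {n : N.carrier}
    (hn : n ∈ N.gr d) (h : n ∈ LinearMap.range f.lin) : ∃ m ∈ M.gr d, f.lin m = n := by
  obtain ⟨m, rfl⟩ := h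
  have key : ∀ m, f.lin (M.proj d m) = N.proj d (f.lin m) := by
    intro m
    induction m using M.gr_induction with
    | h0 => simp
    | hg c m hm =>
      rw [M.proj_of_mem_gen _ _ hm, N.proj_of_mem_gen _ _ (f.map_gr hm)]
      split_ifs
      · rfl
      · simp
    | ha m n h h' => simp [h, h']
  refine ⟨M.proj d m, M.proj_mem d m, ?_⟩
  rw [key, N.proj_of_mem_gen _ _ hn, if_pos rfl]

end Graded

section Coh

variable {G : Type} [CommGroup G] {ε : G →* ℂˣ} {τ : MonoidAlgebra ℂ G}

theorem GrMod.quotMap_torIso (g : Qu ε τ) (hg : ∀ q, Commute g q) (e : ℤ × ℤ)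
    (he : g ∈ Qu.grading ε τ e) {M N : GrMod.{u} ε τ} (f : M ⟶ N) (hf : torIso f) :
    torIso (GrMod.quotMap g hg e he f) := by
  obtain ⟨⟨a, ha⟩, ⟨b, hb⟩⟩ := hf
  refine ⟨⟨(max a.1 (b.1 + e.1), max a.2 (b.2 + e.2)), ?_⟩, ⟨b, ?_⟩⟩
  · rintro d h1 h2 _ ⟨m, hm, rfl⟩ h0
    have h0' : Submodule.Quotient.mk (p := LinearMap.range (rmul (M := N.carrier) g hg))
      (f.lin m) = 0 := h0
    rw [Submodule.Quotient.mk_eq_zero] at h0'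
    obtain ⟨n, hn⟩ := h0'
    rw [rmul_apply] at hn
    have hn2 : op g • N.proj (d - e) n = f.lin m := by
      rw [← N.proj_rmul he, hn, N.proj_of_mem_gen _ _ (f.map_gr hm), if_pos rfl]
    simp only [max_lt_iff] at h1 h2
    obtain ⟨m', hm', hm2⟩ := torIso.surj_deg f (N.proj_mem (d - e) n)
      (hb (d - e) (by rw [Prod.fst_sub]; omega) (by rw [Prod.snd_sub]; omega) _ (N.proj_mem _ _))
    have hk : f.lin (m - op g • m') = 0 := by
      rw [map_sub, map_smul, hm2, hn2, sub_self]
    have hmem : m - op g • m' ∈ M.gr d := by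
      refine sub_mem hm ?_
      have := M.smul_mem he hm'
      rwa [sub_add_cancel] at this
    have := ha d h1.1 h2.1 _ hmem hk
    show Submodule.Quotient.mk (p := LinearMap.range (rmul (M := M.carrier) g hg)) m = 0
    rw [Submodule.Quotient.mk_eq_zero]
    exact ⟨m', (sub_eq_zero.mp this).symm⟩
  · rintro d h1 h2 _ ⟨n, hn, rfl⟩
    obtain ⟨m, rfl⟩ := hb d h1 h2 n hn
    exact ⟨Submodule.Quotient.mk m, rfl⟩

variable (ε τ) in
/-- `coh` of the noncommutative quadric: the quotient category of finitely generated bigraded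
right `Q`-modules by torsion modules, i.e. the localization at the morphisms with
torsion kernel and cokernel. -/
abbrev Coh := (torIso (ε := ε) (τ := τ) : MorphismProperty (GrMod.{u} ε τ)).Localization

variable (ε τ) in
/-- The projection functor `π`. -/
abbrev piFun : GrMod.{u} ε τ ⥤ Coh.{u} ε τ := torIso.Q

/-- Bigraded `Q`-modules killed by `g`, i.e. bigraded `Q / gQ`-modules for central `g`. -/
def killed (g : Qu ε τ) : ObjectProperty (GrMod.{u} ε τ) := fun M => ∀ m : M.carrier, op g • m = 0

/-- The quotient category of finitely generated bigraded `Q / gQ`-modules by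
torsion modules. For `g = z`, `g = w` these are the coherent sheaves on the two lines. -/
abbrev CohLine (g : Qu ε τ) := (torIso.inverseImage (killed.{u} g).ι).Localization

/-- `M ↦ M / M g` as a functor to bigraded `Q / gQ`-modules. -/
def quotFun (g : Qu ε τ) (hg : ∀ q, Commute g q) (e : ℤ × ℤ) (he : g ∈ Qu.grading ε τ e) :
    GrMod.{u} ε τ ⥤ (killed.{u} g).FullSubcategory where
  obj M := ⟨GrMod.quot g hg e he M, fun m => by
    obtain ⟨m, rfl⟩ := Submodule.mkQ_surjective _ m
    exact (Submodule.Quotient.mk_eq_zero _).mpr ⟨m, rfl⟩⟩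
  map f := ObjectProperty.homMk (GrMod.quotMap g hg e he f)
  map_id M := by
    apply ObjectProperty.hom_ext
    apply GrMod.hom_ext
    apply LinearMap.ext
    intro m
    obtain ⟨m, rfl⟩ := Submodule.mkQ_surjective _ m
    rfl
  map_comp f h := by
    apply ObjectProperty.hom_ext
    apply GrMod.hom_ext
    apply LinearMap.ext
    intro m
    obtain ⟨m, rfl⟩ := Submodule.mkQ_surjective _ m
    rfl

/-- The restriction functor to the line `g = 0`, induced by `M ↦ M / M g`. -/
def restrict (g : Qu ε τ) (hg : ∀ q, Commute g q) (e : ℤ × ℤ) (he : g ∈ Qu.grading ε τ e) :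
    Coh.{u} ε τ ⥤ CohLine.{u} g :=
  Localization.Construction.lift
    (quotFun g hg e he ⋙ (torIso.inverseImage (killed.{u} g).ι).Q) (fun _ _ f hf =>
      MorphismProperty.Q_inverts _ _ (GrMod.quotMap_torIso g hg e he f hf))

variable (ε τ) in
/-- `i_z^*`. -/
def izStar : Coh.{u} ε τ ⥤ CohLine.{u} (Qu.z ε τ) :=
  restrict (Qu.z ε τ) (Qu.z_comm ε τ) (1, 0) (Qu.gen_mem ε τ .z)

variable (ε τ) in
/-- `i_w^*`. -/
def iwStar : Coh.{u} ε τ ⥤ CohLine.{u} (Qu.w ε τ) :=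
  restrict (Qu.w ε τ) (Qu.w_comm ε τ) (0, 1) (Qu.gen_mem ε τ .w)

end Coh

section Free

variable {G : Type} [CommGroup G] (ε : G →* ℂˣ) (τ : MonoidAlgebra ℂ G)
variable {W : Type u} [AddCommGroup W] [Module ℂ W]

theorem Qu.grp_mul_coact (r : MonoidAlgebra ℂ G) (q : Qu ε τ) (d : ℤ × ℤ) :
    (Qu.coact ε τ (Qu.ofCG ε τ r * q)).coeff d =
      Qu.ofCG ε τ r * (Qu.coact ε τ q).coeff d := by
  have hr : Qu.ofCG ε τ r ∈ Qu.grading ε τ 0 := by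
    rw [Qu.ofCG, MonoidAlgebra.lift_apply]
    exact Submodule.sum_mem _ fun g _ => Submodule.smul_mem _ _ (Qu.gen_mem ε τ (.grp g))
  rw [map_mul, Qu.coact_of_mem ε τ hr, AddMonoidAlgebra.coeff_single_mul_apply]
  simp

/-- The projection of `Q` onto `Q_d`, as a map of left modules over the group algebra. -/
def Qu.proj (d : ℤ × ℤ) : Qu ε τ →ₗ[MonoidAlgebra ℂ G] Qu ε τ where
  toFun q := (Qu.coact ε τ q).coeff d
  map_add' a b := by rw [map_add]; rfl
  map_smul' r q := Qu.grp_mul_coact ε τ r q d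

theorem Qu.proj_of_mem {d e : ℤ × ℤ} {q : Qu ε τ} (hq : q ∈ Qu.grading ε τ e) :
    Qu.proj ε τ d q = if e = d then q else 0 := by
  show (Qu.coact ε τ q).coeff d = _
  rw [Qu.coact_of_mem ε τ hq, AddMonoidAlgebra.coeff_single, Finsupp.single_apply]

/-- The component `W ⊗_G Q_d` of `W ⊗_G Q`. -/
def freeGr (ρ : Representation ℂ G W) (d : ℤ × ℤ) :
    AddSubgroup (Qu ε τ ⊗[MonoidAlgebra ℂ G] ρ.asModule) :=
  AddSubgroup.closure {t | ∃ q ∈ Qu.grading ε τ d, ∃ w, t = q ⊗ₜ w}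

variable {ε} in
theorem lmulPoly_mem {k : ℕ} (P : SemiInv ε k) (ρ ρ' : Representation ℂ G W)
    (hW : ∀ g w, ρ' g w = ((ε g ^ k : ℂˣ) : ℂ) • ρ g w) (d : ℤ × ℤ)
    {m : Qu ε τ ⊗[MonoidAlgebra ℂ G] ρ.asModule} (hm : m ∈ freeGr ε τ ρ d) :
    Qu.lmulPoly τ P ρ ρ' hW m ∈ freeGr ε τ ρ' (d + ((k : ℤ), 0)) := by
  induction hm using AddSubgroup.closure_induction with
  | mem m hm =>
    obtain ⟨q, hq, w, rfl⟩ := hm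
    refine AddSubgroup.subset_closure ⟨Qu.evalPoly ε τ P.poly * q, ?_,
      ρ'.asModuleEquiv.symm (ρ.asModuleEquiv w), rfl⟩
    rw [add_comm]
    exact Qu.mul_mem ε τ (Qu.evalPoly_mem τ P) hq
  | zero => rw [map_zero]; exact zero_mem _
  | add a b _ _ ha hb => rw [map_add]; exact add_mem ha hb
  | neg a _ ha => rw [map_neg]; exact neg_mem ha

/-- The bigraded module `(W ⊗_G Q)(s)`, with components `W ⊗_G Q_{d+s}`
(written with the tensor factors in the order `Q ⊗ W`). -/
abbrev freeMod [FiniteDimensional ℂ W] (ρ : Representation ℂ G W) (s : ℤ × ℤ) : GrMod.{u} ε τ where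
  carrier := Qu ε τ ⊗[MonoidAlgebra ℂ G] ρ.asModule
  gr d := freeGr ε τ ρ (d + s)
  isInternal := by
    refine isInternal_of_proj _
      (fun d => (LinearMap.rTensor ρ.asModule (Qu.proj ε τ (d + s))).toAddMonoidHom) ?_ ?_ ?_
    · intro d m hm
      induction hm using AddSubgroup.closure_induction with
      | mem m hm =>
        obtain ⟨q, hq, w, rfl⟩ := hm
        show LinearMap.rTensor ρ.asModule (Qu.proj ε τ (d + s)) (q ⊗ₜ w) = _
        rw [LinearMap.rTensor_tmul, Qu.proj_of_mem ε τ hq, if_pos rfl]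
      | zero => exact map_zero _
      | add a b _ _ ha hb => rw [map_add, ha, hb]
      | neg a _ ha => rw [map_neg, ha]
    · intro d e hde m hm
      induction hm using AddSubgroup.closure_induction with
      | mem m hm =>
        obtain ⟨q, hq, w, rfl⟩ := hm
        show LinearMap.rTensor ρ.asModule (Qu.proj ε τ (d + s)) (q ⊗ₜ w) = _
        rw [LinearMap.rTensor_tmul, Qu.proj_of_mem ε τ hq,
          if_neg (fun h => hde (add_right_cancel h)), zero_tmul]
      | zero => exact map_zero _
      | add a b _ _ ha hb => rw [map_add, ha, hb, add_zero]
      | neg a _ ha => rw [map_neg, ha, neg_zero]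
    · intro m
      induction m using TensorProduct.induction_on with
      | zero => exact zero_mem _
      | add a b ha hb => exact add_mem ha hb
      | tmul q w =>
        have hq : q ∈ ⨆ d, Qu.grading ε τ d := by rw [Qu.iSup_grading]; trivial
        induction hq using Submodule.iSup_induction' with
        | mem d q hq =>
          refine AddSubgroup.subset_closure (Set.mem_iUnion.mpr ⟨d - s, ?_⟩)
          exact AddSubgroup.subset_closure ⟨q, by rwa [sub_add_cancel], w, rfl⟩
        | zero => rw [zero_tmul]; exact zero_mem _
        | add a b _ _ ha hb => rw [add_tmul]; exact add_mem ha hb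
  smul_mem := by
    intro d e q m hq hm
    induction hm using AddSubgroup.closure_induction with
    | mem m hm =>
      obtain ⟨q', hq', w, rfl⟩ := hm
      refine AddSubgroup.subset_closure ⟨q' * q, ?_, w, ?_⟩
      · have := Qu.mul_mem ε τ hq' hq
        rwa [add_right_comm] at this
      · rw [smul_tmul']; rfl
    | zero => rw [smul_zero]; exact zero_mem _
    | add a b _ _ ha hb => rw [smul_add]; exact add_mem ha hb
    | neg a _ ha => rw [smul_neg]; exact neg_mem ha
  finite := by
    obtain ⟨S, hS⟩ := (inferInstance : Module.Finite ℂ ρ.asModule)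
    refine ⟨⟨(S.finite_toSet.image fun w : ρ.asModule =>
      (1 : Qu ε τ) ⊗ₜ[MonoidAlgebra ℂ G] w).toFinset, ?_⟩⟩
    rw [Set.Finite.coe_toFinset, eq_top_iff]
    rintro t -
    induction t using TensorProduct.induction_on with
    | zero => exact zero_mem _
    | add a b ha hb => exact add_mem ha hb
    | tmul q w =>
      have h1 : q ⊗ₜ[MonoidAlgebra ℂ G] w = op q • ((1 : Qu ε τ) ⊗ₜ[MonoidAlgebra ℂ G] w) := by
        rw [smul_tmul', op_smul_eq_mul, one_mul]
      rw [h1]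
      refine Submodule.smul_mem _ _ ?_
      have hw : w ∈ Submodule.span ℂ (S : Set ρ.asModule) := by rw [hS]; trivial
      induction hw using Submodule.span_induction with
      | mem w hw => exact Submodule.subset_span ⟨w, hw, rfl⟩
      | zero => rw [tmul_zero]; exact zero_mem _
      | add a b _ _ ha hb => 
        rw [tmul_add]
        exact add_mem (ha (by rw [smul_tmul', op_smul_eq_mul, one_mul]))
          (hb (by rw [smul_tmul', op_smul_eq_mul, one_mul]))
      | smul c a _ ha =>
        have h2 : (1 : Qu ε τ) ⊗ₜ[MonoidAlgebra ℂ G] (c • a) =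
            op (algebraMap ℂ (Qu ε τ) c) • ((1 : Qu ε τ) ⊗ₜ[MonoidAlgebra ℂ G] a) := by
          have h3 : c • a = (algebraMap ℂ (MonoidAlgebra ℂ G) c) • a := by
            rw [algebraMap_smul]
          rw [h3, ← smul_tmul, smul_tmul', op_smul_eq_mul, one_mul, Qu.cg_smul, AlgHom.commutes,
            mul_one]
        rw [h2]
        exact Submodule.smul_mem _ _ (ha (by rw [smul_tmul', op_smul_eq_mul, one_mul]))

variable {ε} in
/-- Multiplication by a semiinvariant homogeneous polynomial of degree `k`, as a morphism
`(W ⊗_G Q)(a,0) → ((W ⊗ ε^k) ⊗_G Q)(a + k,0)` of bigraded modules. -/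
def mulMod [FiniteDimensional ℂ W] {k : ℕ} (P : SemiInv ε k) (ρ ρ' : Representation ℂ G W)
    (hW : ∀ g w, ρ' g w = ((ε g ^ k : ℂˣ) : ℂ) • ρ g w) (a b : ℤ) (hab : b = a + k) :
    freeMod ε τ ρ (a, 0) ⟶ freeMod ε τ ρ' (b, 0) where
  lin := Qu.lmulPoly τ P ρ ρ' hW
  map_gr := by
    intro d m hm
    have h := lmulPoly_mem τ P ρ ρ' hW _ hm
    have hd : d + (a, (0 : ℤ)) + ((k : ℤ), 0) = d + (b, 0) := by
      subst hab
      rw [add_assoc]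
      simp
    rwa [hd] at h

/-- The sheaf `(W ⊗ ε^n) ⊗_G O(n,0)`. -/
def twistedO [FiniteDimensional ℂ W] (ρ : Representation ℂ G W) (n : ℤ) : Coh.{u} ε τ :=
  (piFun ε τ).obj (freeMod ε τ (twist ρ (ε ^ n)) (n, 0))

theorem twist_shift (ρ : Representation ℂ G W) {a b : ℤ} {k : ℕ} (hab : b = a + k) (g : G) (w : W) :
    twist ρ (ε ^ b) g w = ((ε g ^ k : ℂˣ) : ℂ) • twist ρ (ε ^ a) g w := by
  subst hab
  show ((ε g ^ (a + (k : ℤ)) : ℂˣ) : ℂ) • ρ g w =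
    ((ε g ^ k : ℂˣ) : ℂ) • ((ε g ^ a : ℂˣ) : ℂ) • ρ g w
  rw [smul_smul, ← Units.val_mul]
  congr 2
  rw [zpow_add, mul_comm, zpow_natCast]

variable {ε} in
/-- Multiplication by a semiinvariant homogeneous polynomial of degree `k`,
`(W ⊗ ε^a) ⊗_G O(a,0) → (W ⊗ ε^b) ⊗_G O(b,0)`, `b = a + k`. -/
def mulPoly [FiniteDimensional ℂ W] {k : ℕ} (P : SemiInv ε k) (ρ : Representation ℂ G W) (a b : ℤ)
    (hab : b = a + k) : twistedO ε τ ρ a ⟶ twistedO ε τ ρ b :=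
  (piFun ε τ).map (mulMod τ P _ _ (twist_shift ε ρ hab) a b hab)

end Free

section Affine

variable {G : Type} [CommGroup G] {ε : G →* ℂˣ} {τ : MonoidAlgebra ℂ G}

/-- The submodule `M(z-1) + M(w-1)`. -/
def jKer (M : GrMod.{u} ε τ) : Submodule (Qu ε τ)ᵐᵒᵖ M.carrier :=
  LinearMap.range (rmul (M := M.carrier) (Qu.z ε τ) (Qu.z_comm ε τ) - LinearMap.id) ⊔
    LinearMap.range (rmul (M := M.carrier) (Qu.w ε τ) (Qu.w_comm ε τ) - LinearMap.id)

/-- The quotient `M / (M(z-1) + M(w-1))`. -/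
def JCarrier (M : GrMod.{u} ε τ) : Type u := M.carrier ⧸ jKer M

instance (M : GrMod.{u} ε τ) : AddCommGroup (JCarrier M) :=
  inferInstanceAs (AddCommGroup (M.carrier ⧸ jKer M))
instance (M : GrMod.{u} ε τ) : Module (Qu ε τ)ᵐᵒᵖ (JCarrier M) :=
  inferInstanceAs (Module (Qu ε τ)ᵐᵒᵖ (M.carrier ⧸ jKer M))

/-- The quotient map `M → M / (M(z-1) + M(w-1))`. -/
def jMk (M : GrMod.{u} ε τ) : M.carrier →ₗ[(Qu ε τ)ᵐᵒᵖ] JCarrier M := (jKer M).mkQ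

theorem jMk_surj (M : GrMod.{u} ε τ) : Function.Surjective (jMk M) := Submodule.mkQ_surjective _

theorem jMk_eq_zero (M : GrMod.{u} ε τ) (m : M.carrier) : jMk M m = 0 ↔ m ∈ jKer M :=
  Submodule.Quotient.mk_eq_zero _

theorem mem_jKer (M : GrMod.{u} ε τ) (m : M.carrier) : m ∈ jKer M ↔
    ∃ a b : M.carrier, (op (Qu.z ε τ) • a - a) + (op (Qu.w ε τ) • b - b) = m := by
  rw [jKer, Submodule.mem_sup]
  constructor
  · rintro ⟨_, ⟨a, rfl⟩, _, ⟨b, rfl⟩, rfl⟩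
    exact ⟨a, b, rfl⟩
  · rintro ⟨a, b, rfl⟩
    exact ⟨_, ⟨a, rfl⟩, _, ⟨b, rfl⟩, rfl⟩

theorem jMk_z (M : GrMod.{u} ε τ) (v : JCarrier M) : op (Qu.z ε τ) • v = v := by
  obtain ⟨m, rfl⟩ := jMk_surj M v
  rw [← map_smul, ← sub_eq_zero, ← map_sub, jMk_eq_zero, mem_jKer]
  exact ⟨m, 0, by simp⟩

theorem jMk_w (M : GrMod.{u} ε τ) (v : JCarrier M) : op (Qu.w ε τ) • v = v := by
  obtain ⟨m, rfl⟩ := jMk_surj M v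
  rw [← map_smul, ← sub_eq_zero, ← map_sub, jMk_eq_zero, mem_jKer]
  exact ⟨0, m, by simp⟩

variable (ε τ) in
/-- The lift of words in `x, y, g` from `B` to `Q`. -/
def sect : FreeAlgebra ℂ (BGen G) →ₐ[ℂ] Qu ε τ :=
  FreeAlgebra.lift ℂ fun t => match t with
    | .grp g => Qu.gen ε τ (.grp g)
    | .x => Qu.x ε τ
    | .y => Qu.y ε τ

theorem sect_rel (M : GrMod.{u} ε τ) {a b : FreeAlgebra ℂ (BGen G)} (h : BRel ε τ a b)
    (v : JCarrier M) : op (sect ε τ a) • v = op (sect ε τ b) • v := by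
  cases h with
  | grp_one =>
    congr 2
    simpa [sect, Qu.gen] using Qu.mk_rel (ε := ε) (τ := τ) QRel.grp_one
  | grp_mul g h =>
    congr 2
    simpa [sect, Qu.gen] using Qu.mk_rel (ε := ε) (τ := τ) (QRel.grp_mul g h)
  | grp_x g =>
    congr 2
    simpa [sect, Qu.gen] using Qu.mk_rel (ε := ε) (τ := τ) (QRel.grp_x g)
  | grp_y g =>
    congr 2
    simpa [sect, Qu.gen] using Qu.mk_rel (ε := ε) (τ := τ) (QRel.grp_y g)
  | yx =>
    have h1 : sect ε τ (liftGrp .grp τ) = Qu.ofCG ε τ τ := by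
      simp [liftGrp, Finsupp.sum, sect, map_sum, Qu.ofCG, MonoidAlgebra.lift_apply, Qu.grp_apply]
    have h2 : sect ε τ (FreeAlgebra.ι ℂ .y * FreeAlgebra.ι ℂ .x -
        FreeAlgebra.ι ℂ .x * FreeAlgebra.ι ℂ .y) =
        Qu.ofCG ε τ τ * (Qu.z ε τ * Qu.w ε τ) := by
      rw [← Qu.yx]; simp [sect]
    rw [h1, h2, op_mul, op_mul, mul_smul, mul_smul, jMk_z, jMk_w]

/-- The right action of `B` on `M / (M(z-1) + M(w-1))`. -/
def jAct (M : GrMod.{u} ε τ) : (Bt ε τ)ᵐᵒᵖ →+* AddMonoid.End (JCarrier M) :=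
  let T : Qu ε τ →+* (AddMonoid.End (JCarrier M))ᵐᵒᵖ :=
    { toFun := fun q => op (Module.toAddMonoidEnd (Qu ε τ)ᵐᵒᵖ (JCarrier M) (op q))
      map_one' := by rw [op_one, map_one]; rfl
      map_zero' := by rw [op_zero, map_zero]; rfl
      map_add' := fun a b => by rw [MulOpposite.op_add, map_add]; rfl
      map_mul' := fun a b => by rw [op_mul, map_mul]; rfl }
  let F : Bt ε τ →+* (AddMonoid.End (JCarrier M))ᵐᵒᵖ :=
    RingQuot.lift ⟨T.comp (sect ε τ).toRingHom, fun a b h =>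
      congrArg op (AddMonoidHom.ext fun v => sect_rel M h v)⟩
  { toFun := fun b => unop (F (unop b))
    map_one' := by rw [unop_one, map_one]; rfl
    map_zero' := by rw [unop_zero, map_zero]; rfl
    map_add' := fun a b => by rw [MulOpposite.unop_add, map_add]; rfl
    map_mul' := fun a b => by rw [unop_mul, map_mul]; rfl }

/-- `M / (M(z-1) + M(w-1))` as a right `B`-module. -/
instance (M : GrMod.{u} ε τ) : Module (Bt ε τ)ᵐᵒᵖ (JCarrier M) :=
  Module.compHom (JCarrier M) (jAct M)

theorem jAct_mk (M : GrMod.{u} ε τ) (t : FreeAlgebra ℂ (BGen G)) (v : JCarrier M) :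
    op (Bt.mk ε τ t) • v = op (sect ε τ t) • v := by
  have h : Bt.mk ε τ t = RingQuot.mkRingHom (BRel ε τ) t := by
    rw [← RingQuot.mkAlgHom_coe ℂ]; rfl
  show (jAct M (op (Bt.mk ε τ t))) v = _
  rw [h]
  simp only [jAct]
  exact congrArg (fun f : (AddMonoid.End (JCarrier M))ᵐᵒᵖ => f.unop v) (RingQuot.lift_mkRingHom_apply _ _ _)

/-- The map induced on `M / (M(z-1) + M(w-1))`. -/
def jMap {M N : GrMod.{u} ε τ} (f : M ⟶ N) : JCarrier M →ₗ[(Bt ε τ)ᵐᵒᵖ] JCarrier N :=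
  let F : JCarrier M →ₗ[(Qu ε τ)ᵐᵒᵖ] JCarrier N := Submodule.mapQ (jKer M) (jKer N) f.lin (by
    intro m hm
    obtain ⟨a, b, rfl⟩ := (mem_jKer M m).mp hm
    refine (mem_jKer N _).mpr ⟨f.lin a, f.lin b, ?_⟩
    simp only [map_add, map_sub, map_smul])
  { toFun := F
    map_add' := map_add F
    map_smul' := fun b v => by
      obtain ⟨t, ht⟩ := Bt.mk_surj (unop b)
      have hb : b = op (Bt.mk ε τ t) := by rw [ht, op_unop]
      rw [RingHom.id_apply, hb, jAct_mk, jAct_mk, map_smul] }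

theorem jMap_mk {M N : GrMod.{u} ε τ} (f : M ⟶ N) (m : M.carrier) :
    jMap f (jMk M m) = jMk N (f.lin m) := rfl

variable (ε τ) in
/-- `M ↦ M / (M(z-1) + M(w-1))`, as a functor to right `B`-modules. -/
def jFun : GrMod.{u} ε τ ⥤ ModuleCat.{u} (Bt ε τ)ᵐᵒᵖ where
  obj M := ModuleCat.of _ (JCarrier M)
  map f := ModuleCat.ofHom (jMap f)
  map_id M := by
    apply ModuleCat.hom_ext
    apply LinearMap.ext
    intro v
    obtain ⟨m, rfl⟩ := jMk_surj M v
    rfl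
  map_comp f g := by
    apply ModuleCat.hom_ext
    apply LinearMap.ext
    intro v
    obtain ⟨m, rfl⟩ := jMk_surj _ v
    rfl

theorem jMk_pow (M : GrMod.{u} ε τ) (k : ℕ) (m : M.carrier) :
    jMk M (op ((Qu.z ε τ * Qu.w ε τ) ^ k) • m) = jMk M m := by
  induction k generalizing m with
  | zero => simp
  | succ k ih =>
    rw [pow_succ, op_mul, mul_smul, map_smul, op_mul, mul_smul, jMk_z, jMk_w, ih]

theorem Qu.zw_pow_mem (k : ℕ) :
    (Qu.z ε τ * Qu.w ε τ) ^ k ∈ Qu.grading ε τ ((k : ℤ), (k : ℤ)) := by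
  induction k with
  | zero => rw [pow_zero]; exact Qu.one_mem ε τ
  | succ k ih =>
    rw [pow_succ]
    have h1 : Qu.z ε τ * Qu.w ε τ ∈ Qu.grading ε τ (1, 1) := by
      simpa [QGen.deg] using Qu.mul_mem ε τ (Qu.gen_mem ε τ .z) (Qu.gen_mem ε τ .w)
    simpa using Qu.mul_mem ε τ ih h1

/-- The part of a bigraded module in bidegrees `> c`. -/
def GrMod.tail (M : GrMod.{u} ε τ) (c : ℤ) : AddSubgroup M.carrier :=
  AddSubgroup.closure (⋃ d : {d : ℤ × ℤ // c < d.1 ∧ c < d.2}, (M.gr d : Set M.carrier))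

theorem GrMod.exists_tail (M : GrMod.{u} ε τ) (c : ℤ) (m : M.carrier) :
    ∃ k₀ : ℕ, ∀ k ≥ k₀, op ((Qu.z ε τ * Qu.w ε τ) ^ k) • m ∈ M.tail c := by
  induction m using M.gr_induction with
  | h0 => exact ⟨0, fun k _ => by rw [smul_zero]; exact zero_mem _⟩
  | hg d m hm =>
    refine ⟨(c - d.1 + 1).toNat + (c - d.2 + 1).toNat, fun k hk => ?_⟩
    refine AddSubgroup.subset_closure (Set.mem_iUnion.mpr
      ⟨⟨d + ((k : ℤ), (k : ℤ)), ?_, ?_⟩, M.smul_mem (Qu.zw_pow_mem k) hm⟩)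
    · rw [Prod.fst_add]; omega
    · rw [Prod.snd_add]; omega
  | ha m n h h' =>
    obtain ⟨k, hk⟩ := h
    obtain ⟨k', hk'⟩ := h'
    exact ⟨k + k', fun l hl => by
      rw [smul_add]; exact add_mem (hk l (by omega)) (hk' l (by omega))⟩

theorem torIso.tail {M N : GrMod.{u} ε τ} {f : M ⟶ N} (hf : torIso f) : ∃ c : ℤ,
    (∀ m ∈ M.tail c, f.lin m = 0 → m = 0) ∧ (∀ n ∈ N.tail c, ∃ m ∈ M.tail c, f.lin m = n) := by
  obtain ⟨⟨a, ha⟩, ⟨b, hb⟩⟩ := hf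
  refine ⟨max (max a.1 a.2) (max b.1 b.2), fun m hm h0 => ?_, fun n hn => ?_⟩
  · have hproj : ∀ d, f.lin (M.proj d m) = N.proj d (f.lin m) := by
      intro d
      clear h0 hm
      induction m using M.gr_induction with
      | h0 => simp
      | hg c m hm =>
        rw [M.proj_of_mem_gen _ _ hm, N.proj_of_mem_gen _ _ (f.map_gr hm)]
        split_ifs
        · rfl
        · simp
      | ha m n h h' => simp [h, h']
    have hz : ∀ d, M.proj d m = 0 := by
      intro d
      by_cases hd : a.1 < d.1 ∧ a.2 < d.2
      · exact ha d hd.1 hd.2 _ (M.proj_mem d m) (by rw [hproj, h0, map_zero])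
      · clear h0 hproj
        induction hm using AddSubgroup.closure_induction with
        | mem m hm =>
          obtain ⟨⟨e, he⟩, hm⟩ := Set.mem_iUnion.mp hm
          rw [M.proj_of_mem_gen _ _ hm, if_neg]
          intro hed
          simp only [max_lt_iff] at he
          exact hd ⟨hed ▸ he.1.1.1, hed ▸ he.2.1.2⟩
        | zero => exact map_zero _
        | add a b _ _ h h' => rw [map_add, h, h', add_zero]
        | neg a _ h => rw [map_neg, h, neg_zero]
    obtain ⟨x, rfl⟩ := M.isInternal.2 m
    have : x = 0 := by
      ext d
      have h := hz d
      have h2 : M.proj d (DirectSum.coeAddMonoidHom M.gr x) = (x d : M.carrier) := by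
        show ((AddEquiv.ofBijective (DirectSum.coeAddMonoidHom M.gr) M.isInternal).symm
          ((AddEquiv.ofBijective (DirectSum.coeAddMonoidHom M.gr) M.isInternal) x) d :
          M.carrier) = _
        rw [AddEquiv.symm_apply_apply]
      rw [h2] at h
      simpa using h
    rw [this, map_zero]
  · induction hn using AddSubgroup.closure_induction with
    | mem n hn =>
      obtain ⟨⟨e, he⟩, hn⟩ := Set.mem_iUnion.mp hn
      obtain ⟨m, hm, hmn⟩ := torIso.surj_deg f hn (hb e (by omega) (by omega) n hn)
      exact ⟨m, AddSubgroup.subset_closure (Set.mem_iUnion.mpr ⟨⟨e, he⟩, hm⟩), hmn⟩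
    | zero => exact ⟨0, zero_mem _, map_zero _⟩
    | add a b _ _ h h' =>
      obtain ⟨m, hm, rfl⟩ := h
      obtain ⟨m', hm', rfl⟩ := h'
      exact ⟨m + m', add_mem hm hm', map_add _ _ _⟩
    | neg a _ h =>
      obtain ⟨m, hm, rfl⟩ := h
      exact ⟨-m, neg_mem hm, map_neg _ _⟩

theorem GrMod.tail_mul (M : GrMod.{u} ε τ) (c : ℤ) {m : M.carrier} (hm : m ∈ M.tail c)
    {q : Qu ε τ} {e : ℤ × ℤ} (hq : q ∈ Qu.grading ε τ e) (h1 : 0 ≤ e.1) (h2 : 0 ≤ e.2) :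
    op q • m ∈ M.tail c := by
  induction hm using AddSubgroup.closure_induction with
  | mem m hm =>
    obtain ⟨⟨d, hd⟩, hm⟩ := Set.mem_iUnion.mp hm
    refine AddSubgroup.subset_closure (Set.mem_iUnion.mpr ⟨⟨d + e, ?_, ?_⟩, M.smul_mem hq hm⟩)
    · rw [Prod.fst_add]; omega
    · rw [Prod.snd_add]; omega
  | zero => rw [smul_zero]; exact zero_mem _
  | add a b _ _ h h' => rw [smul_add]; exact add_mem h h'
  | neg a _ h => rw [smul_neg]; exact neg_mem h

theorem jMap_bijective {M N : GrMod.{u} ε τ} {f : M ⟶ N} (hf : torIso f) :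
    Function.Bijective (jMap f) := by
  obtain ⟨c, hinj, hsurj⟩ := torIso.tail hf
  constructor
  · rw [injective_iff_map_eq_zero]
    intro v hv
    obtain ⟨m, rfl⟩ := jMk_surj M v
    rw [jMap_mk, jMk_eq_zero, mem_jKer] at hv
    obtain ⟨n₁, n₂, hn⟩ := hv
    obtain ⟨k₀, h₀⟩ := M.exists_tail c m
    obtain ⟨k₁, h₁⟩ := N.exists_tail c n₁
    obtain ⟨k₂, h₂⟩ := N.exists_tail c n₂
    set k := k₀ + k₁ + k₂ with hk
    obtain ⟨m₁, hm₁, e₁⟩ := hsurj _ (h₁ k (by omega))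
    obtain ⟨m₂, hm₂, e₂⟩ := hsurj _ (h₂ k (by omega))
    set t := op ((Qu.z ε τ * Qu.w ε τ) ^ k) with ht
    have hz : ∀ n : N.carrier, t • op (Qu.z ε τ) • n = op (Qu.z ε τ) • t • n := fun n => by
      rw [smul_smul, smul_smul, ht, ← op_mul, ← op_mul, (Qu.z_comm ε τ _).eq]
    have hw : ∀ n : N.carrier, t • op (Qu.w ε τ) • n = op (Qu.w ε τ) • t • n := fun n => by
      rw [smul_smul, smul_smul, ht, ← op_mul, ← op_mul, (Qu.w_comm ε τ _).eq]
    set r := (op (Qu.z ε τ) • m₁ - m₁) + (op (Qu.w ε τ) • m₂ - m₂) with hr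
    have hfr : f.lin (t • m - r) = 0 := by
      rw [map_sub, map_smul, ← hn, hr]
      simp only [map_add, map_sub, map_smul, e₁, e₂, smul_add, smul_sub, hz, hw, sub_self]
    have hmem : t • m - r ∈ M.tail c :=
      sub_mem (h₀ k (by omega)) (add_mem
        (sub_mem (M.tail_mul c hm₁ (Qu.gen_mem ε τ .z) (by simp [QGen.deg]) (by simp [QGen.deg]))
          hm₁)
        (sub_mem (M.tail_mul c hm₂ (Qu.gen_mem ε τ .w) (by simp [QGen.deg]) (by simp [QGen.deg]))
          hm₂))
    have h3 := sub_eq_zero.mp (hinj _ hmem hfr)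
    rw [← jMk_pow M k m, ← ht, h3, jMk_eq_zero, mem_jKer]
    exact ⟨m₁, m₂, rfl⟩
  · intro v
    obtain ⟨n, rfl⟩ := jMk_surj N v
    obtain ⟨k, h⟩ := N.exists_tail c n
    obtain ⟨m, -, hm⟩ := hsurj _ (h k le_rfl)
    exact ⟨jMk M m, by rw [jMap_mk, hm, jMk_pow]⟩

variable (ε τ) in
/-- The restriction functor `j^*` from coherent sheaves to right `B`-modules, induced by
`M ↦ M / (M(z-1) + M(w-1))`. -/
def jStar : Coh.{u} ε τ ⥤ ModuleCat.{u} (Bt ε τ)ᵐᵒᵖ :=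
  Localization.Construction.lift (jFun ε τ) (fun _ _ f hf => by
    rw [ConcreteCategory.isIso_iff_bijective]
    exact jMap_bijective hf)

end Affine

section TensorMaps

variable {G : Type} [CommGroup G] (ε : G →* ℂˣ) (τ : MonoidAlgebra ℂ G)
variable {W : Type u} [AddCommGroup W] [Module ℂ W] (ρ : Representation ℂ G W)

/-- The canonical map `W ⊗_G Q → W ⊗_G B_rat`, `z, w ↦ 1`. -/
def toRat : Qu ε τ ⊗[MonoidAlgebra ℂ G] ρ.asModule →+ BRat ε τ ⊗[MonoidAlgebra ℂ G] ρ.asModule :=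
  (LinearMap.rTensor ρ.asModule
    ({ toFun := fun q => BRat.num ε τ (theta ε τ q)
       map_add' := fun a b => by rw [map_add, map_add]
       map_smul' := fun r q => by
        have h : theta ε τ (Qu.ofCG ε τ r) = Bt.ofCG ε τ r := by
          induction r using MonoidAlgebra.induction_linear with
          | zero => simp
          | add a b ha hb => simp only [map_add, ha, hb]
          | single g c => simp [Qu.ofCG, Bt.ofCG, Qu.grp_apply, Bt.grp_apply, theta_gen]
        rw [Qu.cg_smul, map_mul, map_mul, h]
        rfl } : Qu ε τ →ₗ[MonoidAlgebra ℂ G] BRat ε τ)).toAddMonoidHom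

theorem toRat_tmul (q : Qu ε τ) (w : ρ.asModule) :
    toRat ε τ ρ (q ⊗ₜ w) = (BRat.num ε τ (theta ε τ q)) ⊗ₜ[MonoidAlgebra ℂ G] w := rfl

theorem theta_sect (t : FreeAlgebra ℂ (BGen G)) : theta ε τ (sect ε τ t) = Bt.mk ε τ t := by
  have : (theta ε τ).comp (sect ε τ) = Bt.mk ε τ := by
    apply FreeAlgebra.hom_ext
    funext t
    cases t <;> simp [sect, theta_gen, Bt.gen]
  exact congrArg (fun f => f t) this

theorem toRat_smul (q : Qu ε τ) (t : Qu ε τ ⊗[MonoidAlgebra ℂ G] ρ.asModule) :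
    toRat ε τ ρ (op q • t) = op (theta ε τ q) • toRat ε τ ρ t := by
  induction t using TensorProduct.induction_on with
  | zero => rw [smul_zero, map_zero, smul_zero]
  | add a b ha hb => rw [smul_add, map_add, ha, hb, map_add, smul_add]
  | tmul a w =>
    rw [smul_tmul', op_smul_eq_mul, toRat_tmul, toRat_tmul, smul_tmul', BRat.op_smul, map_mul,
      map_mul]

variable {ε τ}

theorem lmulPoly_comp {k l m : ℕ} (q : SemiInv ε k) (r : SemiInv ε l) (p : SemiInv ε m)
    (hp : p.poly = q.poly * r.poly) (ρ₁ ρ₂ ρ₃ : Representation ℂ G W)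
    (h₁ : ∀ g w, ρ₂ g w = ((ε g ^ k : ℂˣ) : ℂ) • ρ₁ g w)
    (h₂ : ∀ g w, ρ₃ g w = ((ε g ^ l : ℂˣ) : ℂ) • ρ₂ g w)
    (h₃ : ∀ g w, ρ₃ g w = ((ε g ^ m : ℂˣ) : ℂ) • ρ₁ g w) :
    (Qu.lmulPoly τ r ρ₂ ρ₃ h₂).comp (Qu.lmulPoly τ q ρ₁ ρ₂ h₁) = Qu.lmulPoly τ p ρ₁ ρ₃ h₃ := by
  apply LinearMap.ext
  intro t
  induction t using TensorProduct.induction_on with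
  | zero => rw [map_zero, map_zero]
  | add a b ha hb => rw [map_add, map_add, ha, hb]
  | tmul a w =>
    show (Qu.evalPoly ε τ r.poly * (Qu.evalPoly ε τ q.poly * a)) ⊗ₜ[MonoidAlgebra ℂ G] _ =
      (Qu.evalPoly ε τ p.poly * a) ⊗ₜ[MonoidAlgebra ℂ G] _
    rw [hp, mul_comm, map_mul, mul_assoc]
    rfl

end TensorMaps

section GrP

variable {G : Type} [CommGroup G] (ε : G →* ℂˣ) (τ : MonoidAlgebra ℂ G)
variable {W : Type u} [AddCommGroup W] [Module ℂ W] [FiniteDimensional ℂ W]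
variable (ρ : Representation ℂ G W)

/-- A trivialization of a coherent sheaf `E` in a neighborhood of the line `z = 0`:
embeddings `(W ⊗ ε^{-n}) ⊗_G O(-n,0) → E → (W ⊗ ε^n) ⊗_G O(n,0)` whose composite is the
multiplication by `P(x,z)^2`, where `P` is a normalized semiinvariant homogeneous polynomial of
degree `n`; moreover `i_z^* E ≅ W ⊗_G O`, and the embedding `ψ` restricts to an
embedding on the line `w = 0` (equivalently, `L¹i_w^* (Coker ψ) = 0`). -/
structure Triv where
  E : Coh.{u} ε τ
  n : ℕ
  P : SemiInv ε n
  φ : twistedO ε τ ρ (-n) ⟶ E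
  ψ : E ⟶ twistedO ε τ ρ n
  mono_φ : Mono φ
  mono_ψ : Mono ψ
  comp : φ ≫ ψ = mulPoly τ (P.mul P) ρ (-n) n (by push_cast; ring)
  iz : Nonempty ((izStar ε τ).obj E ≅ (izStar ε τ).obj ((piFun ε τ).obj (freeMod ε τ ρ (0, 0))))
  iw : Mono ((iwStar ε τ).map ψ)

variable {ε τ ρ}

/-- Equivalence of trivializations, the sheaves being identified up to isomorphism. -/
def Triv.Equivalent (s t : Triv.{u} ε τ ρ) : Prop :=
  ∃ (e : s.E ≅ t.E) (k l N : ℕ) (q : SemiInv ε k) (r : SemiInv ε l)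
    (h₁ : N = s.n + k) (h₂ : N = t.n + l),
    mulPoly τ q ρ (-N) (-s.n) (by rw [h₁]; push_cast; ring) ≫ s.φ ≫ e.hom =
      mulPoly τ r ρ (-N) (-t.n) (by rw [h₂]; push_cast; ring) ≫ t.φ ∧
    s.ψ ≫ mulPoly τ q ρ s.n N (by rw [h₁]; push_cast; ring) =
      e.hom ≫ t.ψ ≫ mulPoly τ r ρ t.n N (by rw [h₂]; push_cast; ring)

theorem mulPoly_comp {k l m : ℕ} (q : SemiInv ε k) (r : SemiInv ε l) (p : SemiInv ε m)
    (hp : p.poly = q.poly * r.poly) (a b c : ℤ) (h₁ : b = a + k) (h₂ : c = b + l)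
    (h₃ : c = a + m) :
    mulPoly τ q ρ a b h₁ ≫ mulPoly τ r ρ b c h₂ = mulPoly τ p ρ a c h₃ := by
  rw [mulPoly, mulPoly, mulPoly]
  refine ((piFun ε τ).map_comp _ _).symm.trans (congrArg (piFun ε τ).map ?_)
  apply GrMod.hom_ext
  exact lmulPoly_comp q r p hp _ _ _ _ _ _

theorem Triv.equivalent_equivalence :
    Equivalence (Triv.Equivalent : Triv.{u} ε τ ρ → Triv.{u} ε τ ρ → Prop) where
  refl s := ⟨Iso.refl _, 0, 0, s.n, SemiInv.one ε, SemiInv.one ε, rfl, rfl, by simp, by simp⟩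
  symm := by
    rintro s t ⟨e, k, l, N, q, r, h₁, h₂, e₁, e₂⟩
    refine ⟨e.symm, l, k, N, r, q, h₂, h₁, ?_, ?_⟩
    · rw [Iso.symm_hom, ← Category.assoc, ← e₁]
      simp
    · rw [Iso.symm_hom, e₂]
      simp
  trans := by
    rintro s t u ⟨e, k, l, N, q, r, h₁, h₂, e₁, e₂⟩ ⟨e', k', l', N', q', r', h₁', h₂', e₁', e₂'⟩
    refine ⟨e ≪≫ e', k + k', l' + l, s.n + k + k', q.mul q', r'.mul r, by omega, by omega, ?_, ?_⟩
    · have a₁ := mulPoly_comp (τ := τ) (ρ := ρ) q' q (q.mul q') (mul_comm _ _)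
        (-((s.n + k + k' : ℕ) : ℤ)) (-(N : ℤ)) (-(s.n : ℤ))
        (by rw [h₁]; push_cast; ring) (by rw [h₁]; push_cast; ring) (by push_cast; ring)
      have a₂ := mulPoly_comp (τ := τ) (ρ := ρ) r r' (r'.mul r) (mul_comm _ _)
        (-((s.n + k + k' : ℕ) : ℤ)) (-(N' : ℤ)) (-(u.n : ℤ))
        (by have : (N' : ℤ) + l = s.n + k + k' := by exact_mod_cast (by omega)
            push_cast; linarith)
        (by rw [h₂']; push_cast; ring)
        (by have : (s.n + k + k' : ℤ) = u.n + (l' + l) := by exact_mod_cast (by omega)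
            push_cast; linarith)
      have a₃ := mulPoly_comp (τ := τ) (ρ := ρ) q' r (r.mul q') (mul_comm _ _)
        (-((s.n + k + k' : ℕ) : ℤ)) (-(N : ℤ)) (-(t.n : ℤ))
        (by rw [h₁]; push_cast; ring) (by rw [h₂]; push_cast; ring)
        (by have : (s.n + k + k' : ℤ) = t.n + (l + k') := by exact_mod_cast (by omega)
            push_cast; linarith)
      have a₄ := mulPoly_comp (τ := τ) (ρ := ρ) r q' (r.mul q') rfl
        (-((s.n + k + k' : ℕ) : ℤ)) (-(N' : ℤ)) (-(t.n : ℤ))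
        (by have : (N' : ℤ) + l = s.n + k + k' := by exact_mod_cast (by omega)
            push_cast; linarith)
        (by rw [h₁']; push_cast; ring)
        (by have : (s.n + k + k' : ℤ) = t.n + (l + k') := by exact_mod_cast (by omega)
            push_cast; linarith)
      rw [← a₁, ← a₂, Iso.trans_hom, Category.assoc, Category.assoc, ← e₁']
      rw [← Category.assoc s.φ, ← Category.assoc (mulPoly τ q ρ _ _ _) (s.φ ≫ e.hom), e₁,
        Category.assoc, ← Category.assoc, a₃, ← a₄, Category.assoc]
    · have a₁ := mulPoly_comp (τ := τ) (ρ := ρ) q q' (q.mul q') rfl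
        (s.n : ℤ) (N : ℤ) ((s.n + k + k' : ℕ) : ℤ)
        (by rw [h₁]; push_cast; ring) (by rw [h₁]; push_cast; ring) (by push_cast; ring)
      have a₂ := mulPoly_comp (τ := τ) (ρ := ρ) r' r (r'.mul r) rfl
        (u.n : ℤ) (N' : ℤ) ((s.n + k + k' : ℕ) : ℤ)
        (by rw [h₂']; push_cast; ring)
        (by have : (N' : ℤ) + l = s.n + k + k' := by exact_mod_cast (by omega)
            push_cast; linarith)
        (by have : (s.n + k + k' : ℤ) = u.n + (l' + l) := by exact_mod_cast (by omega)
            push_cast; linarith)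
      have a₃ := mulPoly_comp (τ := τ) (ρ := ρ) r q' (r.mul q') rfl
        (t.n : ℤ) (N : ℤ) ((s.n + k + k' : ℕ) : ℤ)
        (by rw [h₂]; push_cast; ring) (by rw [h₁]; push_cast; ring)
        (by have : (s.n + k + k' : ℤ) = t.n + (l + k') := by exact_mod_cast (by omega)
            push_cast; linarith)
      have a₄ := mulPoly_comp (τ := τ) (ρ := ρ) q' r (r.mul q') (mul_comm _ _)
        (t.n : ℤ) (N' : ℤ) ((s.n + k + k' : ℕ) : ℤ)
        (by rw [h₁']; push_cast; ring)
        (by have : (N' : ℤ) + l = s.n + k + k' := by exact_mod_cast (by omega)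
            push_cast; linarith)
        (by have : (s.n + k + k' : ℤ) = t.n + (l + k') := by exact_mod_cast (by omega)
            push_cast; linarith)
      rw [← a₁, ← a₂, Iso.trans_hom, ← Category.assoc, e₂, Category.assoc, Category.assoc,
        Category.assoc, a₃, ← a₄, ← Category.assoc t.ψ, e₂', Category.assoc, Category.assoc]

variable (ε τ ρ)

/-- Equivalence of trivializations as a setoid. -/
instance Triv.setoid : Setoid (Triv.{u} ε τ ρ) := ⟨Triv.Equivalent, Triv.equivalent_equivalence⟩

/-- The set of equivalence classes of trivialized sheaves. -/
def GrP : Type (u + 1) := Quotient (Triv.setoid.{u} ε τ ρ)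

/-- The canonical map `j^*(W ⊗_G O(s)) = W ⊗_G B → W ⊗_G B_rat`. -/
def jToRat (s : ℤ × ℤ) : JCarrier (freeMod ε τ ρ s) →ₗ[(Bt ε τ)ᵐᵒᵖ]
    BRat ε τ ⊗[MonoidAlgebra ℂ G] ρ.asModule :=
  let F : JCarrier (freeMod ε τ ρ s) →+ BRat ε τ ⊗[MonoidAlgebra ℂ G] ρ.asModule :=
    QuotientAddGroup.lift (jKer (freeMod ε τ ρ s)).toAddSubgroup (toRat ε τ ρ) (by
      intro m hm
      obtain ⟨a, b, rfl⟩ := (mem_jKer _ m).mp hm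
      rw [AddMonoidHom.mem_ker, map_add, map_sub, map_sub, toRat_smul, toRat_smul, theta_gen,
        theta_gen, op_one, one_smul, one_smul, sub_self, sub_self, add_zero])
  { toFun := F
    map_add' := map_add F
    map_smul' := fun b v => by
      obtain ⟨t, ht⟩ := Bt.mk_surj (unop b)
      have hb : b = op (Bt.mk ε τ t) := by rw [ht, op_unop]
      obtain ⟨m, rfl⟩ := jMk_surj _ v
      rw [RingHom.id_apply, hb, jAct_mk, ← theta_sect]
      exact toRat_smul ε τ ρ _ m }

variable {ε τ ρ}

/-- The right `B`-submodule of `W ⊗_G B_rat` attached to a trivialized sheaf: the image of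
`j^*E` under `p⁻¹ j^*ψ`, where `p(x) = P(x,1)` and
`j^*((W ⊗ ε^n) ⊗_G O(n,0)) = (W ⊗ ε^n) ⊗_G B` is embedded into `W ⊗_G B_rat` by `p⁻¹`. Thus
`N = {u | p u ∈ (j^*ψ)(j^*E)}`. -/
def Triv.toSubmodule (t : Triv.{u} ε τ ρ) :
    Submodule (Bt ε τ)ᵐᵒᵖ (BRat ε τ ⊗[MonoidAlgebra ℂ G] ρ.asModule) :=
  Submodule.comap
    (BRat.lmulPoly τ t.P ρ (twist ρ (ε ^ (t.n : ℤ))) (fun g w => by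
      show ((ε g ^ (t.n : ℤ) : ℂˣ) : ℂ) • ρ g w = _
      rw [zpow_natCast]))
    (LinearMap.range ((jToRat ε τ (twist ρ (ε ^ (t.n : ℤ))) (t.n, 0)).comp
      ((jStar ε τ).map t.ψ).hom))

end GrP

end NCQuadric

end

/-! Write `F(k)` for the graded module `shiftMod` of `(W ⊗ ε^k) ⊗ O(k,0)`. The point is that a
trivialized sheaf is the same thing as a graded submodule of some `F(n)` that is saturated with
respect to `z` and `w`, and that such a submodule is determined, up to bidegrees that are not large,
by its image in `W ⊗ B_rat` under `z, w ↦ 1`.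

Affine side. The algebra `B` has the basis `x^a y^b g`: the representation `Bt.rep` separates these
words. Since the bidegree fixes the exponents of `z` and `w`, the map `theta : Q → B` is injective
on every `Q_d`, with image the elements of degree at most `d` in `x` and `y`. The space `B` is
torsion-free over `ℂ[x]` and every module over the semisimple ring `ℂΓ` is flat, so `(W ⊗ Q)_d → W ⊗
B_rat` is injective (`toRat_eq_zero`). A normalized semiinvariant `P(x,z)` is monic in `x`. Hence it
acts injectively on `Q/zQ` and on `Q/wQ`, `Q = P Q + z Q` in large degree, and `P(x,1)` becomes a
unit in `B_rat`, since its `|Γ|`-th power is invariant.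

Sheaf side. `Q` is right noetherian (an iterated Hilbert basis theorem), so the tails of finitely
generated graded modules are objects of the category again, and morphisms with torsion kernel and
cokernel have a calculus of right fractions. Equality of morphisms and monomorphy in the quotient
category can then be read off in large bidegrees. A trivialized sheaf becomes a map `f : M → F(n)`,
injective in large bidegrees, with image containing `P² F(-n)` (`IsPresentation`). Injectivity of
`f` modulo `z` or `w` means that the image is saturated. For `w` this is the assumption on `i_w^*ψ`.
For `z` it is a dimension count (`exists_presentation`): `f` modulo `z` is onto in large bidegrees
because `F(n) = P² F(-n) + z F(n)`, while `M/Mz` agrees in large bidegrees with `F(0)/zF(0)`, which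
`P` embeds into `F(n)/zF(n)`.

The bijection. The image of a presentation is squeezed between `P²` times one lattice and another
lattice, which gives fatness (`Triv.isFat`). Equivalent data satisfy `(Pq)² = (P'q')²` on `W`, and
`lmulPoly_eq_of_sq` extracts `Pq = P'q'`, so the submodule depends only on the class. If two data
give the same submodule, then `P'f` and `Pf'` are saturated with the same image in `W ⊗ B_rat`,
hence have the same image in large bidegrees (`eventually_range_le`), and `q = P'`, `q' = P` is an
equivalence. Conversely, for a fat `N` with denominator `P`, the homogeneous elements of `F(n)`
whose value in `W ⊗ B_rat` lies in `P N` span a saturated graded submodule that gives back `N`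
(`exists_triv`). -/

noncomputable section

namespace NCQuadric

/-! ### Hilbert's basis theorem for Ore-type extensions. -/

section OreExtension

variable {A : Type*} [Ring A]

/-- The left `R`-span of the powers `x^i`, `i < n`. -/
def powSpan (R : Subring A) (x : A) (n : ℕ) : Submodule R A :=
  Submodule.span R ((fun i => x ^ i) '' Set.Iio n)

variable {R : Subring A} {x : A}

theorem powSpan_mono {n m : ℕ} (h : n ≤ m) : powSpan R x n ≤ powSpan R x m :=
  Submodule.span_mono (Set.image_mono (Set.Iio_subset_Iio h))

theorem mul_pow_mem_powSpan {r : A} (hr : r ∈ R) {i n : ℕ} (h : i < n) :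
    r * x ^ i ∈ powSpan R x n :=
  Submodule.smul_mem _ (⟨r, hr⟩ : R) (Submodule.subset_span ⟨i, h, rfl⟩)

theorem mul_mem_powSpan {r b : A} (hr : r ∈ R) {n : ℕ} (hb : b ∈ powSpan R x n) :
    r * b ∈ powSpan R x n :=
  Submodule.smul_mem _ (⟨r, hr⟩ : R) hb

theorem powSpan_induction {n : ℕ} {p : A → Prop} (h0 : p 0) (ha : ∀ a b, p a → p b → p (a + b))
    (hp : ∀ r ∈ R, ∀ i < n, p (r * x ^ i)) {b : A} (hb : b ∈ powSpan R x n) : p b := by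
  -- `p` is not assumed stable under scalars, so the span induction is run for all left multiples at
  -- once.
  have : ∀ b ∈ powSpan R x n, ∀ r ∈ R, p (r * b) := by
    intro b hb
    induction hb using Submodule.span_induction with
    | mem b h => obtain ⟨i, hi, rfl⟩ := h; exact fun r hr => hp r hr i hi
    | zero => intro r _; rwa [mul_zero]
    | add a b _ _ ha' hb' => intro r hr; rw [mul_add]; exact ha _ _ (ha' r hr) (hb' r hr)
    | smul s b _ h =>
      intro r hr
      have : r * (s • b) = (r * s) * b := (mul_assoc r s b).symm
      rw [this]
      exact h _ (R.mul_mem hr s.2)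
  simpa using this b hb 1 R.one_mem

theorem powSpan_mul_pow {n : ℕ} (m : ℕ) {b : A} (hb : b ∈ powSpan R x n) :
    b * x ^ m ∈ powSpan R x (n + m) := by
  refine powSpan_induction (p := fun b => b * x ^ m ∈ powSpan R x (n + m)) (by simp)
    (fun a b ha hb => by rw [add_mul]; exact add_mem ha hb) (fun r hr i hi => ?_) hb
  rw [mul_assoc, ← pow_add]
  exact mul_pow_mem_powSpan hr (by omega)

theorem mul_powSpan (h1 : ∀ r ∈ R, ∃ s ∈ R, ∃ t ∈ R, x * r = s * x + t) {n : ℕ} {b : A}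
    (hb : b ∈ powSpan R x n) : x * b ∈ powSpan R x (n + 1) := by
  refine powSpan_induction (p := fun b => x * b ∈ powSpan R x (n + 1)) (by simp)
    (fun a b ha hb => by rw [mul_add]; exact add_mem ha hb) (fun r hr i hi => ?_) hb
  obtain ⟨s, hs, t, ht, h⟩ := h1 r hr
  rw [← mul_assoc, h, add_mul, mul_assoc, ← pow_succ']
  exact add_mem (mul_pow_mem_powSpan hs (by omega)) (mul_pow_mem_powSpan ht (by omega))

theorem pow_mul_powSpan (h1 : ∀ r ∈ R, ∃ s ∈ R, ∃ t ∈ R, x * r = s * x + t) (k : ℕ) {n : ℕ} {b : A}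
    (hb : b ∈ powSpan R x n) : x ^ k * b ∈ powSpan R x (n + k) := by
  induction k with
  | zero => simpa using hb
  | succ k ih => rw [pow_succ', mul_assoc]; exact mul_powSpan h1 ih

/-- Moving a coefficient from the right of `x^n` to the left costs only terms of lower degree. This
makes right leading coefficients form left ideals. -/
theorem pow_mul_coeff (h1 : ∀ r ∈ R, ∃ s ∈ R, ∃ t ∈ R, x * r = s * x + t) (n : ℕ) :
    ∀ r ∈ R, ∃ s ∈ R, ∃ b ∈ powSpan R x n, x ^ n * r = s * x ^ n + b := by
  induction n with
  | zero => exact fun r hr => ⟨r, hr, 0, zero_mem _, by simp⟩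
  | succ n ih =>
    intro r hr
    obtain ⟨s, hs, b, hb, h⟩ := ih r hr
    obtain ⟨s', hs', t, ht, h'⟩ := h1 s hs
    refine ⟨s', hs', t * x ^ n + x * b,
      add_mem (mul_pow_mem_powSpan ht (by omega)) (mul_powSpan h1 hb), ?_⟩
    rw [pow_succ', mul_assoc, h, mul_add, ← mul_assoc, h', add_mul, mul_assoc, add_assoc]

/-- The reverse move. It supplies every element of `powSpan` with a leading coefficient on the right
of the power. -/
theorem coeff_mul_pow (h1 : ∀ r ∈ R, ∃ s ∈ R, ∃ t ∈ R, x * r = s * x + t)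
    (h2 : ∀ r ∈ R, ∃ s ∈ R, ∃ t ∈ R, r * x = x * s + t) (n : ℕ) :
    ∀ r ∈ R, ∃ s ∈ R, ∃ b ∈ powSpan R x n, r * x ^ n = x ^ n * s + b := by
  induction n with
  | zero => exact fun r hr => ⟨r, hr, 0, zero_mem _, by simp⟩
  | succ n ih =>
    intro r hr
    obtain ⟨s, hs, t, ht, h⟩ := h2 r hr
    obtain ⟨s', hs', b, hb, h'⟩ := ih s hs
    refine ⟨s', hs', x * b + t * x ^ n,
      add_mem (mul_powSpan h1 hb) (mul_pow_mem_powSpan ht (by omega)), ?_⟩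
    rw [pow_succ', ← mul_assoc, h, add_mul, mul_assoc, h', mul_add, mul_assoc, add_assoc]

theorem powSpan_mul_coeff (h1 : ∀ r ∈ R, ∃ s ∈ R, ∃ t ∈ R, x * r = s * x + t) {n : ℕ} {b r : A}
    (hb : b ∈ powSpan R x n) (hr : r ∈ R) : b * r ∈ powSpan R x n := by
  refine powSpan_induction (p := fun b => b * r ∈ powSpan R x n) (by simp)
    (fun a b ha hb => by rw [add_mul]; exact add_mem ha hb) (fun s hs i hi => ?_) hb
  obtain ⟨s', hs', c, hc, h⟩ := pow_mul_coeff h1 i r hr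
  rw [mul_assoc, h, mul_add, ← mul_assoc]
  exact add_mem (mul_pow_mem_powSpan (R.mul_mem hs hs') hi)
    (powSpan_mono hi.le (mul_mem_powSpan hs hc))

theorem powSpan_mul_powSpan (h1 : ∀ r ∈ R, ∃ s ∈ R, ∃ t ∈ R, x * r = s * x + t) {n m : ℕ} {a b : A}
    (ha : a ∈ powSpan R x n) (hb : b ∈ powSpan R x m) : a * b ∈ powSpan R x (n + m) := by
  refine powSpan_induction (p := fun b => a * b ∈ powSpan R x (n + m)) (by simp)
    (fun b c hb hc => by rw [mul_add]; exact add_mem hb hc) (fun r hr i hi => ?_) hb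
  rw [← mul_assoc]
  exact powSpan_mono (by omega) (powSpan_mul_pow i (powSpan_mul_coeff h1 ha hr))

theorem exists_powSpan (h1 : ∀ r ∈ R, ∃ s ∈ R, ∃ t ∈ R, x * r = s * x + t) {a : A}
    (ha : a ∈ Subring.closure ((R : Set A) ∪ {x})) : ∃ n, a ∈ powSpan R x n := by
  have hR : ∀ r ∈ R, r ∈ powSpan R x 1 := fun r hr => by
    simpa using mul_pow_mem_powSpan (x := x) hr (i := 0) (n := 1) (by omega)
  induction ha using Subring.closure_induction with
  | mem a h =>
    rcases h with h | rfl
    · exact ⟨1, hR a h⟩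
    · exact ⟨2, by simpa using mul_pow_mem_powSpan R.one_mem (i := 1) (n := 2) (by omega)⟩
  | zero => exact ⟨0, zero_mem _⟩
  | one => exact ⟨1, hR 1 R.one_mem⟩
  | add a b _ _ ha hb =>
    obtain ⟨n, hn⟩ := ha
    obtain ⟨m, hm⟩ := hb
    exact ⟨n + m, add_mem (powSpan_mono (by omega) hn) (powSpan_mono (by omega) hm)⟩
  | neg a _ h => obtain ⟨n, hn⟩ := h; exact ⟨n, neg_mem hn⟩
  | mul a b _ _ ha hb =>
    obtain ⟨n, hn⟩ := ha
    obtain ⟨m, hm⟩ := hb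
    exact ⟨n + m, powSpan_mul_powSpan h1 hn hm⟩

/-- Hilbert's basis theorem for an extension of a noetherian ring `R` by an element `x` with
`x R + R = R x + R`. -/
theorem isNoetherianRing_closure (R : Subring A) [IsNoetherianRing R] (x : A)
    (h1 : ∀ r ∈ R, ∃ s ∈ R, ∃ t ∈ R, x * r = s * x + t)
    (h2 : ∀ r ∈ R, ∃ s ∈ R, ∃ t ∈ R, r * x = x * s + t) :
    IsNoetherianRing (Subring.closure ((R : Set A) ∪ {x})) := by
  set T := Subring.closure ((R : Set A) ∪ {x}) with hT
  have hRT : ∀ r ∈ R, r ∈ T := fun r hr => Subring.subset_closure (Or.inl hr)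
  have hxT : x ∈ T := Subring.subset_closure (Or.inr rfl)
  refine (isNoetherianRing_iff_ideal_fg T).mpr fun I => ?_
  -- The ideal is viewed inside `A`, where `powSpan` lives.
  let I' : AddSubgroup A := I.toAddSubgroup.map T.subtype.toAddMonoidHom
  have hI' : ∀ t ∈ T, ∀ a ∈ I', t * a ∈ I' := by
    rintro t ht _ ⟨a, ha, rfl⟩
    exact ⟨⟨t, ht⟩ * a, I.mul_mem_left _ ha, rfl⟩
  -- Leading coefficients in degree `n`, written to the right of `x^n`: left multiplication by `s'`
  -- on `x^n r + b` then becomes multiplication of `r` by `s` on the left, where `x^n s = s' x^n +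
  -- c`.
  let Ln : ℕ → Ideal R := fun n =>
    { carrier := {r | ∃ b ∈ powSpan R x n, x ^ n * r + b ∈ I'}
      zero_mem' := ⟨0, zero_mem _, by simp [I'.zero_mem]⟩
      add_mem' := by
        rintro r s ⟨b, hb, h⟩ ⟨c, hc, h'⟩
        refine ⟨b + c, add_mem hb hc, ?_⟩
        have := add_mem h h'
        rw [Subring.coe_add, mul_add]
        convert this using 1
        abel
      smul_mem' := by
        rintro s r ⟨b, hb, h⟩
        obtain ⟨s', hs', c, hc, e⟩ := pow_mul_coeff h1 n s s.2
        refine ⟨s' * b - c * r,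
          sub_mem (mul_mem_powSpan hs' hb) (powSpan_mul_coeff h1 hc r.2), ?_⟩
        have := hI' s' (hRT s' hs') _ h
        convert this using 1
        rw [smul_eq_mul, Subring.coe_mul, ← mul_assoc, e]
        noncomm_ring }
  have hmono : Monotone Ln := by
    refine monotone_nat_of_le_succ fun n => ?_
    rintro r ⟨b, hb, h⟩
    refine ⟨x * b, mul_powSpan h1 hb, ?_⟩
    have := hI' x hxT _ h
    rwa [mul_add, ← mul_assoc, ← pow_succ'] at this
  obtain ⟨N, hN⟩ := monotone_stabilizes_iff_noetherian.mpr ‹IsNoetherianRing R› ⟨Ln, hmono⟩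
  have hfin : (powSpan R x (N + 1)).FG :=
    Submodule.fg_span ((Set.finite_Iio (N + 1)).image _)
  -- The elements of the ideal of degree at most `N`, where the coefficient ideals have stabilized.
  -- They form a noetherian module over `R`, and its generators generate the whole ideal.
  let J : Submodule R A :=
    { carrier := {a | a ∈ I' ∧ a ∈ powSpan R x (N + 1)}
      zero_mem' := ⟨zero_mem _, zero_mem _⟩
      add_mem' := fun h h' => ⟨add_mem h.1 h'.1, add_mem h.2 h'.2⟩
      smul_mem' := fun r a h => ⟨hI' r (hRT r r.2) a h.1, Submodule.smul_mem _ r h.2⟩ }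
  have hJ : J.FG := by
    have h3 : IsNoetherian R (powSpan R x (N + 1)) := isNoetherian_of_fg_of_noetherian _ hfin
    exact (isNoetherian_submodule.mp h3) J fun a h => h.2
  obtain ⟨s, hs⟩ := hJ
  have hsI : ∀ a ∈ s, ∃ i ∈ I, (i : A) = a := fun a ha => by
    have : a ∈ J := hs ▸ Submodule.subset_span ha
    obtain ⟨i, hi, e⟩ := this.1
    exact ⟨i, hi, e⟩
  choose! f hfI hf using hsI
  classical
  refine ⟨s.image f, le_antisymm (Ideal.span_le.mpr ?_) ?_⟩
  · intro i hi
    obtain ⟨a, ha, rfl⟩ := Finset.mem_image.mp hi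
    exact hfI a ha
  · have hsmall : ∀ a ∈ J, ∃ i ∈ Ideal.span (s.image f : Set T), (i : A) = a := by
      intro a ha
      rw [← hs] at ha
      induction ha using Submodule.span_induction with
      | mem a h => exact ⟨f a, Ideal.subset_span (Finset.mem_image_of_mem f h), hf a h⟩
      | zero => exact ⟨0, zero_mem _, rfl⟩
      | add a b _ _ ha hb =>
        obtain ⟨i, hi, rfl⟩ := ha
        obtain ⟨j, hj, rfl⟩ := hb
        exact ⟨i + j, add_mem hi hj, rfl⟩
      | smul r a _ h =>
        obtain ⟨i, hi, rfl⟩ := h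
        exact ⟨⟨r, hRT r r.2⟩ * i, Ideal.mul_mem_left _ _ hi, rfl⟩
    have key : ∀ n, ∀ i ∈ I, (i : A) ∈ powSpan R x n → i ∈ Ideal.span (s.image f : Set T) := by
      intro n
      induction n with
      | zero =>
        intro i _ h
        have : (i : A) = 0 := by simpa [powSpan] using h
        have h0 : i = 0 := Subtype.ext this
        rw [h0]
        exact zero_mem _
      | succ k ih =>
        intro i hi h
        by_cases hk : k ≤ N
        · obtain ⟨j, hj, e⟩ := hsmall i ⟨⟨i, hi, rfl⟩, powSpan_mono (by omega) h⟩
          rwa [← Subtype.ext e]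
        · push Not at hk
          have hdec : ∃ r ∈ R, ∃ b ∈ powSpan R x k, (i : A) = x ^ k * r + b := by
            clear hi
            refine powSpan_induction (R := R) (x := x) (n := k + 1)
              (p := fun a => ∃ r ∈ R, ∃ b ∈ powSpan R x k, a = x ^ k * r + b)
              ⟨0, zero_mem _, 0, zero_mem _, by simp⟩ ?_ ?_ h
            · rintro _ _ ⟨r, hr, b, hb, rfl⟩ ⟨s, hs, c, hc, rfl⟩
              exact ⟨r + s, add_mem hr hs, b + c, add_mem hb hc, by rw [mul_add]; abel⟩
            · intro r hr j hj
              rcases Nat.lt_succ_iff_lt_or_eq.mp hj with h | rfl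
              · exact ⟨0, zero_mem _, _, mul_pow_mem_powSpan hr h, by simp⟩
              · obtain ⟨s, hs, b, hb, e⟩ := coeff_mul_pow h1 h2 j r hr
                exact ⟨s, hs, b, hb, e⟩
          obtain ⟨r, hr, b, hb, e⟩ := hdec
          have hrk : (⟨r, hr⟩ : R) ∈ Ln k := ⟨b, hb, ⟨i, hi, e⟩⟩
          have hst : Ln N = Ln k := hN k hk.le
          rw [← hst] at hrk
          obtain ⟨c, hc, ⟨j, hj, e'⟩⟩ := hrk
          have e2 : (j : A) = x ^ N * r + c := e'
          have hxk : x ^ (k - N) ∈ T := T.pow_mem hxT _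
          -- `j` has degree `N` and the same leading coefficient as `i`; after multiplication by
          -- `x^(k-N)` it cancels the leading term of `i`, so the induction on degree applies to the
          -- difference.
          have hj' : (⟨x ^ (k - N), hxk⟩ : T) * j ∈ Ideal.span (s.image f : Set T) := by
            refine Ideal.mul_mem_left _ _ ?_
            have : (j : A) ∈ powSpan R x (N + 1) := by
              rw [e2]
              obtain ⟨s, hs, d, hd, e3⟩ := pow_mul_coeff h1 N r hr
              rw [e3]
              exact add_mem (add_mem (mul_pow_mem_powSpan hs (by omega))
                (powSpan_mono (by omega) hd)) (powSpan_mono (by omega) hc)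
            obtain ⟨j', hj', e3⟩ := hsmall j ⟨⟨j, hj, rfl⟩, this⟩
            rwa [← Subtype.ext e3]
          have hsub : i - ⟨x ^ (k - N), hxk⟩ * j ∈ Ideal.span (s.image f : Set T) := by
            refine ih _ (sub_mem hi (Ideal.mul_mem_left _ _ hj)) ?_
            have : ((i - ⟨x ^ (k - N), hxk⟩ * j : T) : A) = b - x ^ (k - N) * c := by
              show (i : A) - x ^ (k - N) * (j : A) = _
              rw [e, e2, mul_add, ← mul_assoc, ← pow_add, Nat.sub_add_cancel hk.le]
              abel
            rw [this]
            refine sub_mem hb ?_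
            have h3 := pow_mul_powSpan h1 (k - N) hc
            rwa [Nat.add_sub_cancel' hk.le] at h3
          simpa using add_mem hsub hj'
    intro i hi
    obtain ⟨n, hn⟩ := exists_powSpan h1 i.2
    exact key n i hi hn

/-- The commutation condition `x r ∈ R x + R` may be checked on generators. -/
theorem ore_condition_closure (S : Set A) (x : A)
    (h : ∀ r ∈ S, ∃ s ∈ Subring.closure S, ∃ t ∈ Subring.closure S, x * r = s * x + t) :
    ∀ r ∈ Subring.closure S, ∃ s ∈ Subring.closure S, ∃ t ∈ Subring.closure S,
      x * r = s * x + t := by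
  intro r hr
  induction hr using Subring.closure_induction with
  | mem r hr => exact h r hr
  | zero => exact ⟨0, zero_mem _, 0, zero_mem _, by simp⟩
  | one => exact ⟨1, one_mem _, 0, zero_mem _, by simp⟩
  | add a b _ _ ha hb =>
    obtain ⟨s, hs, t, ht, e⟩ := ha
    obtain ⟨s', hs', t', ht', e'⟩ := hb
    exact ⟨s + s', add_mem hs hs', t + t', add_mem ht ht', by rw [mul_add, e, e', add_mul]; abel⟩
  | neg a _ ha =>
    obtain ⟨s, hs, t, ht, e⟩ := ha
    exact ⟨-s, neg_mem hs, -t, neg_mem ht, by rw [mul_neg, e]; noncomm_ring⟩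
  | mul a b _ hb' ha hb =>
    obtain ⟨s, hs, t, ht, e⟩ := ha
    obtain ⟨s', hs', t', ht', e'⟩ := hb
    refine ⟨s * s', mul_mem hs hs', s * t' + t * b, add_mem (mul_mem hs ht') (mul_mem ht hb'), ?_⟩
    rw [← mul_assoc, e, add_mul, mul_assoc s x b, e']
    noncomm_ring

/-- The commutation condition `r x ∈ x R + R` may be checked on generators. -/
theorem ore_condition_closure' (S : Set A) (x : A)
    (h : ∀ r ∈ S, ∃ s ∈ Subring.closure S, ∃ t ∈ Subring.closure S, r * x = x * s + t) :
    ∀ r ∈ Subring.closure S, ∃ s ∈ Subring.closure S, ∃ t ∈ Subring.closure S,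
      r * x = x * s + t := by
  intro r hr
  induction hr using Subring.closure_induction with
  | mem r hr => exact h r hr
  | zero => exact ⟨0, zero_mem _, 0, zero_mem _, by simp⟩
  | one => exact ⟨1, one_mem _, 0, zero_mem _, by simp⟩
  | add a b _ _ ha hb =>
    obtain ⟨s, hs, t, ht, e⟩ := ha
    obtain ⟨s', hs', t', ht', e'⟩ := hb
    exact ⟨s + s', add_mem hs hs', t + t', add_mem ht ht', by rw [mul_add, add_mul, e, e']; abel⟩
  | neg a _ ha =>
    obtain ⟨s, hs, t, ht, e⟩ := ha
    exact ⟨-s, neg_mem hs, -t, neg_mem ht, by rw [neg_mul, e]; noncomm_ring⟩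
  | mul a b ha' _ ha hb =>
    obtain ⟨s, hs, t, ht, e⟩ := ha
    obtain ⟨s', hs', t', ht', e'⟩ := hb
    refine ⟨s * s', mul_mem hs hs', t * s' + a * t', add_mem (mul_mem ht hs') (mul_mem ha' ht'), ?_⟩
    rw [mul_assoc, e', mul_add, ← mul_assoc, e]
    noncomm_ring

/-- The form used for iteration: adjoining one generator at a time, with the commutation conditions
checked on the previous generators only. -/
theorem isNoetherianRing_closure_insert (S : Set A) (x : A) [IsNoetherianRing (Subring.closure S)]
    (h1 : ∀ r ∈ S, ∃ s ∈ Subring.closure S, ∃ t ∈ Subring.closure S, x * r = s * x + t)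
    (h2 : ∀ r ∈ S, ∃ s ∈ Subring.closure S, ∃ t ∈ Subring.closure S, r * x = x * s + t) :
    IsNoetherianRing (Subring.closure (insert x S)) := by
  have h := isNoetherianRing_closure (Subring.closure S) x (ore_condition_closure S x h1)
    (ore_condition_closure' S x h2)
  have e : Subring.closure ((Subring.closure S : Set A) ∪ {x}) = Subring.closure (insert x S) := by
    rw [Subring.closure_union, Subring.closure_eq, Set.insert_eq, Subring.closure_union, sup_comm]
  rwa [e] at h

end OreExtension

/-! ### `Q` is right noetherian. -/

section Noetherian

variable {G : Type} [CommGroup G] (ε : G →* ℂˣ) (τ : MonoidAlgebra ℂ G)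

theorem Qu.grp_y (g : G) :
    Qu.grp ε τ g * Qu.y ε τ = (((ε g)⁻¹ : ℂ) • Qu.y ε τ) * Qu.grp ε τ g := by
  apply conj_to_comm
  simpa [Qu.gen, Qu.grp_apply] using Qu.mk_rel (ε := ε) (τ := τ) (QRel.grp_y g)

theorem Qu.ofCG_single (g : G) (c : ℂ) : Qu.ofCG ε τ (.single g c) = c • Qu.grp ε τ g := by
  simp [Qu.ofCG]

variable {ε τ}

/-- A group element passes a semiinvariant up to a scalar, so linear combinations pass it with
twisted coefficients. Together with `Qu.mul_ofCG_exists` this gives both Ore conditions for `x` and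
`y` over the group algebra. -/
theorem Qu.ofCG_mul_exists {a : Qu ε τ} {χ : G → ℂ}
    (h : ∀ g, Qu.grp ε τ g * a = (χ g • a) * Qu.grp ε τ g) (t : MonoidAlgebra ℂ G) :
    ∃ t', Qu.ofCG ε τ t * a = a * Qu.ofCG ε τ t' := by
  induction t using MonoidAlgebra.induction_linear with
  | zero => exact ⟨0, by simp⟩
  | add r s hr hs =>
    obtain ⟨r', hr⟩ := hr
    obtain ⟨s', hs⟩ := hs
    exact ⟨r' + s', by simp only [map_add, add_mul, mul_add, hr, hs]⟩
  | single g c =>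
    refine ⟨.single g (c * χ g), ?_⟩
    rw [Qu.ofCG_single, Qu.ofCG_single, smul_mul_assoc, h, smul_mul_assoc, mul_smul_comm, smul_smul]

theorem Qu.mul_ofCG_exists {a : Qu ε τ} {χ : G → ℂ} (hχ : ∀ g, χ g ≠ 0)
    (h : ∀ g, Qu.grp ε τ g * a = (χ g • a) * Qu.grp ε τ g) (t : MonoidAlgebra ℂ G) :
    ∃ t', a * Qu.ofCG ε τ t = Qu.ofCG ε τ t' * a := by
  induction t using MonoidAlgebra.induction_linear with
  | zero => exact ⟨0, by simp⟩
  | add r s hr hs =>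
    obtain ⟨r', hr⟩ := hr
    obtain ⟨s', hs⟩ := hs
    exact ⟨r' + s', by simp only [map_add, add_mul, mul_add, hr, hs]⟩
  | single g c =>
    refine ⟨.single g (c * (χ g)⁻¹), ?_⟩
    rw [Qu.ofCG_single, Qu.ofCG_single, smul_mul_assoc, h, smul_mul_assoc, mul_smul_comm, smul_smul,
      mul_assoc, inv_mul_cancel₀ (hχ g), mul_one]

/-- `Q` is right noetherian. -/
instance [Finite G] : IsNoetherianRing (Qu ε τ)ᵐᵒᵖ := by
  let S₀ : Set (Qu ε τ)ᵐᵒᵖ := Set.range fun t => op (Qu.ofCG ε τ t)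
  have mem : ∀ {S : Set (Qu ε τ)ᵐᵒᵖ} {s}, s ∈ S → s ∈ Subring.closure S := fun h =>
    Subring.subset_closure h
  have comm : ∀ (S : Set (Qu ε τ)ᵐᵒᵖ) (a : (Qu ε τ)ᵐᵒᵖ), (∀ r ∈ S, Commute a r) →
      (∀ r ∈ S, ∃ s ∈ Subring.closure S, ∃ t ∈ Subring.closure S, a * r = s * a + t) ∧
      (∀ r ∈ S, ∃ s ∈ Subring.closure S, ∃ t ∈ Subring.closure S, r * a = a * s + t) :=
    fun S a h => ⟨fun r hr => ⟨r, mem hr, 0, zero_mem _, by rw [(h r hr).eq, add_zero]⟩,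
      fun r hr => ⟨r, mem hr, 0, zero_mem _, by rw [(h r hr).eq, add_zero]⟩⟩
  -- The chain of extensions starts from the image of the group algebra, whose commutativity allows
  -- it to be mapped into the opposite ring. Then `z`, `w`, `y`, `x` are adjoined in this order, so
  -- that `τ z w`, the defect of commutation of `x` and `y`, is already a coefficient when `x` is
  -- added.
  have n₀ : IsNoetherianRing (Subring.closure S₀) := by
    let f : MonoidAlgebra ℂ G →+* (Qu ε τ)ᵐᵒᵖ :=
      (Qu.ofCG ε τ).toRingHom.toOpposite fun a b => by
        show Qu.ofCG ε τ a * Qu.ofCG ε τ b = Qu.ofCG ε τ b * Qu.ofCG ε τ a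
        rw [← map_mul, mul_comm, map_mul]
    have : Subring.closure S₀ = f.range := by
      rw [← Subring.closure_eq f.range, RingHom.coe_range]
      rfl
    rw [this]
    infer_instance
  let S₁ := insert (op (Qu.z ε τ)) S₀
  have n₁ : IsNoetherianRing (Subring.closure S₁) := by
    obtain ⟨h, h'⟩ := comm S₀ (op (Qu.z ε τ)) fun r _ => (Qu.z_comm ε τ r.unop).op
    exact isNoetherianRing_closure_insert _ _ h h'
  let S₂ := insert (op (Qu.w ε τ)) S₁
  have n₂ : IsNoetherianRing (Subring.closure S₂) := by
    obtain ⟨h, h'⟩ := comm S₁ (op (Qu.w ε τ)) fun r _ => (Qu.w_comm ε τ r.unop).op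
    exact isNoetherianRing_closure_insert _ _ h h'
  have hw : op (Qu.w ε τ) ∈ S₂ := Set.mem_insert _ _
  have hz : op (Qu.z ε τ) ∈ S₂ := Set.mem_insert_of_mem _ (Set.mem_insert _ _)
  have hc : ∀ t, op (Qu.ofCG ε τ t) ∈ S₂ := fun t =>
    Set.mem_insert_of_mem _ (Set.mem_insert_of_mem _ ⟨t, rfl⟩)
  have hεi : ∀ g : G, ((ε g : ℂ))⁻¹ ≠ 0 := fun g => inv_ne_zero (ε g).ne_zero
  let S₃ := insert (op (Qu.y ε τ)) S₂
  have n₃ : IsNoetherianRing (Subring.closure S₃) := by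
    refine isNoetherianRing_closure_insert _ _ ?_ ?_
    · rintro r (rfl | rfl | ⟨t, rfl⟩)
      · exact ⟨_, mem hw, 0, zero_mem _, by rw [((Qu.w_comm ε τ _).op).eq, add_zero]⟩
      · exact ⟨_, mem hz, 0, zero_mem _, by rw [((Qu.z_comm ε τ _).op).eq, add_zero]⟩
      · obtain ⟨t', h⟩ := Qu.ofCG_mul_exists (Qu.grp_y ε τ) t
        exact ⟨_, mem (hc t'), 0, zero_mem _, by rw [add_zero, ← op_mul, h, op_mul]⟩
    · rintro r (rfl | rfl | ⟨t, rfl⟩)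
      · exact ⟨_, mem hw, 0, zero_mem _, by rw [((Qu.w_comm ε τ _).op).eq, add_zero]⟩
      · exact ⟨_, mem hz, 0, zero_mem _, by rw [((Qu.z_comm ε τ _).op).eq, add_zero]⟩
      · obtain ⟨t', h⟩ := Qu.mul_ofCG_exists hεi (Qu.grp_y ε τ) t
        exact ⟨_, mem (hc t'), 0, zero_mem _, by rw [add_zero, ← op_mul, h, op_mul]⟩
  have hτ : op (Qu.ofCG ε τ τ * (Qu.z ε τ * Qu.w ε τ)) ∈ Subring.closure S₃ := by
    rw [op_mul, op_mul]
    exact mul_mem (mul_mem (mem (Set.mem_insert_of_mem _ hw)) (mem (Set.mem_insert_of_mem _ hz)))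
      (mem (Set.mem_insert_of_mem _ (hc τ)))
  let S₄ := insert (op (Qu.x ε τ)) S₃
  have n₄ : IsNoetherianRing (Subring.closure S₄) := by
    refine isNoetherianRing_closure_insert _ _ ?_ ?_
    · rintro r (rfl | rfl | rfl | ⟨t, rfl⟩)
      -- In the opposite ring the relation `yx = xy + τzw` reads `op x * op y = op y * op x + op
      -- (τzw)`.
      · refine ⟨_, mem (Set.mem_insert _ _), _, hτ, ?_⟩
        rw [← op_mul, ← op_mul, ← MulOpposite.op_add, ← Qu.yx, add_sub_cancel]
      · exact ⟨_, mem (Set.mem_insert_of_mem _ hw), 0, zero_mem _, by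
          rw [((Qu.w_comm ε τ _).op).eq, add_zero]⟩
      · exact ⟨_, mem (Set.mem_insert_of_mem _ hz), 0, zero_mem _, by
          rw [((Qu.z_comm ε τ _).op).eq, add_zero]⟩
      · obtain ⟨t', h⟩ := Qu.ofCG_mul_exists (Qu.grp_x ε τ) t
        exact ⟨_, mem (Set.mem_insert_of_mem _ (hc t')), 0, zero_mem _, by
          rw [add_zero, ← op_mul, h, op_mul]⟩
    · rintro r (rfl | rfl | rfl | ⟨t, rfl⟩)
      · refine ⟨_, mem (Set.mem_insert _ _), _, neg_mem hτ, ?_⟩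
        rw [← op_mul, ← op_mul, ← MulOpposite.op_neg, ← MulOpposite.op_add, ← Qu.yx, neg_sub,
          add_sub_cancel]
      · exact ⟨_, mem (Set.mem_insert_of_mem _ hw), 0, zero_mem _, by
          rw [((Qu.w_comm ε τ _).op).eq, add_zero]⟩
      · exact ⟨_, mem (Set.mem_insert_of_mem _ hz), 0, zero_mem _, by
          rw [((Qu.z_comm ε τ _).op).eq, add_zero]⟩
      · obtain ⟨t', h⟩ := Qu.mul_ofCG_exists (fun g => (ε g).ne_zero) (Qu.grp_x ε τ) t
        exact ⟨_, mem (Set.mem_insert_of_mem _ (hc t')), 0, zero_mem _, by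
          rw [add_zero, ← op_mul, h, op_mul]⟩
  have htop : Subring.closure S₄ = ⊤ := by
    rw [eq_top_iff]
    rintro ⟨q⟩ -
    show op q ∈ _
    induction q using Qu.gen_induction with
    | hs c =>
      refine mem (Set.mem_insert_of_mem _ (Set.mem_insert_of_mem _ ?_))
      have := hc (algebraMap ℂ _ c)
      rwa [AlgHom.commutes] at this
    | hg t =>
      cases t with
      | grp g =>
        refine mem (Set.mem_insert_of_mem _ (Set.mem_insert_of_mem _ ?_))
        have := hc (.single g 1)
        rwa [Qu.ofCG_single, one_smul] at this
      | x => exact mem (Set.mem_insert _ _)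
      | z => exact mem (Set.mem_insert_of_mem _ (Set.mem_insert_of_mem _ hz))
      | y => exact mem (Set.mem_insert_of_mem _ (Set.mem_insert _ _))
      | w => exact mem (Set.mem_insert_of_mem _ (Set.mem_insert_of_mem _ hw))
    | hm a b h1 h2 => rw [op_mul]; exact mul_mem h2 h1
    | ha a b h1 h2 => rw [MulOpposite.op_add]; exact add_mem h1 h2
  rw [htop] at n₄
  exact isNoetherianRing_of_ringEquiv _ Subring.topEquiv

end Noetherian

end NCQuadric
end

noncomputable section

namespace NCQuadric

/-! ### Ordered monomials span `Q`. -/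

section PBW

variable {G : Type} [CommGroup G] (ε : G →* ℂˣ) (τ : MonoidAlgebra ℂ G)

/-- The ordered monomial `x^a z^c y^b w^e g`. -/
def Qu.mon (a c b e : ℕ) (g : G) : Qu ε τ :=
  Qu.z ε τ ^ c * Qu.w ε τ ^ e * (Qu.x ε τ ^ a * (Qu.y ε τ ^ b * Qu.grp ε τ g))

/-- The span of the ordered monomials of a given bidegree. -/
def Qu.monSpan (d : ℤ × ℤ) : Submodule ℂ (Qu ε τ) :=
  Submodule.span ℂ {q | ∃ (a c b e : ℕ) (g : G), (a + c : ℤ) = d.1 ∧ (b + e : ℤ) = d.2 ∧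
    q = Qu.mon ε τ a c b e g}

variable {ε τ}

theorem Qu.mon_mem {a c b e : ℕ} (g : G) {d : ℤ × ℤ} (h1 : (a + c : ℤ) = d.1)
    (h2 : (b + e : ℤ) = d.2) : Qu.mon ε τ a c b e g ∈ Qu.monSpan ε τ d :=
  Submodule.subset_span ⟨a, c, b, e, g, h1, h2, rfl⟩

theorem Qu.monSpan_le_of_forall {d : ℤ × ℤ} (f : Qu ε τ →ₗ[ℂ] Qu ε τ) (N : Submodule ℂ (Qu ε τ))
    (h : ∀ (a c b e : ℕ) (g : G), (a + c : ℤ) = d.1 → (b + e : ℤ) = d.2 → f (Qu.mon ε τ a c b e g) ∈ N)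
    {q : Qu ε τ} (hq : q ∈ Qu.monSpan ε τ d) : f q ∈ N := by
  have : Qu.monSpan ε τ d ≤ N.comap f := by
    refine Submodule.span_le.mpr ?_
    rintro _ ⟨a, c, b, e, g, h1, h2, rfl⟩
    exact h a c b e g h1 h2
  exact this hq

theorem Qu.z_mul_mon (a c b e : ℕ) (g : G) :
    Qu.z ε τ * Qu.mon ε τ a c b e g = Qu.mon ε τ a (c + 1) b e g := by
  rw [Qu.mon, Qu.mon, pow_succ']
  simp only [mul_assoc]

theorem Qu.w_mul_mon (a c b e : ℕ) (g : G) :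
    Qu.w ε τ * Qu.mon ε τ a c b e g = Qu.mon ε τ a c b (e + 1) g := by
  rw [Qu.mon, Qu.mon, pow_succ']
  simp only [← mul_assoc]
  rw [(Qu.w_comm ε τ (Qu.z ε τ ^ c)).eq]

theorem Qu.x_mul_mon (a c b e : ℕ) (g : G) :
    Qu.x ε τ * Qu.mon ε τ a c b e g = Qu.mon ε τ (a + 1) c b e g := by
  rw [Qu.mon, Qu.mon, pow_succ']
  have h := (((Qu.z_comm ε τ (Qu.x ε τ)).pow_left c).mul_left
    ((Qu.w_comm ε τ (Qu.x ε τ)).pow_left e)).eq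
  rw [← mul_assoc (Qu.x ε τ), ← h]
  simp only [mul_assoc]

theorem Qu.y_mul_mon_zero (c b e : ℕ) (g : G) :
    Qu.y ε τ * Qu.mon ε τ 0 c b e g = Qu.mon ε τ 0 c (b + 1) e g := by
  rw [Qu.mon, Qu.mon, pow_succ', pow_zero, one_mul, one_mul]
  have h := (((Qu.z_comm ε τ (Qu.y ε τ)).pow_left c).mul_left
    ((Qu.w_comm ε τ (Qu.y ε τ)).pow_left e)).eq
  rw [← mul_assoc (Qu.y ε τ), ← h]
  simp only [mul_assoc]

theorem grp_mul_pow {A : Type*} [Ring A] [Algebra ℂ A] (f : G →* A) (χ : ℂ) (x : A) (g : G)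
    (h : f g * x = (χ • x) * f g) (a : ℕ) : f g * x ^ a = χ ^ a • (x ^ a * f g) := by
  induction a with
  | zero => simp
  | succ a ih =>
    rw [pow_succ, ← mul_assoc, ih, smul_mul_assoc, mul_assoc, h, smul_mul_assoc, mul_smul_comm,
      smul_smul, ← pow_succ, mul_assoc]

theorem Qu.grp_mul_mon (h : G) (a c b e : ℕ) (g : G) :
    Qu.grp ε τ h * Qu.mon ε τ a c b e g =
      ((ε h : ℂ) ^ a * ((ε h : ℂ)⁻¹) ^ b) • Qu.mon ε τ a c b e (h * g) := by
  rw [Qu.mon, Qu.mon]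
  have hh := (((Qu.z_comm ε τ (Qu.grp ε τ h)).pow_left c).mul_left
    ((Qu.w_comm ε τ (Qu.grp ε τ h)).pow_left e)).eq
  rw [← mul_assoc (Qu.grp ε τ h), ← hh, mul_assoc, ← mul_assoc (Qu.grp ε τ h),
    grp_mul_pow _ _ _ _ (Qu.grp_x ε τ h), smul_mul_assoc, mul_assoc (Qu.x ε τ ^ a),
    ← mul_assoc (Qu.grp ε τ h), grp_mul_pow _ _ _ _ (Qu.grp_y ε τ h), smul_mul_assoc,
    mul_assoc (Qu.y ε τ ^ b), ← map_mul]
  simp only [mul_smul_comm, smul_smul]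

/-- Rewriting into normal order: `z`, `w`, `x` and group elements act on ordered monomials directly,
and only `y` has to be moved past a power of `x`. -/
theorem Qu.gen_mul_monSpan {d : ℤ × ℤ} (t : QGen G) {q : Qu ε τ} (hq : q ∈ Qu.monSpan ε τ d) :
    Qu.gen ε τ t * q ∈ Qu.monSpan ε τ (t.deg + d) := by
  have hgrp : ∀ (h : G) (d : ℤ × ℤ) (q : Qu ε τ), q ∈ Qu.monSpan ε τ d →
      Qu.grp ε τ h * q ∈ Qu.monSpan ε τ d := fun h d q hq => by
    refine Qu.monSpan_le_of_forall (LinearMap.mulLeft ℂ _) _ (fun a c b e g h1 h2 => ?_) hq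
    rw [LinearMap.mulLeft_apply, Qu.grp_mul_mon]
    exact Submodule.smul_mem _ _ (Qu.mon_mem _ h1 h2)
  cases t with
  | grp h =>
    rw [QGen.deg, zero_add]
    exact hgrp h d q hq
  | x =>
    refine Qu.monSpan_le_of_forall (LinearMap.mulLeft ℂ _) _ (fun a c b e g h1 h2 => ?_) hq
    rw [LinearMap.mulLeft_apply, Qu.x_mul_mon]
    exact Qu.mon_mem _ (by simp [QGen.deg, ← h1]; ring) (by simp [QGen.deg, ← h2])
  | z =>
    refine Qu.monSpan_le_of_forall (LinearMap.mulLeft ℂ _) _ (fun a c b e g h1 h2 => ?_) hq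
    rw [LinearMap.mulLeft_apply, Qu.z_mul_mon]
    exact Qu.mon_mem _ (by simp [QGen.deg, ← h1]; ring) (by simp [QGen.deg, ← h2])
  | w =>
    refine Qu.monSpan_le_of_forall (LinearMap.mulLeft ℂ _) _ (fun a c b e g h1 h2 => ?_) hq
    rw [LinearMap.mulLeft_apply, Qu.w_mul_mon]
    exact Qu.mon_mem _ (by simp [QGen.deg, ← h1]) (by simp [QGen.deg, ← h2]; ring)
  | y =>
    have hx : ∀ (d : ℤ × ℤ) (q : Qu ε τ), q ∈ Qu.monSpan ε τ d →
        Qu.x ε τ * q ∈ Qu.monSpan ε τ (d + (1, 0)) := fun d q hq => by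
      refine Qu.monSpan_le_of_forall (LinearMap.mulLeft ℂ _) _ (fun a c b e g h1 h2 => ?_) hq
      rw [LinearMap.mulLeft_apply, Qu.x_mul_mon]
      exact Qu.mon_mem _ (by simp [← h1]; ring) (by simp [← h2])
    have hτ : ∀ (t : MonoidAlgebra ℂ G) (d : ℤ × ℤ) (q : Qu ε τ), q ∈ Qu.monSpan ε τ d →
        Qu.ofCG ε τ t * q ∈ Qu.monSpan ε τ d := fun t d q hq => by
      induction t using MonoidAlgebra.induction_linear with
      | zero => simp
      | add r s hr hs => rw [map_add, add_mul]; exact add_mem hr hs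
      | single g c =>
        rw [Qu.ofCG_single, smul_mul_assoc]
        exact Submodule.smul_mem _ _ (hgrp g d q hq)
    refine Qu.monSpan_le_of_forall (LinearMap.mulLeft ℂ _) _ (fun a c b e g h1 h2 => ?_) hq
    rw [LinearMap.mulLeft_apply]
    clear hq
    -- Induction on the exponent of `x`: each passage of `y` over `x` leaves the correction `τ z w`,
    -- which has the same bidegree `(1,1)` as `yx`.
    induction a generalizing d with
    | zero =>
      rw [Qu.y_mul_mon_zero]
      exact Qu.mon_mem _ (by simp [QGen.deg, ← h1]) (by simp [QGen.deg, ← h2]; ring)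
    | succ a ih =>
      have hyx : Qu.y ε τ * Qu.x ε τ = Qu.x ε τ * Qu.y ε τ +
        Qu.ofCG ε τ τ * (Qu.z ε τ * Qu.w ε τ) := by rw [← Qu.yx, add_sub_cancel]
      rw [← Qu.x_mul_mon, ← mul_assoc, hyx, add_mul, mul_assoc, mul_assoc, mul_assoc, Qu.w_mul_mon,
        Qu.z_mul_mon]
      refine add_mem ?_ (hτ _ _ _ (Qu.mon_mem _ ?_ ?_))
      · have := hx _ _ (ih (d := d - (1, 0)) (by simp [← h1]; ring) (by simp [← h2]))
        rwa [add_assoc, sub_add_cancel] at this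
      · simp [QGen.deg, ← h1]; ring
      · simp [QGen.deg, ← h2]; ring

/-- The ordered monomials of bidegree `d` span `Q_d`. -/
theorem Qu.grading_le_monSpan (d : ℤ × ℤ) : Qu.grading ε τ d ≤ Qu.monSpan ε τ d := by
  refine Submodule.span_le.mpr ?_
  rintro _ ⟨l, rfl, rfl⟩
  show (l.map (Qu.gen ε τ)).prod ∈ Qu.monSpan ε τ (l.map QGen.deg).sum
  induction l with
  | nil =>
    have : Qu.mon ε τ 0 0 0 0 1 = 1 := by simp [Qu.mon]
    simp only [List.map_nil, List.prod_nil, List.sum_nil]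
    rw [← this]
    exact Qu.mon_mem _ (by simp) (by simp)
  | cons t l ih =>
    simp only [List.map_cons, List.prod_cons, List.sum_cons]
    exact Qu.gen_mul_monSpan t ih

theorem Qu.mon_mem_grading {a c b e : ℕ} (g : G) {d : ℤ × ℤ} (h1 : (a + c : ℤ) = d.1)
    (h2 : (b + e : ℤ) = d.2) : Qu.mon ε τ a c b e g ∈ Qu.grading ε τ d := by
  have hp : ∀ (t : QGen G) (k : ℕ), Qu.gen ε τ t ^ k ∈ Qu.grading ε τ (k • t.deg) := by
    intro t k
    have := Qu.word_mem ε τ (List.replicate k t)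
    simpa using this
  have := Qu.mul_mem ε τ (Qu.mul_mem ε τ (hp .z c) (hp .w e))
    (Qu.mul_mem ε τ (hp .x a) (Qu.mul_mem ε τ (hp .y b) (Qu.gen_mem ε τ (.grp g))))
  have hd : c • (QGen.z : QGen G).deg + e • (QGen.w : QGen G).deg +
      (a • (QGen.x : QGen G).deg + (b • (QGen.y : QGen G).deg + (QGen.grp g).deg)) = d := by
    ext
    · simp [QGen.deg, ← h1]; ring
    · simp [QGen.deg, ← h2]; ring
  rwa [hd] at this

theorem Qu.monSpan_eq (d : ℤ × ℤ) : Qu.monSpan ε τ d = Qu.grading ε τ d := by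
  refine le_antisymm (Submodule.span_le.mpr ?_) (Qu.grading_le_monSpan d)
  rintro _ ⟨a, c, b, e, g, h1, h2, rfl⟩
  exact Qu.mon_mem_grading g h1 h2

theorem theta_mon (a c b e : ℕ) (g : G) :
    theta ε τ (Qu.mon ε τ a c b e g) = Bt.x ε τ ^ a * (Bt.y ε τ ^ b * Bt.grp ε τ g) := by
  simp [Qu.mon, theta_gen, Qu.grp_apply, Bt.grp_apply]

end PBW

/-! ### The regular representation of `B` and its PBW basis. -/

section Representation

open Polynomial

variable {G : Type} [CommGroup G] (ε : G →* ℂˣ) (τ : MonoidAlgebra ℂ G)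

/-- The space with basis `x^a y^b g`. -/
abbrev Space (G : Type) := ℕ × G →₀ ℂ[X]

/-- The coefficient `∑_{k < a} ε(h)^{k - b}` of `x^{a-1} y^b h` in `[y, x^a] y^b`, for `τ = h`. -/
def commCoeff (h : G) (b a : ℕ) : ℂ := ∑ k ∈ Finset.range a, ((ε h ^ ((k : ℤ) - b) : ℂˣ) : ℂ)

/-- The difference operator `x^a ↦ (∑_{k < a} ε(h)^{k - b}) x^{a-1}`. -/
def dunkl (h : G) (b : ℕ) : ℂ[X] →ₗ[ℂ] ℂ[X] :=
  Polynomial.lsum fun a => commCoeff ε h b a • Polynomial.monomial (a - 1)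

/-- The scaling `f(x) ↦ f(ε(h) x)`. -/
def scale (h : G) : ℂ[X] →ₗ[ℂ] ℂ[X] := (aeval (C (ε h : ℂ) * X)).toLinearMap

/-- The operator of left multiplication by `h`. -/
def opGrp (h : G) : Space G →ₗ[ℂ] Space G :=
  Finsupp.lsum ℂ fun i =>
    ((ε h ^ (-(i.1 : ℤ)) : ℂˣ) : ℂ) • (Finsupp.lsingle (i.1, h * i.2)).comp (scale ε h)

/-- The operator of left multiplication by `y`. -/
def opY : Space G →ₗ[ℂ] Space G :=
  Finsupp.lsum ℂ fun i => Finsupp.lsingle (i.1 + 1, i.2) +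
    τ.coeff.sum fun h t => t • (Finsupp.lsingle (i.1, h * i.2)).comp (dunkl ε h i.1)

/-- The operator of left multiplication by `x`. -/
def opX : Space G →ₗ[ℂ] Space G := Algebra.lsmul ℂ ℂ (Space G) (X : ℂ[X])

variable {ε τ}

theorem dunkl_monomial (h : G) (b a : ℕ) (c : ℂ) :
    dunkl ε h b (monomial a c) = commCoeff ε h b a • monomial (a - 1) c := by
  rw [dunkl, lsum_apply, sum_monomial_index]
  · rfl
  · simp

theorem scale_monomial (h : G) (a : ℕ) (c : ℂ) :
    scale ε h (monomial a c) = (ε h : ℂ) ^ a • monomial a c := by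
  rw [scale, AlgHom.toLinearMap_apply, aeval_monomial, mul_pow, ← C_pow, smul_eq_C_mul,
    ← C_mul_X_pow_eq_monomial, algebraMap_eq]
  ring

theorem opGrp_single (h : G) (b : ℕ) (g : G) (a : ℕ) (c : ℂ) :
    opGrp ε h (Finsupp.single (b, g) (monomial a c)) =
      ((ε h ^ ((a : ℤ) - b) : ℂˣ) : ℂ) • Finsupp.single (b, h * g) (monomial a c) := by
  rw [opGrp, Finsupp.lsum_single, LinearMap.smul_apply, LinearMap.comp_apply, scale_monomial,
    map_smul, smul_smul]
  congr 1
  rw [← Units.val_pow_eq_pow_val, ← Units.val_mul, ← zpow_natCast, ← zpow_add, neg_add_eq_sub]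

theorem opY_single (b : ℕ) (g : G) (a : ℕ) (c : ℂ) :
    opY ε τ (Finsupp.single (b, g) (monomial a c)) =
      Finsupp.single (b + 1, g) (monomial a c) + τ.coeff.sum fun h t =>
        (t * commCoeff ε h b a) • Finsupp.single (b, h * g) (monomial (a - 1) c) := by
  rw [opY, Finsupp.lsum_single, LinearMap.add_apply, Finsupp.sum, LinearMap.sum_apply]
  congr 1
  refine Finset.sum_congr rfl fun h _ => ?_
  rw [LinearMap.smul_apply, LinearMap.comp_apply, dunkl_monomial, map_smul, smul_smul]
  rfl

theorem opX_single {H : Type} (b : ℕ) (g : H) (a : ℕ) (c : ℂ) :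
    opX (Finsupp.single (b, g) (monomial a c)) = Finsupp.single (b, g) (monomial (a + 1) c) := by
  show (X : ℂ[X]) • Finsupp.single (b, g) (monomial a c) = _
  rw [Finsupp.smul_single, smul_eq_mul, X_mul_monomial]

theorem space_hom_ext {H : Type} {f g : Space H →ₗ[ℂ] Space H}
    (h : ∀ b k a c, f (Finsupp.single (b, k) (monomial a c)) =
      g (Finsupp.single (b, k) (monomial a c))) : f = g := by
  refine Finsupp.lhom_ext' fun i => Polynomial.lhom_ext' fun a => LinearMap.ext fun c => ?_
  exact h i.1 i.2 a c

theorem commCoeff_succ (h : G) (b a : ℕ) :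
    commCoeff ε h b (a + 1) = commCoeff ε h b a + ((ε h ^ ((a : ℤ) - b) : ℂˣ) : ℂ) :=
  Finset.sum_range_succ _ _

theorem commCoeff_zero (h : G) (b : ℕ) : commCoeff ε h b 0 = 0 := Finset.sum_range_zero _

theorem opGrp_one : opGrp ε (1 : G) = LinearMap.id := by
  refine space_hom_ext fun b k a c => ?_
  rw [opGrp_single]
  simp

theorem opGrp_mul (h h' : G) : opGrp ε (h * h') = opGrp ε h ∘ₗ opGrp ε h' := by
  refine space_hom_ext fun b k a c => ?_
  rw [LinearMap.comp_apply, opGrp_single, opGrp_single, map_smul, opGrp_single, smul_smul,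
    map_mul, mul_zpow, Units.val_mul, mul_assoc, mul_comm ((ε h ^ _ : ℂˣ) : ℂ)]

theorem opGrp_opX (h : G) : opGrp ε h ∘ₗ opX = (ε h : ℂ) • (opX ∘ₗ opGrp ε h) := by
  refine space_hom_ext fun b k a c => ?_
  rw [LinearMap.smul_apply, LinearMap.comp_apply, LinearMap.comp_apply, opX_single, opGrp_single,
    opGrp_single, map_smul, opX_single, smul_smul, ← Units.val_mul, ← zpow_one_add]
  congr 3
  push_cast; ring

theorem opGrp_opY (h : G) :
    opGrp ε h ∘ₗ opY ε τ = ((ε h)⁻¹ : ℂ) • (opY ε τ ∘ₗ opGrp ε h) := by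
  refine space_hom_ext fun b k a c => ?_
  rw [LinearMap.smul_apply, LinearMap.comp_apply, LinearMap.comp_apply, opY_single, opGrp_single,
    map_smul, opY_single, map_add, opGrp_single, smul_add, smul_add]
  have e1 : ((ε h ^ ((a : ℤ) - ((b + 1 : ℕ) : ℤ)) : ℂˣ) : ℂ) =
      ((ε h : ℂ))⁻¹ * ((ε h ^ ((a : ℤ) - b) : ℂˣ) : ℂ) := by
    rw [← Units.val_inv_eq_inv_val, ← Units.val_mul, ← zpow_neg_one, ← zpow_add]
    congr 2
    push_cast; ring
  congr 1
  · rw [e1, mul_smul]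
  · rw [smul_smul, ← e1]
    simp only [Finsupp.sum, map_sum, Finset.smul_sum, map_smul]
    refine Finset.sum_congr rfl fun h' _ => ?_
    -- For `a = 0` the truncated exponent `a - 1` is harmless, since its coefficient `commCoeff` is
    -- an empty sum.
    rcases a with _ | a
    · simp [commCoeff_zero]
    · rw [opGrp_single, smul_smul, smul_smul, mul_comm]
      simp only [Nat.add_sub_cancel]
      rw [mul_left_comm h h' k]
      congr 4
      push_cast; ring

/-- The sums `commCoeff` telescope: the difference of the values at `a + 1` and `a` is the scalar
`ε(h)^(a-b)` by which `h` acts on `x^a y^b`. -/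
theorem opY_opX : opY ε τ ∘ₗ opX - opX ∘ₗ opY ε τ = τ.coeff.sum fun h t => t • opGrp ε h := by
  refine space_hom_ext fun b k a c => ?_
  rw [LinearMap.sub_apply, LinearMap.comp_apply, LinearMap.comp_apply, opX_single, opY_single,
    opY_single, map_add, opX_single, add_sub_add_left_eq_sub]
  simp only [Finsupp.sum, map_sum, LinearMap.sum_apply, map_smul]
  rw [← Finset.sum_sub_distrib]
  refine Finset.sum_congr rfl fun h _ => ?_
  rw [LinearMap.smul_apply, opGrp_single, opX_single, commCoeff_succ, smul_smul]
  rcases a with _ | a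
  · simp [commCoeff_zero]
  · simp only [Nat.add_sub_cancel]
    rw [← sub_smul]
    congr 1
    ring

variable (ε τ)

/-- The left regular representation of `B` in the basis `x^a y^b g`. -/
def Bt.rep : Bt ε τ →ₐ[ℂ] Module.End ℂ (Space G) :=
  RingQuot.liftAlgHom ℂ ⟨FreeAlgebra.lift ℂ fun t => match t with
    | .grp g => opGrp ε g
    | .x => opX
    | .y => opY ε τ, by
    have hinv : ∀ g : G, opGrp ε g * opGrp ε g⁻¹ = 1 := fun g => by
      rw [Module.End.mul_eq_comp, ← opGrp_mul, mul_inv_cancel, opGrp_one]; rfl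
    intro a b h
    cases h with
    | grp_one =>
      simp only [map_one, FreeAlgebra.lift_ι_apply]
      exact opGrp_one
    | grp_mul g h =>
      have := opGrp_mul (ε := ε) g h
      rw [← Module.End.mul_eq_comp] at this
      simpa using this
    | grp_x g =>
      have := opGrp_opX (ε := ε) g
      rw [← Module.End.mul_eq_comp, ← Module.End.mul_eq_comp] at this
      simp only [map_mul, map_smul, FreeAlgebra.lift_ι_apply]
      rw [this, smul_mul_assoc, mul_assoc, hinv, mul_one]
    | grp_y g =>
      have := opGrp_opY (ε := ε) (τ := τ) g
      rw [← Module.End.mul_eq_comp, ← Module.End.mul_eq_comp] at this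
      simp only [map_mul, map_smul, FreeAlgebra.lift_ι_apply]
      rw [this, smul_mul_assoc, mul_assoc, hinv, mul_one]
    | yx =>
      have := opY_opX (ε := ε) (τ := τ)
      rw [← Module.End.mul_eq_comp, ← Module.End.mul_eq_comp] at this
      simpa [liftGrp, Finsupp.sum, map_sum] using this⟩

theorem Bt.rep_gen (t : BGen G) : Bt.rep ε τ (Bt.gen ε τ t) = match t with
    | .grp g => opGrp ε g
    | .x => opX
    | .y => opY ε τ := by
  refine (RingQuot.liftAlgHom_mkAlgHom_apply ℂ _ _ _).trans ?_
  simp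

/-- The coordinates of an element of `B` in the basis `x^a y^b g`. -/
def Bt.coord : Bt ε τ →ₗ[ℂ] Space G :=
  (LinearMap.applyₗ (Finsupp.single (0, 1) (1 : ℂ[X]))).comp (Bt.rep ε τ).toLinearMap

variable {ε τ}

theorem Bt.coord_apply (b : Bt ε τ) :
    Bt.coord ε τ b = Bt.rep ε τ b (Finsupp.single (0, 1) (1 : ℂ[X])) := rfl

/-- Coordinates are `ℂ[x]`-linear because `x` acts on the model space as multiplication by `X`. This
gives both torsion-freeness over `ℂ[x]` and control of the degree in `x`. -/
theorem Bt.coord_aeval_mul (f : ℂ[X]) (b : Bt ε τ) :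
    Bt.coord ε τ (aeval (Bt.x ε τ) f * b) = f • Bt.coord ε τ b := by
  have h : Bt.rep ε τ (aeval (Bt.x ε τ) f) = Algebra.lsmul ℂ ℂ (Space G) f := by
    rw [← aeval_algHom_apply, Bt.rep_gen]
    show aeval (Algebra.lsmul ℂ ℂ (Space G) (X : ℂ[X])) f = _
    rw [aeval_algHom_apply, aeval_X_left_apply]
  rw [Bt.coord_apply, map_mul, h]
  rfl

theorem Bt.coord_y_grp (b : ℕ) (g : G) :
    Bt.coord ε τ (Bt.y ε τ ^ b * Bt.grp ε τ g) = Finsupp.single (b, g) 1 := by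
  have h1 : ∀ b : ℕ, (1 : ℂ[X]) = monomial 0 1 := fun _ => by rw [monomial_zero_left, C_1]
  rw [Bt.coord_apply, map_mul, map_pow, Bt.grp_apply, Bt.rep_gen, Bt.rep_gen, Module.End.mul_apply,
    h1 0, opGrp_single, mul_one]
  simp only [Nat.cast_zero, sub_self, zpow_zero, Units.val_one, one_smul]
  induction b with
  | zero => rfl
  | succ b ih =>
    rw [pow_succ', Module.End.mul_apply, ih, opY_single]
    simp [commCoeff_zero]

/-- The words `x^a y^b g` go to distinct basis vectors of `Space G`; this is the linear independence
half of the PBW theorem. -/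
theorem Bt.coord_mon (a b : ℕ) (g : G) :
    Bt.coord ε τ (Bt.x ε τ ^ a * (Bt.y ε τ ^ b * Bt.grp ε τ g)) =
      Finsupp.single (b, g) (X ^ a) := by
  have : Bt.x ε τ ^ a = aeval (Bt.x ε τ) (X ^ a : ℂ[X]) := by simp
  rw [this, Bt.coord_aeval_mul, Bt.coord_y_grp, Finsupp.smul_single, smul_eq_mul, mul_one]

end Representation

end NCQuadric
end

noncomputable section

namespace NCQuadric

/-! ### Normalized semiinvariant polynomials at `z = 1`. -/

section Dehomogenization

open Polynomial

variable {G : Type} [CommGroup G] {ε : G →* ℂˣ} {τ : MonoidAlgebra ℂ G}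

/-- The polynomial `P(x,1)`. -/
def SemiInv.dehom {n : ℕ} (P : SemiInv ε n) : ℂ[X] := MvPolynomial.aeval ![X, 1] P.poly

theorem SemiInv.add_eq {n : ℕ} (P : SemiInv ε n) {s : Fin 2 →₀ ℕ} (hs : s ∈ P.poly.support) :
    s 0 + s 1 = n := by
  rw [← P.homog (MvPolynomial.mem_support_iff.mp hs)]
  simp [Finsupp.weight_apply, Finsupp.sum_fintype]

theorem SemiInv.dehom_eq_sum {n : ℕ} (P : SemiInv ε n) :
    P.dehom = ∑ s ∈ P.poly.support, monomial (s 0) (P.poly.coeff s) := by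
  rw [SemiInv.dehom, MvPolynomial.aeval_def, MvPolynomial.eval₂_eq']
  refine Finset.sum_congr rfl fun s _ => ?_
  simp [C_mul_X_pow_eq_monomial]

/-- The coefficient of `x^n` is `P(1,0)`: every other monomial of `P` contains `z` and hence has a
smaller exponent of `x`. -/
theorem SemiInv.dehom_monic {n : ℕ} (P : SemiInv ε n) : P.dehom.Monic ∧ P.dehom.natDegree = n := by
  have hdeg : P.dehom.natDegree ≤ n := by
    rw [P.dehom_eq_sum]
    refine natDegree_sum_le_of_forall_le _ _ fun s hs => ?_
    have := P.add_eq hs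
    exact (natDegree_monomial_le _).trans (by omega)
  have hc : P.dehom.coeff n = 1 := by
    rw [← P.normalized, MvPolynomial.eval_eq', P.dehom_eq_sum, finsetSum_coeff]
    refine Finset.sum_congr rfl fun s hs => ?_
    have := P.add_eq hs
    rw [coeff_monomial]
    simp only [Fin.prod_univ_two, Matrix.cons_val_zero, Matrix.cons_val_one, one_pow, one_mul]
    by_cases h : s 1 = 0
    · rw [if_pos (by omega), h, pow_zero, mul_one]
    · rw [if_neg (by omega), zero_pow h, mul_zero]
  exact ⟨monic_of_natDegree_le_of_coeff_eq_one n hdeg hc,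
    natDegree_eq_of_le_of_coeff_ne_zero hdeg (by rw [hc]; exact one_ne_zero)⟩

variable (ε τ) in
theorem Bt.evalPoly_eq (R : MvPolynomial (Fin 2) ℂ) :
    Bt.evalPoly ε τ R = aeval (Bt.x ε τ) (MvPolynomial.aeval ![(X : ℂ[X]), 1] R) := by
  have : Bt.evalPoly ε τ = (aeval (Bt.x ε τ)).comp (MvPolynomial.aeval ![(X : ℂ[X]), 1]) := by
    apply MvPolynomial.algHom_ext
    intro i
    fin_cases i
    · simp [Bt.evalPoly, evalAt_X0]
    · simp [Bt.evalPoly, evalAt_X1]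
  rw [this]
  rfl

theorem SemiInv.evalPoly_eq {n : ℕ} (P : SemiInv ε n) :
    Bt.evalPoly ε τ P.poly = aeval (Bt.x ε τ) P.dehom := Bt.evalPoly_eq ε τ _

variable (ε τ) in
theorem theta_evalPoly (R : MvPolynomial (Fin 2) ℂ) :
    theta ε τ (Qu.evalPoly ε τ R) = Bt.evalPoly ε τ R := by
  have : (theta ε τ).comp (Qu.evalPoly ε τ) = Bt.evalPoly ε τ := by
    apply MvPolynomial.algHom_ext
    intro i
    fin_cases i
    · exact (congrArg (theta ε τ) (evalAt_X0 _ _ (Qu.xz ε τ))).trans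
        ((theta_gen ε τ .x).trans (evalAt_X0 _ _ _).symm)
    · exact (congrArg (theta ε τ) (evalAt_X1 _ _ (Qu.xz ε τ))).trans
        ((theta_gen ε τ .z).trans (evalAt_X1 _ _ _).symm)
  rw [← this]
  rfl

/-- By normalization, `P` is `x^n` on the line `z = 0`. -/
theorem SemiInv.evalPoly_eq_add {n : ℕ} (P : SemiInv ε n) :
    ∃ r, Qu.evalPoly ε τ P.poly = Qu.x ε τ ^ n + Qu.z ε τ * r := by
  -- The factor `0 ^ s 1` is `1` for monomials free of `z` and `0` otherwise, so one formula covers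
  -- both kinds, and these factors sum to `P(1,0) = 1`.
  have key : ∀ s ∈ P.poly.support, ∃ r, Qu.evalPoly ε τ (MvPolynomial.monomial s (P.poly.coeff s)) =
      algebraMap ℂ _ (P.poly.coeff s * 0 ^ s 1) * Qu.x ε τ ^ n + Qu.z ε τ * r := by
    intro s hs
    have h := P.add_eq hs
    have he : Qu.evalPoly ε τ (MvPolynomial.monomial s (P.poly.coeff s)) =
      P.poly.coeff s • (Qu.x ε τ ^ s 0 * Qu.z ε τ ^ s 1) := evalAt_monomial _ _ _ _ _
    rw [he]
    rcases hs1 : s 1 with _ | k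
    · refine ⟨0, ?_⟩
      have : s 0 = n := by omega
      rw [this, pow_zero, pow_zero, mul_one, mul_one, mul_zero, add_zero, Algebra.smul_def]
    · refine ⟨P.poly.coeff s • (Qu.z ε τ ^ k * Qu.x ε τ ^ s 0), ?_⟩
      rw [zero_pow (Nat.succ_ne_zero k), mul_zero, RingHom.map_zero, zero_mul, zero_add,
        mul_smul_comm, ← mul_assoc,
        ← pow_succ', ((Qu.z_comm ε τ (Qu.x ε τ ^ s 0)).pow_left (k + 1)).eq]
  choose! r hr using key
  refine ⟨∑ s ∈ P.poly.support, r s, ?_⟩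
  conv_lhs => rw [P.poly.as_sum]
  rw [map_sum, Finset.sum_congr rfl hr, Finset.sum_add_distrib, ← Finset.sum_mul, ← map_sum,
    ← Finset.mul_sum]
  have : ∑ s ∈ P.poly.support, P.poly.coeff s * (0 : ℂ) ^ s 1 = 1 := by
    rw [← P.normalized, MvPolynomial.eval_eq']
    refine Finset.sum_congr rfl fun s _ => ?_
    simp [Fin.prod_univ_two]
  rw [this, map_one, one_mul]

end Dehomogenization

/-! ### Homogenization, and divisibility by `z` and `w` in `Q`. -/

section Coordinates

open Polynomial

variable {G : Type} [CommGroup G] {ε : G →* ℂˣ} {τ : MonoidAlgebra ℂ G}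

/-- Coordinate vectors of elements of `B` of degree at most `d.1` in `x` and `d.2` in `y`. -/
def Bounded (d : ℤ × ℤ) (v : Space G) : Prop :=
  ∀ (a b : ℕ) (g : G), (v (b, g)).coeff a ≠ 0 → (a : ℤ) ≤ d.1 ∧ (b : ℤ) ≤ d.2

variable (ε τ) in
/-- Homogenization in bidegree `d`. -/
def Qu.homogenize (d : ℤ × ℤ) : Space G →ₗ[ℂ] Qu ε τ :=
  Finsupp.lsum ℂ fun i => Polynomial.lsum fun a => LinearMap.toSpanSingleton ℂ _
    (Qu.mon ε τ a (d.1 - a).toNat i.1 (d.2 - i.1).toNat i.2)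

theorem Qu.homogenize_apply (d : ℤ × ℤ) (v : Space G) :
    Qu.homogenize ε τ d v = v.sum fun i f => f.sum fun a c =>
      c • Qu.mon ε τ a (d.1 - a).toNat i.1 (d.2 - i.1).toNat i.2 := rfl

/-- In a fixed bidegree the exponents of `x` and `y` determine those of `z` and `w`, so nothing is
lost by setting `z = w = 1`. -/
theorem Qu.homogenize_coord {d : ℤ × ℤ} {q : Qu ε τ} (hq : q ∈ Qu.grading ε τ d) :
    Qu.homogenize ε τ d (Bt.coord ε τ (theta ε τ q)) = q := by
  have hq' := Qu.grading_le_monSpan d hq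
  induction hq' using Submodule.span_induction with
  | mem q h =>
    obtain ⟨a, c, b, e, g, h1, h2, rfl⟩ := h
    rw [theta_mon, Bt.coord_mon, Qu.homogenize_apply, Finsupp.sum_single_index (by simp),
      ← monomial_one_right_eq_X_pow, sum_monomial_index _ _ (by simp), one_smul]
    rw [← h1, ← h2]
    simp
  | zero => simp
  | add a b ha hb iha ihb =>
    rw [map_add, map_add, map_add, iha (Qu.monSpan_eq (ε := ε) (τ := τ) d ▸ ha),
      ihb (Qu.monSpan_eq (ε := ε) (τ := τ) d ▸ hb)]
  | smul c a ha ih =>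
    rw [map_smul, map_smul, map_smul, ih (Qu.monSpan_eq (ε := ε) (τ := τ) d ▸ ha)]

theorem Qu.eq_of_coord_eq {d : ℤ × ℤ} {q r : Qu ε τ} (hq : q ∈ Qu.grading ε τ d)
    (hr : r ∈ Qu.grading ε τ d)
    (h : Bt.coord ε τ (theta ε τ q) = Bt.coord ε τ (theta ε τ r)) : q = r := by
  rw [← Qu.homogenize_coord hq, h, Qu.homogenize_coord hr]

theorem Qu.bounded_coord {d : ℤ × ℤ} {q : Qu ε τ} (hq : q ∈ Qu.grading ε τ d) :
    Bounded d (Bt.coord ε τ (theta ε τ q)) := by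
  have hq' := Qu.grading_le_monSpan d hq
  clear hq
  intro a b g
  induction hq' using Submodule.span_induction with
  | mem q h =>
    obtain ⟨a', c, b', e, g', h1, h2, rfl⟩ := h
    intro h
    rw [theta_mon, Bt.coord_mon] at h
    by_cases hb : (b', g') = (b, g)
    · rw [hb, Finsupp.single_eq_same, coeff_X_pow] at h
      obtain ⟨rfl, rfl⟩ := Prod.ext_iff.mp hb
      have ha : a = a' := by
        by_contra ha
        exact h (if_neg ha)
      subst ha
      exact ⟨by rw [← h1]; simp, by rw [← h2]; simp⟩
    · rw [Finsupp.single_eq_of_ne (Ne.symm hb)] at h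
      simp at h
  | zero => simp
  | add q r _ _ hq hr =>
    intro h
    by_cases h' : ((Bt.coord ε τ (theta ε τ q)) (b, g)).coeff a = 0
    · refine hr fun h'' => h ?_
      rw [map_add, map_add, Finsupp.add_apply, coeff_add, h', h'', add_zero]
    · exact hq h'
  | smul c q _ hq =>
    intro h
    refine hq fun h' => h ?_
    rw [map_smul, map_smul, Finsupp.smul_apply, coeff_smul, h', smul_zero]

theorem Qu.homogenize_mem {d : ℤ × ℤ} {v : Space G} (hv : Bounded d v) :
    Qu.homogenize ε τ d v ∈ Qu.grading ε τ d := by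
  rw [Qu.homogenize_apply]
  refine Submodule.sum_mem _ fun i _ => Submodule.sum_mem _ fun a ha => Submodule.smul_mem _ _ ?_
  obtain ⟨h1, h2⟩ := hv a i.1 i.2 (mem_support_iff.mp ha)
  exact Qu.mon_mem_grading _ (by omega) (by omega)

/-- No bound on `v` is needed here: the truncated exponents only concern `z` and `w`, which `theta`
sends to `1`. -/
theorem Qu.coord_homogenize {d : ℤ × ℤ} (v : Space G) :
    Bt.coord ε τ (theta ε τ (Qu.homogenize ε τ d v)) = v := by
  rw [Qu.homogenize_apply]
  conv_rhs => rw [← v.sum_single]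
  simp only [Finsupp.sum, map_sum]
  refine Finset.sum_congr rfl fun i _ => ?_
  conv_rhs => rw [← (v i).sum_monomial_eq]
  simp only [Polynomial.sum, map_sum, map_smul, theta_mon, Bt.coord_mon]
  rw [Finsupp.single_finsetSum]
  refine Finset.sum_congr rfl fun a _ => ?_
  rw [Finsupp.smul_single, ← monomial_one_right_eq_X_pow, smul_monomial, smul_eq_mul, mul_one]

/-- An element killed in the localization is annihilated in `B` by a nonzero `p(x)`, and the
coordinate space has no `ℂ[x]`-torsion. -/
theorem Qu.num_theta_eq_zero {d : ℤ × ℤ} {q : Qu ε τ} (hq : q ∈ Qu.grading ε τ d)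
    (h : BRat.num ε τ (theta ε τ q) = 0) : q = 0 := by
  have h' : (theta ε τ q) /ₒ (1 : invS ε τ) = (0 : Bt ε τ) /ₒ (1 : invS ε τ) :=
    h.trans (map_zero (BRat.num ε τ)).symm
  rw [OreLocalization.oreDiv_eq_iff] at h'
  obtain ⟨⟨u, hu⟩, v, h1, h2⟩ := h'
  have huv : u = v := by simpa using h2
  obtain ⟨p, hp, rfl⟩ := hu
  have h3 : aeval (Bt.x ε τ) p * theta ε τ q = 0 := by
    rw [huv]
    simpa [Submonoid.smul_def] using h1.symm
  have h4 : p • Bt.coord ε τ (theta ε τ q) = 0 := by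
    rw [← Bt.coord_aeval_mul, h3, map_zero]
  refine Qu.eq_of_coord_eq hq (zero_mem _) ?_
  rw [(smul_eq_zero.mp h4).resolve_left hp.1, map_zero, map_zero]

/-- Divisibility by `z` means that the degree in `x` is below the maximum allowed by the bidegree.
As `P(x,1)` is monic of degree `k`, multiplication by it raises the degree in `x` by exactly `k`, so
a drop for the product forces a drop for `a`. -/
theorem Qu.exists_z_mul {k : ℕ} (P : SemiInv ε k) {d : ℤ × ℤ} {a v : Qu ε τ}
    (ha : a ∈ Qu.grading ε τ d) (hv : v ∈ Qu.grading ε τ (d + ((k : ℤ), 0) - (1, 0)))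
    (h : Qu.evalPoly ε τ P.poly * a = Qu.z ε τ * v) : ∃ a', a = Qu.z ε τ * a' := by
  have hco : P.dehom • Bt.coord ε τ (theta ε τ a) = Bt.coord ε τ (theta ε τ v) := by
    have := congrArg (theta ε τ) h
    rw [map_mul, map_mul, theta_evalPoly, theta_gen, one_mul, P.evalPoly_eq] at this
    rw [← Bt.coord_aeval_mul, this]
  obtain ⟨hm, hdeg⟩ := P.dehom_monic
  have hb : Bounded (d - (1, 0)) (Bt.coord ε τ (theta ε τ a)) := by
    intro i j g hij
    have hj := Qu.bounded_coord ha i j g hij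
    refine ⟨?_, by simpa using hj.2⟩
    set f := Bt.coord ε τ (theta ε τ a) (j, g) with hf
    have hf0 : f ≠ 0 := fun h0 => hij (by rw [h0, coeff_zero])
    -- The leading coefficient of the product bounds `natDegree f`, not just the exponent `i`.
    have h1 : (Bt.coord ε τ (theta ε τ v) (j, g)).coeff (k + f.natDegree) ≠ 0 := by
      have hk : k + f.natDegree = (P.dehom * f).natDegree := by rw [hm.natDegree_mul' hf0, hdeg]
      rw [← hco, Finsupp.smul_apply, smul_eq_mul, hk, coeff_natDegree]
      exact leadingCoeff_ne_zero.mpr (mul_ne_zero hm.ne_zero hf0)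
    have h2 := (Qu.bounded_coord hv _ j g h1).1
    have h3 := le_natDegree_of_ne_zero hij
    simp at h2 ⊢
    omega
  refine ⟨Qu.homogenize ε τ (d - (1, 0)) (Bt.coord ε τ (theta ε τ a)),
    Qu.eq_of_coord_eq ha ?_ ?_⟩
  · have := Qu.mul_mem ε τ (Qu.gen_mem ε τ .z) (Qu.homogenize_mem (ε := ε) (τ := τ) hb)
    simpa [QGen.deg] using this
  · rw [map_mul, theta_gen, one_mul, Qu.coord_homogenize]

/-- Divisibility by `w` concerns the degree in `y`, which multiplication by the nonzero polynomial
`P(x,1)` does not change. -/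
theorem Qu.exists_w_mul {k : ℕ} (P : SemiInv ε k) {d : ℤ × ℤ} {a v : Qu ε τ}
    (ha : a ∈ Qu.grading ε τ d) (hv : v ∈ Qu.grading ε τ (d + ((k : ℤ), 0) - (0, 1)))
    (h : Qu.evalPoly ε τ P.poly * a = Qu.w ε τ * v) : ∃ a', a = Qu.w ε τ * a' := by
  have hco : P.dehom • Bt.coord ε τ (theta ε τ a) = Bt.coord ε τ (theta ε τ v) := by
    have := congrArg (theta ε τ) h
    rw [map_mul, map_mul, theta_evalPoly, theta_gen, one_mul, P.evalPoly_eq] at this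
    rw [← Bt.coord_aeval_mul, this]
  obtain ⟨hm, hdeg⟩ := P.dehom_monic
  have hb : Bounded (d - (0, 1)) (Bt.coord ε τ (theta ε τ a)) := by
    intro i j g hij
    have hj := Qu.bounded_coord ha i j g hij
    refine ⟨by simpa using hj.1, ?_⟩
    set f := Bt.coord ε τ (theta ε τ a) (j, g) with hf
    have hf0 : f ≠ 0 := fun h0 => hij (by rw [h0, coeff_zero])
    have h1 : (Bt.coord ε τ (theta ε τ v) (j, g)).coeff (k + f.natDegree) ≠ 0 := by
      have hk : k + f.natDegree = (P.dehom * f).natDegree := by rw [hm.natDegree_mul' hf0, hdeg]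
      rw [← hco, Finsupp.smul_apply, smul_eq_mul, hk, coeff_natDegree]
      exact leadingCoeff_ne_zero.mpr (mul_ne_zero hm.ne_zero hf0)
    have h2 := (Qu.bounded_coord hv _ j g h1).2
    simpa using h2
  refine ⟨Qu.homogenize ε τ (d - (0, 1)) (Bt.coord ε τ (theta ε τ a)),
    Qu.eq_of_coord_eq ha ?_ ?_⟩
  · have := Qu.mul_mem ε τ (Qu.gen_mem ε τ .w) (Qu.homogenize_mem (ε := ε) (τ := τ) hb)
    simpa [QGen.deg] using this
  · rw [map_mul, theta_gen, one_mul, Qu.coord_homogenize]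

theorem Qu.proj_mul {e : ℤ × ℤ} {p : Qu ε τ} (hp : p ∈ Qu.grading ε τ e) (d : ℤ × ℤ) (a : Qu ε τ) :
    Qu.proj ε τ d (p * a) = p * Qu.proj ε τ (d - e) a := by
  show (Qu.coact ε τ (p * a)).coeff d = p * (Qu.coact ε τ a).coeff (d - e)
  rw [map_mul, Qu.coact_of_mem ε τ hp, AddMonoidAlgebra.coeff_single_mul_apply, neg_add_eq_sub]

theorem Qu.proj_mem (d : ℤ × ℤ) (a : Qu ε τ) : Qu.proj ε τ d a ∈ Qu.grading ε τ d := by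
  have ha : a ∈ ⨆ d, Qu.grading ε τ d := by rw [Qu.iSup_grading]; trivial
  induction ha using Submodule.iSup_induction' with
  | mem e a ha =>
    rw [Qu.proj_of_mem ε τ ha]
    split_ifs with h
    · rwa [← h]
    · exact zero_mem _
  | zero => rw [map_zero]; exact zero_mem _
  | add a b _ _ ha hb => rw [map_add]; exact add_mem ha hb

/-- Any element is the sum of its homogeneous components; this reduces the regularity statements to
homogeneous elements. -/
theorem Qu.mem_of_proj_mem (N : Submodule ℂ (Qu ε τ)) (a : Qu ε τ)
    (h : ∀ d, Qu.proj ε τ d a ∈ N) : a ∈ N := by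
  have key : ∀ a : Qu ε τ, (Qu.coact ε τ a).coeff.sum (fun _ q => q) = a := by
    intro a
    have ha : a ∈ ⨆ d, Qu.grading ε τ d := by rw [Qu.iSup_grading]; trivial
    induction ha using Submodule.iSup_induction' with
    | mem e a ha =>
      rw [Qu.coact_of_mem ε τ ha, AddMonoidAlgebra.coeff_single, Finsupp.sum_single_index rfl]
    | zero => simp
    | add a b _ _ ha hb =>
      rw [map_add, AddMonoidAlgebra.coeff_add,
        Finsupp.sum_add_index' (fun _ => rfl) (fun _ _ _ => rfl), ha, hb]
  rw [← key a]
  exact Submodule.sum_mem _ fun d _ => h d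

/-- Multiplication by a normalized polynomial `P(x,z)` is injective on `Q/zQ`. -/
theorem Qu.z_regular {k : ℕ} (P : SemiInv ε k) {a v : Qu ε τ}
    (h : Qu.evalPoly ε τ P.poly * a = Qu.z ε τ * v) : ∃ a', a = Qu.z ε τ * a' := by
  have : a ∈ LinearMap.range (LinearMap.mulLeft ℂ (Qu.z ε τ)) := by
    refine Qu.mem_of_proj_mem _ _ fun d => ?_
    obtain ⟨a', ha'⟩ := Qu.exists_z_mul P (Qu.proj_mem d a)
      (Qu.proj_mem (d + ((k : ℤ), 0) - (1, 0)) v) (by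
        have := congrArg (Qu.proj ε τ (d + ((k : ℤ), 0))) h
        rwa [Qu.proj_mul (Qu.evalPoly_mem τ P), Qu.proj_mul (Qu.gen_mem ε τ .z),
          add_sub_cancel_right] at this)
    exact ⟨a', ha'.symm⟩
  obtain ⟨a', h'⟩ := this
  exact ⟨a', h'.symm⟩

/-- Multiplication by a normalized polynomial `P(x,z)` is injective on `Q/wQ`. -/
theorem Qu.w_regular {k : ℕ} (P : SemiInv ε k) {a v : Qu ε τ}
    (h : Qu.evalPoly ε τ P.poly * a = Qu.w ε τ * v) : ∃ a', a = Qu.w ε τ * a' := by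
  have : a ∈ LinearMap.range (LinearMap.mulLeft ℂ (Qu.w ε τ)) := by
    refine Qu.mem_of_proj_mem _ _ fun d => ?_
    obtain ⟨a', ha'⟩ := Qu.exists_w_mul P (Qu.proj_mem d a)
      (Qu.proj_mem (d + ((k : ℤ), 0) - (0, 1)) v) (by
        have := congrArg (Qu.proj ε τ (d + ((k : ℤ), 0))) h
        rwa [Qu.proj_mul (Qu.evalPoly_mem τ P), Qu.proj_mul (Qu.gen_mem ε τ .w),
          add_sub_cancel_right] at this)
    exact ⟨a', ha'.symm⟩
  obtain ⟨a', h'⟩ := this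
  exact ⟨a', h'.symm⟩

/-- In high degree, `Q = P(x,z) Q + z Q`. -/
theorem Qu.exists_eq_mul_add {k : ℕ} (P : SemiInv ε k) {d : ℤ × ℤ} (hd : (k : ℤ) ≤ d.1) {q : Qu ε τ}
    (hq : q ∈ Qu.grading ε τ d) : ∃ q₁ ∈ Qu.grading ε τ (d - ((k : ℤ), 0)), ∃ q₂,
      q = Qu.evalPoly ε τ P.poly * q₁ + Qu.z ε τ * q₂ := by
  obtain ⟨r, hr⟩ := P.evalPoly_eq_add (τ := τ)
  have hq' := Qu.grading_le_monSpan d hq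
  clear hq
  induction hq' using Submodule.span_induction with
  | mem q h =>
    obtain ⟨a, c, b, e, g, h1, h2, rfl⟩ := h
    rcases c with _ | c
    · have hx : ∀ i a, Qu.x ε τ ^ i * Qu.mon ε τ a 0 b e g = Qu.mon ε τ (a + i) 0 b e g := by
        intro i
        induction i with
        | zero => intro a; rw [pow_zero, one_mul, add_zero]
        | succ i ih => intro a; rw [pow_succ, mul_assoc, Qu.x_mul_mon, ih]; congr 1; ring
      -- Without a factor `z`, the exponent of `x` equals `d.1`, which is at least `k`; so `x^k` can
      -- be split off and replaced by `P - z r`.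
      have ha : a = (a - k) + k := by push_cast at h1; omega
      refine ⟨Qu.mon ε τ (a - k) 0 b e g, Qu.mon_mem_grading g ?_ ?_,
        -(r * Qu.mon ε τ (a - k) 0 b e g), ?_⟩
      · rw [Prod.fst_sub]; push_cast at h1 ⊢; omega
      · simpa using h2
      · rw [hr, add_mul, hx, ← ha, mul_neg, mul_assoc, add_neg_cancel_right]
    · exact ⟨0, zero_mem _, Qu.mon ε τ a c b e g, by rw [Qu.z_mul_mon, mul_zero, zero_add]⟩
  | zero => exact ⟨0, zero_mem _, 0, by simp⟩
  | add a b _ _ ha hb =>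
    obtain ⟨q, hq, q', rfl⟩ := ha
    obtain ⟨s, hs, s', rfl⟩ := hb
    exact ⟨q + s, add_mem hq hs, q' + s', by rw [mul_add, mul_add]; abel⟩
  | smul c a _ ha =>
    obtain ⟨q, hq, q', rfl⟩ := ha
    exact ⟨c • q, Submodule.smul_mem _ _ hq, c • q', by
      rw [mul_smul_comm, mul_smul_comm, smul_add]⟩

/-- The homogeneous components of `Q` are finite-dimensional. -/
theorem Qu.exists_finite_span [Finite G] (d : ℤ × ℤ) :
    ∃ s : Set (Qu ε τ), s.Finite ∧ s ⊆ Qu.grading ε τ d ∧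
      Qu.grading ε τ d ≤ Submodule.span ℂ s := by
  refine ⟨{q | ∃ (a c b e : ℕ) (g : G), (a + c : ℤ) = d.1 ∧ (b + e : ℤ) = d.2 ∧
    q = Qu.mon ε τ a c b e g}, ?_, ?_, Qu.grading_le_monSpan d⟩
  · refine ((Set.finite_univ (α := Fin (d.1.toNat + 1) × Fin (d.1.toNat + 1) × Fin (d.2.toNat + 1) ×
      Fin (d.2.toNat + 1) × G)).image fun i => Qu.mon ε τ i.1 i.2.1 i.2.2.1 i.2.2.2.1
        i.2.2.2.2).subset ?_
    rintro _ ⟨a, c, b, e, g, h1, h2, rfl⟩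
    exact ⟨⟨⟨a, by omega⟩, ⟨c, by omega⟩, ⟨b, by omega⟩, ⟨e, by omega⟩, g⟩, trivial, rfl⟩
  · rintro _ ⟨a, c, b, e, g, h1, h2, rfl⟩
    exact Qu.mon_mem_grading g h1 h2

theorem theta_surjective : Function.Surjective (theta ε τ) := by
  intro b
  obtain ⟨t, rfl⟩ := Bt.mk_surj b
  exact ⟨sect ε τ t, theta_sect ε τ t⟩

end Coordinates

end NCQuadric
end

noncomputable section

namespace NCQuadric

/-! ### Semiinvariant polynomials become invertible in `B_rat`. -/

section Units

open Polynomial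

variable {G : Type} [CommGroup G] {ε : G →* ℂˣ} {τ : MonoidAlgebra ℂ G}

theorem SemiInv.dehom_comp {n : ℕ} (P : SemiInv ε n) (g : G) :
    P.dehom.comp (C (ε g : ℂ) * X) = C ((ε g : ℂ) ^ n) * P.dehom := by
  have h := congrArg (MvPolynomial.aeval ![(X : ℂ[X]), 1]) (P.act g)
  rw [map_mul, MvPolynomial.aeval_C] at h
  rw [SemiInv.dehom, ← algebraMap_eq, ← h]
  have : (aeval (C (ε g : ℂ) * X)).comp (MvPolynomial.aeval ![(X : ℂ[X]), 1]) =
      (MvPolynomial.aeval ![(X : ℂ[X]), 1]).comp (polyAct ε g) := by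
    apply MvPolynomial.algHom_ext
    intro i
    fin_cases i
    · simp [polyAct]
    · simp [polyAct]
  have h2 := congrArg (fun f => f P.poly) this
  simpa [aeval_def, comp, eval₂_eq_eval_map] using h2

/-- The powers of a normalized semiinvariant polynomial. -/
def SemiInv.pow {n : ℕ} (P : SemiInv ε n) (k : ℕ) : SemiInv ε (k * n) where
  poly := P.poly ^ k
  homog := by rw [mul_comm]; exact P.homog.pow k
  semi := ⟨fun g => ((ε g : ℂ) ^ n) ^ k, fun g => by rw [map_pow, P.act, mul_pow, ← map_pow]⟩
  normalized := by rw [map_pow, P.normalized, one_pow]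

theorem pow_card_char [Finite G] (g : G) : ε g ^ Nat.card G = 1 := by
  rw [← map_pow, pow_card_eq_one', map_one]

/-- `P(x,1)` is scaled by `ε(g)^n`, so its `k`-th power is invariant as soon as the character
`ε^(kn)` is trivial. -/
theorem SemiInv.isInvPoly {n : ℕ} (P : SemiInv ε n) {k : ℕ} (h : ∀ g, ε g ^ (k * n) = 1) :
    IsInvPoly ε (P.dehom ^ k) := by
  refine ⟨pow_ne_zero _ P.dehom_monic.1.ne_zero, fun g => ?_⟩
  rw [pow_comp, P.dehom_comp, mul_pow, ← C_pow, ← pow_mul, mul_comm n k,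
    ← Units.val_pow_eq_pow_val, h g, Units.val_one, C_1, one_mul]

theorem IsInvPoly.isUnit {p : ℂ[X]} (hp : IsInvPoly ε p) :
    IsUnit (BRat.num ε τ (aeval (Bt.x ε τ) p)) :=
  OreLocalization.numerator_isUnit (⟨_, p, hp, rfl⟩ : invS ε τ)

/-- The localization inverts only invariant polynomials; the power with exponent `|G|` is one of
them, and a factor of a unit power is a unit. -/
theorem SemiInv.isUnit [Finite G] {n : ℕ} (P : SemiInv ε n) :
    IsUnit (BRat.num ε τ (Bt.evalPoly ε τ P.poly)) := by
  have h := (P.isInvPoly (k := Nat.card G) fun g => by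
    rw [pow_mul, pow_card_char, one_pow]).isUnit (τ := τ)
  rw [map_pow, map_pow, ← P.evalPoly_eq] at h
  exact (isUnit_pow_iff Nat.card_pos.ne').mp h

end Units

/-! ### Left multiplication on tensor products. -/

section Lmul

variable {G : Type} [CommGroup G] {W : Type u} [AddCommGroup W] [Module ℂ W]

theorem lmulAdd_tmul {A : Type} [Ring A] [Module (MonoidAlgebra ℂ G) A]
    (i : MonoidAlgebra ℂ G →+* A) (hi : ∀ r (q : A), r • q = i r * q) (a : A) (χ : G → ℂˣ)
    (H : ∀ g c, a * i (.single g c) = i (.single g (c * ((χ g)⁻¹ : ℂˣ))) * a)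
    (ρ ρ' : Representation ℂ G W) (hW : ∀ g w, ρ' g w = (χ g : ℂ) • ρ g w) (q : A)
    (w : ρ.asModule) : lmulAdd i hi a χ H ρ ρ' hW (q ⊗ₜ w) =
      (a * q) ⊗ₜ[MonoidAlgebra ℂ G] ρ'.asModuleEquiv.symm (ρ.asModuleEquiv w) := rfl

/-- The inverse is left multiplication by `a⁻¹`, which is semiinvariant for the inverse character.
-/
theorem lmulAdd_bijective {A : Type} [Ring A] [Module (MonoidAlgebra ℂ G) A]
    (i : MonoidAlgebra ℂ G →+* A) (hi : ∀ r (q : A), r • q = i r * q) (a : A) (ha : IsUnit a)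
    (χ : G → ℂˣ) (H : ∀ g c, a * i (.single g c) = i (.single g (c * ((χ g)⁻¹ : ℂˣ))) * a)
    (ρ ρ' : Representation ℂ G W) (hW : ∀ g w, ρ' g w = (χ g : ℂ) • ρ g w) :
    Function.Bijective (lmulAdd i hi a χ H ρ ρ' hW) := by
  obtain ⟨a, rfl⟩ := ha
  have H' : ∀ g c, ((a⁻¹ : Aˣ) : A) * i (.single g c) =
      i (.single g (c * (((χ g)⁻¹)⁻¹ : ℂˣ))) * ((a⁻¹ : Aˣ) : A) := fun g c => by
    rw [Units.inv_mul_eq_iff_eq_mul, ← mul_assoc, H, Units.eq_mul_inv_iff_mul_eq, mul_assoc c,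
      ← Units.val_mul, inv_inv, mul_inv_cancel, Units.val_one, mul_one]
  have hW' : ∀ g w, ρ g w = (((χ g)⁻¹ : ℂˣ) : ℂ) • ρ' g w := fun g w => by
    rw [hW, smul_smul, Units.inv_mul, one_smul]
  refine Function.bijective_iff_has_inverse.mpr
    ⟨lmulAdd i hi (a⁻¹ : Aˣ) (fun g => (χ g)⁻¹) H' ρ' ρ hW', fun t => ?_, fun t => ?_⟩
  · induction t using TensorProduct.induction_on with
    | zero => rw [map_zero, map_zero]
    | add s t hs ht => rw [map_add, map_add, hs, ht]
    | tmul q w => rw [lmulAdd_tmul, lmulAdd_tmul, Units.inv_mul_cancel_left]; simp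
  · induction t using TensorProduct.induction_on with
    | zero => rw [map_zero, map_zero]
    | add s t hs ht => rw [map_add, map_add, hs, ht]
    | tmul q w => rw [lmulAdd_tmul, lmulAdd_tmul, Units.mul_inv_cancel_left]; simp

variable {ε : G →* ℂˣ} {τ : MonoidAlgebra ℂ G}

theorem BRat.lmulPoly_bijective [Finite G] {n : ℕ} (P : SemiInv ε n) (ρ ρ' : Representation ℂ G W)
    (hW : ∀ g w, ρ' g w = ((ε g ^ n : ℂˣ) : ℂ) • ρ g w) :
    Function.Bijective (BRat.lmulPoly τ P ρ ρ' hW) :=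
  lmulAdd_bijective (BRat.ofCG ε τ) (fun _ _ => rfl) _ P.isUnit (fun g => ε g ^ n)
    (fun g c => by
      have := congrArg (BRat.num ε τ) (Bt.lmul_aux τ P g c)
      rwa [map_mul, map_mul] at this) ρ ρ' hW

theorem BRat.lmulPoly_comp {k l m : ℕ} (q : SemiInv ε k) (r : SemiInv ε l) (p : SemiInv ε m)
    (hp : p.poly = q.poly * r.poly) (ρ₁ ρ₂ ρ₃ : Representation ℂ G W)
    (h₁ : ∀ g w, ρ₂ g w = ((ε g ^ k : ℂˣ) : ℂ) • ρ₁ g w)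
    (h₂ : ∀ g w, ρ₃ g w = ((ε g ^ l : ℂˣ) : ℂ) • ρ₂ g w)
    (h₃ : ∀ g w, ρ₃ g w = ((ε g ^ m : ℂˣ) : ℂ) • ρ₁ g w)
    (u : BRat ε τ ⊗[MonoidAlgebra ℂ G] ρ₁.asModule) :
    BRat.lmulPoly τ r ρ₂ ρ₃ h₂ (BRat.lmulPoly τ q ρ₁ ρ₂ h₁ u) = BRat.lmulPoly τ p ρ₁ ρ₃ h₃ u := by
  induction u using TensorProduct.induction_on with
  | zero => rw [map_zero, map_zero, map_zero]
  | add a b ha hb => rw [map_add, map_add, ha, hb, map_add]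
  | tmul a w =>
    show (BRat.num ε τ (Bt.evalPoly ε τ r.poly) * (BRat.num ε τ (Bt.evalPoly ε τ q.poly) * a))
      ⊗ₜ[MonoidAlgebra ℂ G] _ = (BRat.num ε τ (Bt.evalPoly ε τ p.poly) * a) ⊗ₜ[MonoidAlgebra ℂ G] _
    rw [hp, mul_comm, map_mul, map_mul, mul_assoc]
    rfl

/-- Connects invariant denominators, in terms of which fatness is defined, with homogeneous
semiinvariants, in terms of which trivializations are defined. -/
theorem BRat.lmulInv_eq {l : ℕ} (p : SemiInv ε l) {f : Polynomial ℂ}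
    (hf : IsInvPoly ε f) (hp : f = p.dehom) (ρ : Representation ℂ G W)
    (h : ∀ g w, ρ g w = ((ε g ^ l : ℂˣ) : ℂ) • ρ g w)
    (u : BRat ε τ ⊗[MonoidAlgebra ℂ G] ρ.asModule) :
    BRat.lmulInv τ hf ρ u = BRat.lmulPoly τ p ρ ρ h u := by
  subst hp
  induction u using TensorProduct.induction_on with
  | zero => rw [map_zero, map_zero]
  | add s t hs ht => rw [map_add, map_add, hs, ht]
  | tmul q w =>
    show (BRat.num ε τ (Polynomial.aeval (Bt.x ε τ) p.dehom) * q) ⊗ₜ[MonoidAlgebra ℂ G] _ =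
      (BRat.num ε τ (Bt.evalPoly ε τ p.poly) * q) ⊗ₜ[MonoidAlgebra ℂ G] _
    rw [p.evalPoly_eq]

theorem toRat_lmulPoly {n : ℕ} (P : SemiInv ε n) (ρ ρ' : Representation ℂ G W)
    (hW : ∀ g w, ρ' g w = ((ε g ^ n : ℂˣ) : ℂ) • ρ g w) (t : Qu ε τ ⊗[MonoidAlgebra ℂ G] ρ.asModule) :
    toRat ε τ ρ' (Qu.lmulPoly τ P ρ ρ' hW t) = BRat.lmulPoly τ P ρ ρ' hW (toRat ε τ ρ t) := by
  induction t using TensorProduct.induction_on with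
  | zero => simp only [map_zero]
  | add s t hs ht => simp only [map_add, hs, ht]
  | tmul q w =>
    show toRat ε τ ρ' ((Qu.evalPoly ε τ P.poly * q) ⊗ₜ _) =
      (BRat.num ε τ (Bt.evalPoly ε τ P.poly) * BRat.num ε τ (theta ε τ q)) ⊗ₜ _
    rw [toRat_tmul, map_mul, map_mul, theta_evalPoly]
    rfl

theorem Qu.ofCG_mem (r : MonoidAlgebra ℂ G) : Qu.ofCG ε τ r ∈ Qu.grading ε τ 0 := by
  rw [Qu.ofCG, MonoidAlgebra.lift_apply]
  exact Submodule.sum_mem _ fun g _ => Submodule.smul_mem _ _ (Qu.gen_mem ε τ (.grp g))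

end Lmul

/-! ### Flatness over the group algebra. -/

section Flat

variable {G : Type} [CommGroup G] [Finite G] {ε : G →* ℂˣ} {τ : MonoidAlgebra ℂ G}
variable {W : Type u} [AddCommGroup W] [Module ℂ W]

/-- Maschke: the group algebra is semisimple, so all its modules are projective. Injectivity
statements about `Q` therefore pass to `W ⊗ Q`. -/
theorem flat_of_finite (V : Type u) [AddCommGroup V] [Module (MonoidAlgebra ℂ G) V] :
    Module.Flat (MonoidAlgebra ℂ G) V := by
  have := Fintype.ofFinite G
  have := Module.projective_of_isSemisimpleRing (MonoidAlgebra ℂ G) V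
  infer_instance

variable (ε τ) in
/-- `Q_d` as a submodule over the group algebra. -/
def Qu.gradingCG (d : ℤ × ℤ) : Submodule (MonoidAlgebra ℂ G) (Qu ε τ) where
  carrier := Qu.grading ε τ d
  zero_mem' := zero_mem _
  add_mem' := add_mem
  smul_mem' r q hq := by
    have := Qu.mul_mem ε τ (Qu.ofCG_mem r) hq
    rwa [zero_add] at this

variable (ε τ) in
/-- The map `Q → B_rat` over the group algebra. -/
def numTheta : Qu ε τ →ₗ[MonoidAlgebra ℂ G] BRat ε τ where
  toFun q := BRat.num ε τ (theta ε τ q)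
  map_add' a b := by rw [map_add, map_add]
  map_smul' r q := by
    have h : theta ε τ (Qu.ofCG ε τ r) = Bt.ofCG ε τ r := by
      induction r using MonoidAlgebra.induction_linear with
      | zero => simp
      | add a b ha hb => simp only [map_add, ha, hb]
      | single g c => simp [Qu.ofCG, Bt.ofCG, Qu.grp_apply, Bt.grp_apply, theta_gen]
    rw [Qu.cg_smul, map_mul, map_mul, h]
    rfl

/-- The map `W ⊗ Q → W ⊗ B_rat` is injective on homogeneous components. -/
theorem toRat_eq_zero {ρ : Representation ℂ G W} {d : ℤ × ℤ}
    {m : Qu ε τ ⊗[MonoidAlgebra ℂ G] ρ.asModule} (hm : m ∈ freeGr ε τ ρ d)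
    (h : toRat ε τ ρ m = 0) : m = 0 := by
  have hflat := flat_of_finite (G := G) ρ.asModule
  have hinj : Function.Injective ((numTheta ε τ).comp (Qu.gradingCG ε τ d).subtype) := by
    rw [injective_iff_map_eq_zero]
    rintro ⟨q, hq⟩ h
    exact Subtype.ext (Qu.num_theta_eq_zero hq h)
  have hinj' := Module.Flat.rTensor_preserves_injective_linearMap (M := ρ.asModule) _ hinj
  have hrange : ∃ m', LinearMap.rTensor ρ.asModule (Qu.gradingCG ε τ d).subtype m' = m := by
    clear h
    show m ∈ LinearMap.range (LinearMap.rTensor ρ.asModule (Qu.gradingCG ε τ d).subtype)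
    induction hm using AddSubgroup.closure_induction with
    | mem m hm =>
      obtain ⟨q, hq, w, rfl⟩ := hm
      exact ⟨(⟨q, hq⟩ : Qu.gradingCG ε τ d) ⊗ₜ w, rfl⟩
    | zero => exact zero_mem _
    | add a b _ _ ha hb => exact add_mem ha hb
    | neg a _ ha => exact neg_mem ha
  obtain ⟨m', rfl⟩ := hrange
  have : m' = 0 := by
    apply hinj'
    rw [LinearMap.rTensor_comp, LinearMap.comp_apply, map_zero]
    exact h
  rw [this, map_zero]

theorem toRat_injOn {ρ : Representation ℂ G W} {d : ℤ × ℤ}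
    {m m' : Qu ε τ ⊗[MonoidAlgebra ℂ G] ρ.asModule} (hm : m ∈ freeGr ε τ ρ d)
    (hm' : m' ∈ freeGr ε τ ρ d) (h : toRat ε τ ρ m = toRat ε τ ρ m') : m = m' :=
  sub_eq_zero.mp (toRat_eq_zero (sub_mem hm hm') (by rw [map_sub, h, sub_self]))

/-- If `P(x,z)` acts injectively on `Q/tQ` for a central element `t`, then so it does on
`W ⊗ (Q/tQ)`. -/
theorem lmulPoly_regular (t : Qu ε τ) (ht : ∀ q, Commute t q)
    (hreg : ∀ {k : ℕ} (P : SemiInv ε k) {a v : Qu ε τ},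
      Qu.evalPoly ε τ P.poly * a = t * v → ∃ a', a = t * a')
    {n : ℕ} (P : SemiInv ε n) (ρ ρ' : Representation ℂ G W)
    (hW : ∀ g w, ρ' g w = ((ε g ^ n : ℂˣ) : ℂ) • ρ g w)
    {u : Qu ε τ ⊗[MonoidAlgebra ℂ G] ρ.asModule} {v : Qu ε τ ⊗[MonoidAlgebra ℂ G] ρ'.asModule}
    (h : Qu.lmulPoly τ P ρ ρ' hW u = op t • v) : ∃ u', u = op t • u' := by
  have hflat := flat_of_finite (G := G) ρ.asModule
  -- Multiplication by `P` is only semilinear over the group algebra, so it does not induce a map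
  -- after tensoring with a fixed `W`. Its power `P^m` commutes with the group, and regularity of
  -- `P^m` implies that of `P`.
  set m := Nat.card G with hm
  have hm1 : m - 1 + 1 = m := Nat.sub_add_cancel Nat.card_pos
  have hε : ∀ g, ε g ^ (m * n) = 1 := fun g => by rw [pow_mul, pow_card_char, one_pow]
  let mulT : Qu ε τ →ₗ[MonoidAlgebra ℂ G] Qu ε τ :=
    { toFun := fun q => t * q
      map_add' := mul_add t
      map_smul' := fun r q => by
        rw [Qu.cg_smul, ← mul_assoc, (ht _).eq, mul_assoc, RingHom.id_apply, Qu.cg_smul] }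
  have hcomm : ∀ r, Commute (Qu.ofCG ε τ r) (Qu.evalPoly ε τ (P.pow m).poly) := fun r => by
    induction r using MonoidAlgebra.induction_linear with
    | zero => rw [map_zero]; exact Commute.zero_left _
    | add r t hr ht => rw [map_add]; exact hr.add_left ht
    | single g c =>
      rw [Qu.ofCG_single, Commute, SemiconjBy, smul_mul_assoc, Qu.grp_evalPoly,
        ← Units.val_pow_eq_pow_val, hε, Units.val_one, one_smul, mul_smul_comm]
  let mulP : Qu ε τ →ₗ[MonoidAlgebra ℂ G] Qu ε τ :=
    { toFun := fun q => Qu.evalPoly ε τ (P.pow m).poly * q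
      map_add' := mul_add _
      map_smul' := fun r q => by
        rw [Qu.cg_smul, ← mul_assoc, ← (hcomm r).eq, mul_assoc, RingHom.id_apply, Qu.cg_smul] }
  have hTle : LinearMap.range mulT ≤ (LinearMap.range mulT).comap mulP := by
    rintro _ ⟨q, rfl⟩
    refine ⟨mulP q, ?_⟩
    show t * (_ * q) = _ * (t * q)
    rw [← mul_assoc, (ht _).eq, mul_assoc]
  let qP := Submodule.mapQ _ _ mulP hTle
  have hqP : Function.Injective qP := by
    rw [injective_iff_map_eq_zero]
    intro a ha
    obtain ⟨a, rfl⟩ := Submodule.mkQ_surjective _ a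
    have ha' : Submodule.Quotient.mk (p := LinearMap.range mulT) (mulP a) = 0 := ha
    rw [Submodule.Quotient.mk_eq_zero] at ha'
    obtain ⟨v, hv⟩ := ha'
    obtain ⟨a', rfl⟩ := hreg (P.pow m) (a := a) (v := v) hv.symm
    exact (Submodule.Quotient.mk_eq_zero _).mpr ⟨a', rfl⟩
  have hqP' := Module.Flat.rTensor_preserves_injective_linearMap (M := ρ.asModule) _ hqP
  have hT : ∀ (σ : Representation ℂ G W) (s : Qu ε τ ⊗[MonoidAlgebra ℂ G] σ.asModule),
      op t • s = LinearMap.rTensor σ.asModule mulT s := fun σ s => by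
    induction s using TensorProduct.induction_on with
    | zero => rw [smul_zero, map_zero]
    | add s t hs ht => rw [smul_add, map_add, hs, ht]
    | tmul q w =>
      rw [smul_tmul', op_smul_eq_mul, LinearMap.rTensor_tmul, ← (ht q).eq]
      rfl
  have hW₂ : ∀ g w, ρ g w = ((ε g ^ ((m - 1) * n) : ℂˣ) : ℂ) • ρ' g w := fun g w => by
    rw [hW, smul_smul, ← Units.val_mul, ← pow_add]
    have : (m - 1) * n + n = m * n := by rw [← Nat.succ_mul, Nat.succ_eq_add_one, hm1]
    rw [this, hε, Units.val_one, one_smul]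
  have hW₃ : ∀ g w, ρ g w = ((ε g ^ (m * n) : ℂˣ) : ℂ) • ρ g w := fun g w => by
    rw [hε, Units.val_one, one_smul]
  -- Multiplying the given equation by `P^(m-1)` brings the target back from `ρ'` to `ρ`.
  have h1 : Qu.lmulPoly τ (P.pow m) ρ ρ hW₃ u =
      op t • Qu.lmulPoly τ (P.pow (m - 1)) ρ' ρ hW₂ v := by
    rw [← map_smul, ← h, ← LinearMap.comp_apply, lmulPoly_comp P (P.pow (m - 1)) (P.pow m)
      (by show P.poly ^ m = P.poly * P.poly ^ (m - 1); rw [← pow_succ', hm1]) _ _ _ hW hW₂ hW₃]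
  have h2 : Qu.lmulPoly τ (P.pow m) ρ ρ hW₃ u = LinearMap.rTensor ρ.asModule mulP u := by
    clear h h1
    induction u using TensorProduct.induction_on with
    | zero => rw [map_zero, map_zero]
    | add s t hs ht => rw [map_add, map_add, hs, ht]
    | tmul q w => rfl
  have hexact : Function.Exact mulT (LinearMap.range mulT).mkQ := fun q => by
    rw [Submodule.mkQ_apply, Submodule.Quotient.mk_eq_zero]
    exact Iff.rfl
  have hex := rTensor_exact ρ.asModule hexact (Submodule.mkQ_surjective _)
  have h3 : LinearMap.rTensor ρ.asModule (LinearMap.range mulT).mkQ u = 0 := by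
    apply hqP'
    rw [map_zero, ← LinearMap.comp_apply, ← LinearMap.rTensor_comp]
    have : qP ∘ₗ (LinearMap.range mulT).mkQ = (LinearMap.range mulT).mkQ ∘ₗ mulP := rfl
    rw [this, LinearMap.rTensor_comp, LinearMap.comp_apply, ← h2, h1, hT]
    exact (hex _).mpr ⟨_, rfl⟩
  obtain ⟨u', hu'⟩ := (hex u).mp h3
  exact ⟨u', by rw [hT, hu']⟩

theorem lmulPoly_z_regular {n : ℕ} (P : SemiInv ε n) (ρ ρ' : Representation ℂ G W)
    (hW : ∀ g w, ρ' g w = ((ε g ^ n : ℂˣ) : ℂ) • ρ g w)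
    {u : Qu ε τ ⊗[MonoidAlgebra ℂ G] ρ.asModule} {v : Qu ε τ ⊗[MonoidAlgebra ℂ G] ρ'.asModule}
    (h : Qu.lmulPoly τ P ρ ρ' hW u = op (Qu.z ε τ) • v) : ∃ u', u = op (Qu.z ε τ) • u' :=
  lmulPoly_regular _ (Qu.z_comm ε τ) (fun P _ _ h => Qu.z_regular P h) P ρ ρ' hW h

theorem lmulPoly_w_regular {n : ℕ} (P : SemiInv ε n) (ρ ρ' : Representation ℂ G W)
    (hW : ∀ g w, ρ' g w = ((ε g ^ n : ℂˣ) : ℂ) • ρ g w)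
    {u : Qu ε τ ⊗[MonoidAlgebra ℂ G] ρ.asModule} {v : Qu ε τ ⊗[MonoidAlgebra ℂ G] ρ'.asModule}
    (h : Qu.lmulPoly τ P ρ ρ' hW u = op (Qu.w ε τ) • v) : ∃ u', u = op (Qu.w ε τ) • u' :=
  lmulPoly_regular _ (Qu.w_comm ε τ) (fun P _ _ h => Qu.w_regular P h) P ρ ρ' hW h

end Flat

/-! ### The lattice `W ⊗ B` and homogeneous representatives. -/

section FreeModules

variable {G : Type} [CommGroup G] {ε : G →* ℂˣ} {τ : MonoidAlgebra ℂ G}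
variable {W : Type u} [AddCommGroup W] [Module ℂ W]

theorem freeGr_exists_eq {k : ℕ} (P : SemiInv ε k) (ρ ρ' : Representation ℂ G W)
    (hW : ∀ g w, ρ' g w = ((ε g ^ k : ℂˣ) : ℂ) • ρ g w) {d : ℤ × ℤ} (hd : (k : ℤ) ≤ d.1)
    {u : Qu ε τ ⊗[MonoidAlgebra ℂ G] ρ'.asModule} (hu : u ∈ freeGr ε τ ρ' d) :
    ∃ u₁ ∈ freeGr ε τ ρ (d - ((k : ℤ), 0)), ∃ u₂,
      u = Qu.lmulPoly τ P ρ ρ' hW u₁ + op (Qu.z ε τ) • u₂ := by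
  induction hu using AddSubgroup.closure_induction with
  | mem u hu =>
    obtain ⟨q, hq, w, rfl⟩ := hu
    obtain ⟨q₁, hq₁, q₂, rfl⟩ := Qu.exists_eq_mul_add P hd hq
    refine ⟨q₁ ⊗ₜ ρ.asModuleEquiv.symm (ρ'.asModuleEquiv w), AddSubgroup.subset_closure
      ⟨q₁, hq₁, _, rfl⟩, q₂ ⊗ₜ w, ?_⟩
    have h1 : Qu.lmulPoly τ P ρ ρ' hW (q₁ ⊗ₜ ρ.asModuleEquiv.symm (ρ'.asModuleEquiv w)) =
        (Qu.evalPoly ε τ P.poly * q₁) ⊗ₜ[MonoidAlgebra ℂ G] w := by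
      show (Qu.evalPoly ε τ P.poly * q₁) ⊗ₜ[MonoidAlgebra ℂ G]
        ρ'.asModuleEquiv.symm (ρ.asModuleEquiv (ρ.asModuleEquiv.symm (ρ'.asModuleEquiv w))) = _
      simp
    rw [h1, smul_tmul', op_smul_eq_mul, ← (Qu.z_comm ε τ q₂).eq, add_tmul]
  | zero => exact ⟨0, zero_mem _, 0, by simp⟩
  | add a b _ _ ha hb =>
    obtain ⟨a, ha, a', rfl⟩ := ha
    obtain ⟨b, hb, b', rfl⟩ := hb
    exact ⟨a + b, add_mem ha hb, a' + b', by rw [map_add, smul_add]; abel⟩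
  | neg a _ ha =>
    obtain ⟨a, ha, a', rfl⟩ := ha
    exact ⟨-a, neg_mem ha, -a', by rw [map_neg, smul_neg, neg_add]⟩

theorem toRat_mem_lattice (ρ : Representation ℂ G W)
    (m : Qu ε τ ⊗[MonoidAlgebra ℂ G] ρ.asModule) : toRat ε τ ρ m ∈ lattice ε τ ρ := by
  induction m using TensorProduct.induction_on with
  | zero => rw [map_zero]; exact zero_mem _
  | add a b ha hb => rw [map_add]; exact add_mem ha hb
  | tmul q w =>
    have : toRat ε τ ρ (q ⊗ₜ w) = op (theta ε τ q) • ((1 : BRat ε τ) ⊗ₜ[MonoidAlgebra ℂ G] w) := by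
      rw [toRat_tmul, smul_tmul', BRat.op_smul, one_mul]
    rw [this]
    exact Submodule.smul_mem _ _ (Submodule.subset_span ⟨w, rfl⟩)

/-- With `toRat_mem_lattice` this identifies the lattice as the image of `W ⊗ Q`. -/
theorem exists_toRat_eq {ρ : Representation ℂ G W} {v : BRat ε τ ⊗[MonoidAlgebra ℂ G] ρ.asModule}
    (hv : v ∈ lattice ε τ ρ) : ∃ m, toRat ε τ ρ m = v := by
  induction hv using Submodule.span_induction with
  | mem v hv =>
    obtain ⟨w, rfl⟩ := hv
    exact ⟨1 ⊗ₜ w, by rw [toRat_tmul, map_one, map_one]⟩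
  | zero => exact ⟨0, map_zero _⟩
  | add a b _ _ ha hb =>
    obtain ⟨a, rfl⟩ := ha
    obtain ⟨b, rfl⟩ := hb
    exact ⟨a + b, map_add _ _ _⟩
  | smul b v _ hv =>
    obtain ⟨m, rfl⟩ := hv
    obtain ⟨q, hq⟩ := theta_surjective (unop b)
    exact ⟨op q • m, by rw [toRat_smul, hq, op_unop]⟩

theorem lmulPoly_mem_lattice {n : ℕ} (P : SemiInv ε n) (ρ ρ' : Representation ℂ G W)
    (hW : ∀ g w, ρ' g w = ((ε g ^ n : ℂˣ) : ℂ) • ρ g w)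
    {v : BRat ε τ ⊗[MonoidAlgebra ℂ G] ρ.asModule} (hv : v ∈ lattice ε τ ρ) :
    BRat.lmulPoly τ P ρ ρ' hW v ∈ lattice ε τ ρ' := by
  obtain ⟨m, rfl⟩ := exists_toRat_eq hv
  rw [← toRat_lmulPoly]
  exact toRat_mem_lattice _ _

variable [FiniteDimensional ℂ W]

/-- Elements of a graded module over `W ⊗ Q` may be replaced by homogeneous ones of any high
bidegree without changing their image in `W ⊗ B_rat`. -/
theorem exists_homogeneous_toRat {M : GrMod.{u} ε τ} {ρ : Representation ℂ G W} {s : ℤ × ℤ}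
    (f : M ⟶ freeMod ε τ ρ s) (m : M.carrier) : ∃ k : ℤ, ∀ d : ℤ × ℤ, k ≤ d.1 → k ≤ d.2 →
      ∃ m' ∈ M.gr d, toRat ε τ ρ (f.lin m') = toRat ε τ ρ (f.lin m) := by
  induction m using M.gr_induction with
  | h0 => exact ⟨0, fun d _ _ => ⟨0, zero_mem _, rfl⟩⟩
  | hg e m hm =>
    have hp : ∀ (t : QGen G) (k : ℕ), Qu.gen ε τ t ^ k ∈ Qu.grading ε τ (k • t.deg) := by
      intro t k
      have := Qu.word_mem ε τ (List.replicate k t)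
      simpa using this
    -- A factor `z^i w^j` shifts the bidegree to `d` and is invisible after `z = w = 1`.
    refine ⟨max e.1 e.2, fun d h1 h2 =>
      ⟨op (Qu.z ε τ ^ (d.1 - e.1).toNat * Qu.w ε τ ^ (d.2 - e.2).toNat) • m, ?_, ?_⟩⟩
    · have := M.smul_mem (Qu.mul_mem ε τ (hp .z (d.1 - e.1).toNat)
        (hp .w (d.2 - e.2).toNat)) hm
      have hd : e + ((d.1 - e.1).toNat • (QGen.z : QGen G).deg +
          (d.2 - e.2).toNat • (QGen.w : QGen G).deg) = d := by
        ext
        · simp [QGen.deg]; omega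
        · simp [QGen.deg]; omega
      rwa [hd] at this
    · rw [map_smul, toRat_smul, map_mul, map_pow, map_pow, theta_gen, theta_gen]
      simp
  | ha a b ha hb =>
    obtain ⟨k, hk⟩ := ha
    obtain ⟨l, hl⟩ := hb
    refine ⟨max k l, fun d h1 h2 => ?_⟩
    obtain ⟨q, hq, e⟩ := hk d (by omega) (by omega)
    obtain ⟨r, hr, e'⟩ := hl d (by omega) (by omega)
    exact ⟨q + r, add_mem hq hr, by rw [map_add, map_add, e, e', map_add, map_add]⟩

end FreeModules

end NCQuadric
end

noncomputable section

namespace NCQuadric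

/-! ### Tails and graded submodules. -/

section GradedSubmodules

open Filter

variable {G : Type} [CommGroup G] {ε : G →* ℂˣ} {τ : MonoidAlgebra ℂ G}

/-- "For all large bidegrees" is the filter `atTop` on `ℤ × ℤ`; statements modulo torsion can then
be combined with `filter_upwards`. -/
theorem eventually_bidegree {p : ℤ × ℤ → Prop} :
    (∀ᶠ d in atTop, p d) ↔ ∃ c : ℤ, ∀ d : ℤ × ℤ, c < d.1 → c < d.2 → p d := by
  rw [eventually_atTop]
  constructor
  · rintro ⟨a, ha⟩
    exact ⟨max a.1 a.2, fun d h1 h2 => ha d ⟨by omega, by omega⟩⟩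
  · rintro ⟨c, hc⟩
    exact ⟨(c + 1, c + 1), fun d hd => hc d (by have := hd.1; simp at this; omega)
      (by have := hd.2; simp at this; omega)⟩

theorem eventually_add {p : ℤ × ℤ → Prop} (e : ℤ × ℤ) (h : ∀ᶠ d in atTop, p d) :
    ∀ᶠ d in atTop, p (d + e) :=
  (tendsto_atTop_add_const_right _ e tendsto_id).eventually h

theorem eventually_sub {p : ℤ × ℤ → Prop} (e : ℤ × ℤ) (h : ∀ᶠ d in atTop, p d) :
    ∀ᶠ d in atTop, p (d - e) := by
  simpa only [sub_eq_add_neg] using eventually_add (-e) h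

theorem torIso_iff {M N : GrMod.{u} ε τ} {f : M ⟶ N} : torIso f ↔
    (∀ᶠ d in atTop, ∀ m ∈ M.gr d, f.lin m = 0 → m = 0) ∧
      ∀ᶠ d in atTop, ∀ n ∈ N.gr d, n ∈ LinearMap.range f.lin := by
  rw [eventually_bidegree, eventually_bidegree]
  constructor
  · rintro ⟨⟨a, ha⟩, ⟨b, hb⟩⟩
    exact ⟨⟨max a.1 a.2, fun d h1 h2 => ha d (by omega) (by omega)⟩,
      ⟨max b.1 b.2, fun d h1 h2 => hb d (by omega) (by omega)⟩⟩
  · rintro ⟨⟨a, ha⟩, ⟨b, hb⟩⟩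
    exact ⟨⟨(a, a), ha⟩, ⟨(b, b), hb⟩⟩

theorem GrMod.lin_proj {M N : GrMod.{u} ε τ} (f : M ⟶ N) (d : ℤ × ℤ) (m : M.carrier) :
    f.lin (M.proj d m) = N.proj d (f.lin m) := by
  induction m using M.gr_induction with
  | h0 => simp
  | hg c m hm =>
    rw [M.proj_of_mem_gen _ _ hm, N.proj_of_mem_gen _ _ (f.map_gr hm)]
    split_ifs
    · rfl
    · simp
  | ha m n h h' => simp [h, h']

theorem GrMod.exists_sum_proj (M : GrMod.{u} ε τ) (m : M.carrier) :
    ∃ s : Finset (ℤ × ℤ), ∀ t, s ⊆ t → ∑ d ∈ t, M.proj d m = m := by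
  classical
  induction m using M.gr_induction with
  | h0 => exact ⟨∅, fun t _ => by simp⟩
  | hg e m hm =>
    refine ⟨{e}, fun t ht => ?_⟩
    rw [Finset.sum_eq_single_of_mem e (ht (Finset.mem_singleton_self e)) fun d _ hd => by
      rw [M.proj_of_mem_gen _ _ hm, if_neg hd.symm], M.proj_of_mem_gen _ _ hm, if_pos rfl]
  | ha m n h h' =>
    obtain ⟨s, hs⟩ := h
    obtain ⟨s', hs'⟩ := h'
    refine ⟨s ∪ s', fun t ht => ?_⟩
    simp only [map_add, Finset.sum_add_distrib]
    rw [hs t (Finset.union_subset_left ht), hs' t (Finset.union_subset_right ht)]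

theorem GrMod.eq_zero_of_proj (M : GrMod.{u} ε τ) {m : M.carrier} (h : ∀ d, M.proj d m = 0) :
    m = 0 := by
  obtain ⟨s, hs⟩ := M.exists_sum_proj m
  rw [← hs s (Finset.Subset.refl s)]
  exact Finset.sum_eq_zero fun d _ => h d

/-- The zero morphism. -/
def GrMod.zeroHom (M N : GrMod.{u} ε τ) : M ⟶ N := ⟨0, fun _ => zero_mem _⟩

theorem GrMod.tail_proj (M : GrMod.{u} ε τ) (c : ℤ) {m : M.carrier} (hm : m ∈ M.tail c)
    (d : ℤ × ℤ) : M.proj d m ∈ M.tail c := by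
  induction hm using AddSubgroup.closure_induction with
  | mem m hm =>
    obtain ⟨e, hm⟩ := Set.mem_iUnion.mp hm
    rw [M.proj_of_mem_gen _ _ hm]
    split_ifs
    · exact AddSubgroup.subset_closure (Set.mem_iUnion.mpr ⟨e, hm⟩)
    · exact zero_mem _
  | zero => rw [map_zero]; exact zero_mem _
  | add a b _ _ h h' => rw [map_add]; exact add_mem h h'
  | neg a _ h => rw [map_neg]; exact neg_mem h

theorem GrMod.tail_proj_eq_zero (M : GrMod.{u} ε τ) (c : ℤ) {m : M.carrier} (hm : m ∈ M.tail c)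
    {d : ℤ × ℤ} (hd : ¬ (c < d.1 ∧ c < d.2)) : M.proj d m = 0 := by
  induction hm using AddSubgroup.closure_induction with
  | mem m hm =>
    obtain ⟨⟨e, he⟩, hm⟩ := Set.mem_iUnion.mp hm
    rw [M.proj_of_mem_gen _ _ hm, if_neg]
    rintro rfl
    exact hd he
  | zero => rw [map_zero]
  | add a b _ _ h h' => rw [map_add, h, h', add_zero]
  | neg a _ h => rw [map_neg, h, neg_zero]

theorem GrMod.mem_tail (M : GrMod.{u} ε τ) {c : ℤ} {d : ℤ × ℤ} (h1 : c < d.1) (h2 : c < d.2)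
    {m : M.carrier} (hm : m ∈ M.gr d) : m ∈ M.tail c :=
  AddSubgroup.subset_closure (Set.mem_iUnion.mpr ⟨⟨d, h1, h2⟩, hm⟩)

/-- The tail of a bigraded module as a submodule. -/
def GrMod.tailSub (M : GrMod.{u} ε τ) (c : ℤ) : Submodule (Qu ε τ)ᵐᵒᵖ M.carrier where
  carrier := M.tail c
  zero_mem' := zero_mem _
  add_mem' := add_mem
  smul_mem' q m hm := by
    obtain ⟨q, rfl⟩ := op_surjective q
    show op q • m ∈ M.tail c
    replace hm : m ∈ M.tail c := hm
    induction q using Qu.gen_induction generalizing m with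
    | hs r =>
      refine M.tail_mul c hm (e := 0) ?_ le_rfl le_rfl
      rw [Algebra.algebraMap_eq_smul_one]
      exact Submodule.smul_mem _ _ (Qu.one_mem ε τ)
    | hg t =>
      exact M.tail_mul c hm (Qu.gen_mem ε τ t) (by cases t <;> simp [QGen.deg])
        (by cases t <;> simp [QGen.deg])
    | hm a b ha hb => rw [op_mul, mul_smul]; exact hb _ (ha _ hm)
    | ha a b ha hb => rw [MulOpposite.op_add, add_smul]; exact add_mem (ha _ hm) (hb _ hm)

theorem tail_injective {M N : GrMod.{u} ε τ} {f : M ⟶ N} {c : ℤ}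
    (h : ∀ d : ℤ × ℤ, c < d.1 → c < d.2 → ∀ m ∈ M.gr d, f.lin m = 0 → m = 0)
    {m : M.carrier} (hm : m ∈ M.tail c) (h0 : f.lin m = 0) : m = 0 := by
  refine M.eq_zero_of_proj fun d => ?_
  by_cases hd : c < d.1 ∧ c < d.2
  · exact h d hd.1 hd.2 _ (M.proj_mem d m) (by rw [GrMod.lin_proj, h0, map_zero])
  · exact M.tail_proj_eq_zero c hm hd

variable [Finite G]

/-- A graded submodule as a bigraded module. -/
abbrev GrMod.sub (M : GrMod.{u} ε τ) (S : Submodule (Qu ε τ)ᵐᵒᵖ M.carrier)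
    (hS : ∀ d, ∀ m ∈ S, M.proj d m ∈ S) : GrMod.{u} ε τ where
  carrier := S
  gr d := (M.gr d).comap S.subtype.toAddMonoidHom
  isInternal := by
    refine isInternal_of_proj _ (fun d => AddMonoidHom.mk' (fun m : S => ⟨M.proj d m, hS d m m.2⟩)
      fun a b => Subtype.ext (map_add (M.proj d) _ _)) ?_ ?_ ?_
    · rintro d m hm
      refine Subtype.ext ?_
      replace hm : (m : M.carrier) ∈ M.gr d := hm
      show M.proj d (m : M.carrier) = m
      rw [M.proj_of_mem_gen _ _ hm, if_pos rfl]
    · rintro d e hde m hm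
      refine Subtype.ext ?_
      replace hm : (m : M.carrier) ∈ M.gr e := hm
      show M.proj d (m : M.carrier) = 0
      rw [M.proj_of_mem_gen _ _ hm, if_neg hde]
    · intro m
      obtain ⟨s, hs⟩ := M.exists_sum_proj m
      have h : m = ∑ d ∈ s, ⟨M.proj d m, hS d m m.2⟩ := by
        refine Subtype.ext ?_
        rw [AddSubmonoidClass.coe_finsetSum, hs s (Finset.Subset.refl s)]
      rw [h]
      exact sum_mem fun d _ => AddSubgroup.subset_closure
        (Set.mem_iUnion.mpr ⟨d, M.proj_mem d m⟩)
  smul_mem := fun hq hm => M.smul_mem hq hm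
  finite := by
    have := M.finite
    -- Noetherianity of `Q` is what keeps graded submodules, in particular kernels and tails, inside
    -- the category of finitely generated modules.
    have := isNoetherian_of_isNoetherianRing_of_finite (Qu ε τ)ᵐᵒᵖ M.carrier
    infer_instance

/-- The inclusion of a graded submodule. -/
def GrMod.subIncl (M : GrMod.{u} ε τ) (S : Submodule (Qu ε τ)ᵐᵒᵖ M.carrier)
    (hS : ∀ d, ∀ m ∈ S, M.proj d m ∈ S) : M.sub S hS ⟶ M := ⟨S.subtype, fun h => h⟩

/-- The tail of a bigraded module. -/
abbrev GrMod.tailObj (M : GrMod.{u} ε τ) (c : ℤ) : GrMod.{u} ε τ :=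
  M.sub (M.tailSub c) fun d _ hm => M.tail_proj c hm d

/-- The inclusion of the tail. -/
abbrev GrMod.tailIncl (M : GrMod.{u} ε τ) (c : ℤ) : M.tailObj c ⟶ M := M.subIncl _ _

theorem GrMod.tailIncl_torIso (M : GrMod.{u} ε τ) (c : ℤ) : torIso (M.tailIncl c) :=
  ⟨⟨0, fun _ _ _ _ _ h => Subtype.ext h⟩,
    ⟨(c, c), fun _ h1 h2 n hn => ⟨⟨n, M.mem_tail h1 h2 hn⟩, rfl⟩⟩⟩

/-- A morphism factors, on a tail, over a morphism which is injective in large bidegrees and whose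
image is larger in large bidegrees. -/
theorem exists_tail_lift {M M' F : GrMod.{u} ε τ} (f : M ⟶ F) (f' : M' ⟶ F)
    (hinj : ∀ᶠ d in atTop, ∀ m ∈ M'.gr d, f'.lin m = 0 → m = 0)
    (hle : ∀ᶠ d in atTop, ∀ m ∈ M.gr d, ∃ m' ∈ M'.gr d, f'.lin m' = f.lin m) :
    ∃ (c : ℤ) (h : M.tailObj c ⟶ M'), h ≫ f' = M.tailIncl c ≫ f := by
  obtain ⟨c, hc⟩ := eventually_bidegree.mp (hinj.and hle)
  have hinj' : ∀ m ∈ M'.tail c, f'.lin m = 0 → m = 0 := fun m hm =>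
    tail_injective (fun d h1 h2 => (hc d h1 h2).1) hm
  have hle' : ∀ m ∈ M.tail c, ∃ m' ∈ M'.tail c, f'.lin m' = f.lin m := by
    intro m hm
    induction hm using AddSubgroup.closure_induction with
    | mem m hm =>
      obtain ⟨⟨e, he⟩, hm⟩ := Set.mem_iUnion.mp hm
      obtain ⟨m', hm', h⟩ := (hc e he.1 he.2).2 m hm
      exact ⟨m', M'.mem_tail he.1 he.2 hm', h⟩
    | zero => exact ⟨0, zero_mem _, by rw [map_zero, map_zero]⟩
    | add a b _ _ h h' =>
      obtain ⟨m, hm, e⟩ := h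
      obtain ⟨m', hm', e'⟩ := h'
      exact ⟨m + m', add_mem hm hm', by rw [map_add, map_add, e, e']⟩
    | neg a _ h =>
      obtain ⟨m, hm, e⟩ := h
      exact ⟨-m, neg_mem hm, by rw [map_neg, map_neg, e]⟩
  let φ := f'.lin.domRestrict (M'.tailSub c)
  have hφ : Function.Injective φ := by
    rw [injective_iff_map_eq_zero]
    exact fun m hm => Subtype.ext (hinj' m m.2 hm)
  -- The lift is `f` followed by the inverse of `f'` on the image of the tail of `M'`.
  let h : M.tailSub c →ₗ[(Qu ε τ)ᵐᵒᵖ] M'.carrier := (M'.tailSub c).subtype ∘ₗ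
    (LinearEquiv.ofInjective φ hφ).symm.toLinearMap ∘ₗ
    LinearMap.codRestrict (LinearMap.range φ) (f.lin ∘ₗ (M.tailSub c).subtype) fun m => by
      obtain ⟨m', hm', e⟩ := hle' m m.2
      exact ⟨⟨m', hm'⟩, e⟩
  have hh : ∀ m, f'.lin (h m) = f.lin m := fun m =>
    congrArg Subtype.val ((LinearEquiv.ofInjective φ hφ).apply_symm_apply _)
  have hmem : ∀ m, h m ∈ M'.tail c := fun m => Subtype.property _
  refine ⟨c, ⟨h, fun {d m} hm => ?_⟩, GrMod.hom_ext (LinearMap.ext hh)⟩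
  -- The lift preserves bidegrees because its value and the `d`-component of its value have the same
  -- image under the injective restriction of `f'`.
  have h1 : f'.lin (M'.proj d (h m) - h m) = 0 := by
    have hm' : f.lin m ∈ F.gr d := f.map_gr hm
    rw [map_sub, GrMod.lin_proj, hh, F.proj_of_mem_gen _ _ hm', if_pos rfl, sub_self]
  have h2 := hinj' _ (sub_mem (M'.tail_proj c (hmem m) d) (hmem m)) h1
  rw [← sub_eq_zero.mp h2]
  exact M'.proj_mem d _

end GradedSubmodules

/-! ### Calculus of right fractions in the quotient categories. -/

section Fractions

open Filter

variable {G : Type} [CommGroup G] {ε : G →* ℂˣ} {τ : MonoidAlgebra ℂ G}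

instance : (torIso (ε := ε) (τ := τ) : MorphismProperty (GrMod.{u} ε τ)).IsMultiplicative where
  id_mem M := torIso_iff.mpr ⟨.of_forall fun _ _ _ h => h, .of_forall fun _ n _ => ⟨n, rfl⟩⟩
  comp_mem f g hf hg := by
    rw [torIso_iff] at hf hg ⊢
    constructor
    · filter_upwards [hf.1, hg.1] with d h1 h2 m hm h
      exact h1 m hm (h2 _ (f.map_gr hm) h)
    · filter_upwards [hf.2, hg.2] with d h1 h2 n hn
      obtain ⟨m, hm, rfl⟩ := torIso.surj_deg g hn (h2 n hn)
      obtain ⟨m, rfl⟩ := h1 m hm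
      exact ⟨m, rfl⟩

theorem torIso_of_isIso {M N : GrMod.{u} ε τ} (f : M ⟶ N) [IsIso f] : torIso f := by
  have h1 : ∀ m, (inv f).lin (f.lin m) = m := fun m =>
    congrArg (fun g : M ⟶ M => g.lin m) (IsIso.hom_inv_id f)
  have h2 : ∀ n, f.lin ((inv f).lin n) = n := fun n =>
    congrArg (fun g : N ⟶ N => g.lin n) (IsIso.inv_hom_id f)
  exact torIso_iff.mpr ⟨.of_forall fun _ m _ h => by rw [← h1 m, h, map_zero],
    .of_forall fun _ n _ => ⟨_, h2 n⟩⟩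

variable [Finite G]
variable {D : Type (u + 1)} [Category.{u} D] (U : D ⥤ GrMod.{u} ε τ)

/-- A category over bigraded modules contains all graded submodules of its objects. -/
def SubClosed : Prop := ∀ (X : D) (S : Submodule (Qu ε τ)ᵐᵒᵖ (U.obj X).carrier)
  (hS : ∀ d, ∀ m ∈ S, (U.obj X).proj d m ∈ S), ∃ Y : D, Nonempty (U.obj Y ≅ (U.obj X).sub S hS)

variable {U}

theorem SubClosed.exists_sub [U.Full] (hU : SubClosed U) (X : D)
    (S : Submodule (Qu ε τ)ᵐᵒᵖ (U.obj X).carrier) (hS : ∀ d, ∀ m ∈ S, (U.obj X).proj d m ∈ S) :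
    ∃ (Y : D) (i : Y ⟶ X) (e : U.obj Y ≅ (U.obj X).sub S hS),
      U.map i = e.hom ≫ (U.obj X).subIncl S hS := by
  obtain ⟨Y, ⟨e⟩⟩ := hU X S hS
  exact ⟨Y, U.preimage (e.hom ≫ (U.obj X).subIncl S hS), e, U.map_preimage _⟩

theorem SubClosed.exists_tail [U.Full] (hU : SubClosed U) (X : D) (c : ℤ) :
    ∃ (Y : D) (i : Y ⟶ X) (e : U.obj Y ≅ (U.obj X).tailObj c),
      U.map i = e.hom ≫ (U.obj X).tailIncl c ∧ torIso.inverseImage U i := by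
  obtain ⟨Y, i, e, h⟩ := hU.exists_sub X ((U.obj X).tailSub c)
    fun d _ hm => (U.obj X).tail_proj c hm d
  refine ⟨Y, i, e, h, ?_⟩
  rw [MorphismProperty.inverseImage_iff, h]
  exact torIso.comp_mem _ _ (torIso_of_isIso _) ((U.obj X).tailIncl_torIso c)

/-- The inclusion of a tail is an isomorphism modulo torsion, so agreement in large bidegrees
becomes equality after precomposing with an inverted morphism. -/
theorem exists_tail_eq {M N : GrMod.{u} ε τ} {f g : M ⟶ N}
    (h : ∀ᶠ d in atTop, ∀ m ∈ M.gr d, f.lin m = g.lin m) :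
    ∃ c, M.tailIncl c ≫ f = M.tailIncl c ≫ g := by
  obtain ⟨c, hc⟩ := eventually_bidegree.mp h
  refine ⟨c, GrMod.hom_ext (LinearMap.ext fun m => ?_)⟩
  obtain ⟨m, hm⟩ := m
  show f.lin m = g.lin m
  replace hm : m ∈ M.tail c := hm
  induction hm using AddSubgroup.closure_induction with
  | mem m hm =>
    obtain ⟨⟨e, he⟩, hm⟩ := Set.mem_iUnion.mp hm
    exact hc e he.1 he.2 m hm
  | zero => rw [map_zero, map_zero]
  | add a b _ _ h h' => rw [map_add, map_add, h, h']
  | neg a _ h => rw [map_neg, map_neg, h]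

/-- The quadric and the two lines are treated simultaneously: `U` is either the identity or the
inclusion of the modules killed by `g`. -/
theorem SubClosed.exists_comp_eq [U.Full] [U.Faithful] (hU : SubClosed U) {X Y : D} {f g : X ⟶ Y}
    (h : ∀ᶠ d in atTop, ∀ m ∈ (U.obj X).gr d, (U.map f).lin m = (U.map g).lin m) :
    ∃ (X' : D) (t : X' ⟶ X) (_ : torIso.inverseImage U t), t ≫ f = t ≫ g := by
  obtain ⟨c, hc⟩ := exists_tail_eq h
  obtain ⟨X', i, e, hi, hi'⟩ := hU.exists_tail X c
  refine ⟨X', i, hi', U.map_injective ?_⟩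
  rw [U.map_comp, U.map_comp, hi, Category.assoc, Category.assoc, hc]

/-- Morphisms with torsion kernel and cokernel admit a calculus of right fractions. -/
theorem SubClosed.hasRightCalculusOfFractions [U.Full] [U.Faithful] (hU : SubClosed U) :
    (torIso.inverseImage U).HasRightCalculusOfFractions where
  exists_rightFraction X Y φ := by
    have hs : torIso (U.map φ.s) := φ.hs
    rw [torIso_iff] at hs
    obtain ⟨c, h, hh⟩ := exists_tail_lift (U.map φ.f) (U.map φ.s) hs.1 (by
      filter_upwards [hs.2] with d hd m hm
      exact torIso.surj_deg _ ((U.map φ.f).map_gr hm) (hd _ ((U.map φ.f).map_gr hm)))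
    obtain ⟨X', i, e, hi, hi'⟩ := hU.exists_tail X c
    refine ⟨⟨i, hi', U.preimage (e.hom ≫ h)⟩, U.map_injective ?_⟩
    simp only [U.map_comp, U.map_preimage]
    rw [hi, Category.assoc, Category.assoc, hh]
  ext X Y Y' f₁ f₂ s hs h := by
    have hs : torIso (U.map s) := hs
    rw [torIso_iff] at hs
    refine hU.exists_comp_eq ?_
    filter_upwards [hs.1] with d hd m hm
    rw [← sub_eq_zero]
    refine hd _ (sub_mem ((U.map f₁).map_gr hm) ((U.map f₂).map_gr hm)) ?_
    have h1 : U.map f₁ ≫ U.map s = U.map f₂ ≫ U.map s := by rw [← U.map_comp, h, U.map_comp]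
    rw [map_sub, sub_eq_zero]
    exact congrArg (fun g : U.obj X ⟶ U.obj Y' => g.lin m) h1

/-- With right fractions, equality after localization means equality after an inverted
precomposition. Such a morphism is surjective in large bidegrees, and conversely a tail inclusion is
available. -/
theorem SubClosed.map_eq_iff [U.Full] [U.Faithful] (hU : SubClosed U) {X Y : D} {f g : X ⟶ Y} :
    (torIso.inverseImage U).Q.map f = (torIso.inverseImage U).Q.map g ↔
      ∀ᶠ d in atTop, ∀ m ∈ (U.obj X).gr d, (U.map f).lin m = (U.map g).lin m := by
  have := hU.hasRightCalculusOfFractions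
  rw [MorphismProperty.map_eq_iff_precomp _ (torIso.inverseImage U)]
  refine ⟨?_, hU.exists_comp_eq⟩
  rintro ⟨Z, s, hs, h⟩
  have hs : torIso (U.map s) := hs
  rw [torIso_iff] at hs
  filter_upwards [hs.2] with d hd m hm
  obtain ⟨m, rfl⟩ := hd m hm
  have h1 : U.map s ≫ U.map f = U.map s ≫ U.map g := by rw [← U.map_comp, h, U.map_comp]
  exact congrArg (fun g : U.obj Z ⟶ U.obj Y => g.lin m) h1

/-- The kernel of a representative is a graded submodule, hence an object of the category; a
monomorphism forces its inclusion to vanish in large bidegrees. The converse clears denominators of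
test morphisms. -/
theorem SubClosed.mono_iff [U.Full] [U.Faithful] (hU : SubClosed U) {X Y : D} {f : X ⟶ Y} :
    Mono ((torIso.inverseImage U).Q.map f) ↔
      ∀ᶠ d in atTop, ∀ m ∈ (U.obj X).gr d, (U.map f).lin m = 0 → m = 0 := by
  have := hU.hasRightCalculusOfFractions
  constructor
  · intro hf
    obtain ⟨K, i, e, hi⟩ := hU.exists_sub X (LinearMap.ker (U.map f).lin) fun d m hm => by
      rw [LinearMap.mem_ker] at hm ⊢
      rw [GrMod.lin_proj, hm, map_zero]
    -- The inclusion of the kernel and the zero map are equalized by `f`, so cancelling the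
    -- monomorphism makes them equal modulo torsion.
    have h0 : i ≫ f = U.preimage (GrMod.zeroHom _ _) ≫ f := by
      apply U.map_injective
      rw [U.map_comp, U.map_comp, U.map_preimage, hi]
      refine GrMod.hom_ext (LinearMap.ext fun m => ?_)
      exact (e.hom.lin m).2.trans (map_zero (U.map f).lin).symm
    have h1 := congrArg (torIso.inverseImage U).Q.map h0
    rw [Functor.map_comp, Functor.map_comp, cancel_mono, hU.map_eq_iff, U.map_preimage] at h1
    filter_upwards [h1] with d hd m hm h
    let m' : ((U.obj X).sub (LinearMap.ker (U.map f).lin) fun d m hm => by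
      rw [LinearMap.mem_ker] at hm ⊢
      rw [GrMod.lin_proj, hm, map_zero]).carrier := ⟨m, h⟩
    have h2 := hd (e.inv.lin m') (e.inv.map_gr hm)
    rw [hi] at h2
    have h3 : e.hom.lin (e.inv.lin m') = m' :=
      congrArg (fun g : _ ⟶ _ => GrMod.Hom.lin g m') e.inv_hom_id
    have h4 : ((e.hom.lin (e.inv.lin m')) : (U.obj X).carrier) = 0 := h2
    rw [h3] at h4
    exact h4
  · intro hf
    refine ⟨fun {Z} a b hab => ?_⟩
    have hZ : ∃ Z', (torIso.inverseImage U).Q.obj Z' = Z :=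
      (Localization.Construction.objEquiv _).surjective Z
    obtain ⟨Z, rfl⟩ := hZ
    -- Denominators are cleared one after the other, first for `a` and then for `b` precomposed with
    -- the denominator of `a`, so that two honest morphisms remain to be compared.
    obtain ⟨φ, rfl⟩ := Localization.exists_rightFraction (torIso.inverseImage U).Q
      (torIso.inverseImage U) a
    have hs := Localization.inverts (torIso.inverseImage U).Q _ _ φ.hs
    rw [← cancel_epi ((torIso.inverseImage U).Q.map φ.s),
      MorphismProperty.RightFraction.map_s_comp_map]
    obtain ⟨ψ, hψ⟩ := Localization.exists_rightFraction (torIso.inverseImage U).Q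
      (torIso.inverseImage U) ((torIso.inverseImage U).Q.map φ.s ≫ b)
    have hs' := Localization.inverts (torIso.inverseImage U).Q _ _ ψ.hs
    have h1 : (torIso.inverseImage U).Q.map φ.f ≫ (torIso.inverseImage U).Q.map f =
        ψ.map _ (Localization.inverts _ _) ≫ (torIso.inverseImage U).Q.map f := by
      rw [← hψ, Category.assoc, ← hab, ← Category.assoc,
        MorphismProperty.RightFraction.map_s_comp_map]
    rw [hψ, ← cancel_epi ((torIso.inverseImage U).Q.map ψ.s),
      MorphismProperty.RightFraction.map_s_comp_map, ← Functor.map_comp, hU.map_eq_iff]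
    rw [← cancel_epi ((torIso.inverseImage U).Q.map ψ.s), ← Category.assoc, ← Category.assoc,
      MorphismProperty.RightFraction.map_s_comp_map, ← Functor.map_comp, ← Functor.map_comp,
      ← Functor.map_comp, hU.map_eq_iff] at h1
    filter_upwards [h1, hf] with d h1 h2 m hm
    rw [← sub_eq_zero]
    refine h2 _ (sub_mem ((U.map _).map_gr hm) ((U.map _).map_gr hm)) ?_
    rw [map_sub, sub_eq_zero]
    have := h1 m hm
    rwa [U.map_comp, U.map_comp _ f] at this

theorem subClosed_id : SubClosed (𝟭 (GrMod.{u} ε τ)) := fun X S hS => ⟨X.sub S hS, ⟨Iso.refl _⟩⟩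

theorem subClosed_killed (g : Qu ε τ) : SubClosed (killed.{u} g).ι := fun X S hS =>
  ⟨⟨X.obj.sub S hS, fun m => Subtype.ext (X.property m)⟩, ⟨Iso.refl _⟩⟩

instance : (torIso (ε := ε) (τ := τ) : MorphismProperty (GrMod.{u} ε τ)).HasRightCalculusOfFractions :=
  subClosed_id.hasRightCalculusOfFractions

instance (g : Qu ε τ) : (torIso.inverseImage (killed.{u} g).ι).HasRightCalculusOfFractions :=
  (subClosed_killed g).hasRightCalculusOfFractions

theorem piFun_map_eq_iff {M N : GrMod.{u} ε τ} {f g : M ⟶ N} :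
    (piFun ε τ).map f = (piFun ε τ).map g ↔ ∀ᶠ d in atTop, ∀ m ∈ M.gr d, f.lin m = g.lin m :=
  subClosed_id.map_eq_iff

theorem mono_piFun_iff {M N : GrMod.{u} ε τ} {f : M ⟶ N} :
    Mono ((piFun ε τ).map f) ↔ ∀ᶠ d in atTop, ∀ m ∈ M.gr d, f.lin m = 0 → m = 0 :=
  subClosed_id.mono_iff

theorem exists_roof {M N : GrMod.{u} ε τ} (f : (piFun ε τ).obj M ⟶ (piFun ε τ).obj N) :
    ∃ (M' : GrMod.{u} ε τ) (s : M' ⟶ M) (g : M' ⟶ N), torIso s ∧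
      (piFun ε τ).map s ≫ f = (piFun ε τ).map g := by
  obtain ⟨φ, rfl⟩ := Localization.exists_rightFraction (piFun ε τ) torIso f
  exact ⟨φ.X', φ.s, φ.f, φ.hs, φ.map_s_comp_map _ _⟩

/-- Two morphisms with torsion kernels and the same image in large bidegrees define the same
subobject. -/
theorem exists_iso_of_range {M M' F : GrMod.{u} ε τ} (f : M ⟶ F) (f' : M' ⟶ F)
    (hf : ∀ᶠ d in atTop, ∀ m ∈ M.gr d, f.lin m = 0 → m = 0)
    (hf' : ∀ᶠ d in atTop, ∀ m ∈ M'.gr d, f'.lin m = 0 → m = 0)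
    (h : ∀ᶠ d in atTop, ∀ v ∈ F.gr d, v ∈ LinearMap.range f.lin ↔ v ∈ LinearMap.range f'.lin) :
    ∃ e : (piFun ε τ).obj M ≅ (piFun ε τ).obj M',
      e.hom ≫ (piFun ε τ).map f' = (piFun ε τ).map f := by
  obtain ⟨c, k, hk⟩ := exists_tail_lift f f' hf' (by
    filter_upwards [h] with d hd m hm
    exact torIso.surj_deg _ (f.map_gr hm) ((hd _ (f.map_gr hm)).mp ⟨m, rfl⟩))
  have hk' : ∀ m, f'.lin (k.lin m) = f.lin m.1 := fun m =>
    congrArg (fun g : M.tailObj c ⟶ F => g.lin m) hk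
  have hktor : torIso k := by
    refine torIso_iff.mpr ⟨?_, ?_⟩
    · filter_upwards [hf] with d hd m hm hm0
      exact Subtype.ext (hd _ hm (by rw [← hk', hm0, map_zero]))
    · filter_upwards [hf', h, eventually_bidegree.mpr ⟨c, fun d h1 h2 => And.intro h1 h2⟩]
        with d h1 h2 h3 n hn
      obtain ⟨m, hm, hmn⟩ := torIso.surj_deg f (f'.map_gr hn)
        ((h2 _ (f'.map_gr hn)).mpr ⟨n, rfl⟩)
      let m' : (M.tailObj c).carrier := ⟨m, M.mem_tail h3.1 h3.2 hm⟩
      refine ⟨m', ?_⟩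
      rw [← sub_eq_zero]
      refine h1 _ (sub_mem (k.map_gr hm) hn) ?_
      rw [map_sub, hk', ← hmn, sub_self]
  have h1 := Localization.inverts (piFun ε τ) torIso _ hktor
  have h2 := Localization.inverts (piFun ε τ) torIso _ (M.tailIncl_torIso c)
  refine ⟨(asIso ((piFun ε τ).map (M.tailIncl c))).symm ≪≫ asIso ((piFun ε τ).map k), ?_⟩
  rw [Iso.trans_hom, Category.assoc, asIso_hom, Iso.symm_hom, asIso_inv, IsIso.inv_comp_eq,
    ← Functor.map_comp, ← Functor.map_comp, hk]

end Fractions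

end NCQuadric
end

noncomputable section

namespace NCQuadric

/-! ### Homogeneous components as complex vector spaces. -/

section Components

variable {G : Type} [CommGroup G] {ε : G →* ℂˣ} {τ : MonoidAlgebra ℂ G}

/-- A homogeneous component of a bigraded module. -/
def GrMod.Comp (M : GrMod.{u} ε τ) (d : ℤ × ℤ) : Type u := M.gr d

instance (M : GrMod.{u} ε τ) (d : ℤ × ℤ) : AddCommGroup (M.Comp d) :=
  inferInstanceAs (AddCommGroup (M.gr d))

theorem Qu.algebraMap_mem (c : ℂ) : algebraMap ℂ (Qu ε τ) c ∈ Qu.grading ε τ 0 := by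
  rw [Algebra.algebraMap_eq_smul_one]
  exact Submodule.smul_mem _ _ (Qu.one_mem ε τ)

theorem GrMod.algebraMap_smul_mem (M : GrMod.{u} ε τ) {d : ℤ × ℤ} (c : ℂ) {m : M.carrier}
    (hm : m ∈ M.gr d) : op (algebraMap ℂ (Qu ε τ) c) • m ∈ M.gr d := by
  simpa using M.smul_mem (Qu.algebraMap_mem c) hm

instance (M : GrMod.{u} ε τ) (d : ℤ × ℤ) : Module ℂ (M.Comp d) where
  smul c m := ⟨op (algebraMap ℂ (Qu ε τ) c) • m.1, M.algebraMap_smul_mem c m.2⟩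
  one_smul m := Subtype.ext (by
    show op (algebraMap ℂ (Qu ε τ) 1) • m.1 = m.1
    rw [map_one, op_one, one_smul])
  mul_smul a b m := Subtype.ext (by
    show op (algebraMap ℂ (Qu ε τ) (a * b)) • m.1 =
      op (algebraMap ℂ (Qu ε τ) a) • op (algebraMap ℂ (Qu ε τ) b) • m.1
    rw [mul_comm, map_mul, op_mul, mul_smul])
  smul_zero a := Subtype.ext (smul_zero (A := M.carrier) (op (algebraMap ℂ (Qu ε τ) a)))
  smul_add a m n := Subtype.ext (smul_add (op (algebraMap ℂ (Qu ε τ) a)) m.1 n.1)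
  add_smul a b m := Subtype.ext (by
    show op (algebraMap ℂ (Qu ε τ) (a + b)) • m.1 =
      op (algebraMap ℂ (Qu ε τ) a) • m.1 + op (algebraMap ℂ (Qu ε τ) b) • m.1
    rw [map_add, MulOpposite.op_add, add_smul])
  zero_smul m := Subtype.ext (by
    show op (algebraMap ℂ (Qu ε τ) 0) • m.1 = 0
    rw [map_zero, op_zero, zero_smul])

theorem GrMod.Comp.coe_smul {M : GrMod.{u} ε τ} {d : ℤ × ℤ} (c : ℂ) (m : M.Comp d) :
    (c • m).1 = op (algebraMap ℂ (Qu ε τ) c) • m.1 := rfl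

/-- The map on homogeneous components induced by a morphism. -/
def GrMod.compMap {M N : GrMod.{u} ε τ} (f : M ⟶ N) (d : ℤ × ℤ) : M.Comp d →ₗ[ℂ] N.Comp d where
  toFun m := ⟨f.lin m.1, f.map_gr m.2⟩
  map_add' m n := Subtype.ext (map_add f.lin m.1 n.1)
  map_smul' _ m := Subtype.ext (map_smul f.lin _ m.1)

variable {W : Type u} [AddCommGroup W] [Module ℂ W] [FiniteDimensional ℂ W]

/-- The component is the image of `Q_{d+s} ⊗ W` over `ℂ`, and `Q_{d+s}` is spanned by finitely many
ordered monomials. -/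
instance [Finite G] (ρ : Representation ℂ G W) (s d : ℤ × ℤ) :
    FiniteDimensional ℂ ((freeMod ε τ ρ s).Comp d) := by
  have hQ : FiniteDimensional ℂ (Qu.grading ε τ (d + s)) := by
    obtain ⟨t, ht, h1, h2⟩ := Qu.exists_finite_span (ε := ε) (τ := τ) (d + s)
    rw [le_antisymm h2 (Submodule.span_le.mpr h1)]
    exact FiniteDimensional.span_of_finite ℂ ht
  have hsmul : ∀ (c : ℂ) (q : Qu ε τ) (w : ρ.asModule),
      (c • q) ⊗ₜ[MonoidAlgebra ℂ G] w = op (algebraMap ℂ (Qu ε τ) c) • (q ⊗ₜ[MonoidAlgebra ℂ G] w) :=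
    fun c q w => by
      rw [smul_tmul', op_smul_eq_mul, Algebra.smul_def, Algebra.commutes]
  have hsmul' : ∀ (c : ℂ) (q : Qu ε τ) (w : ρ.asModule),
      q ⊗ₜ[MonoidAlgebra ℂ G] (c • w) = (c • q) ⊗ₜ[MonoidAlgebra ℂ G] w := fun c q w => by
    have h3 : c • w = (algebraMap ℂ (MonoidAlgebra ℂ G) c) • w := by rw [algebraMap_smul]
    rw [h3, ← smul_tmul, Qu.cg_smul, AlgHom.commutes, Algebra.smul_def]
  let b : Qu.grading ε τ (d + s) →ₗ[ℂ] ρ.asModule →ₗ[ℂ] (freeMod ε τ ρ s).Comp d :=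
    LinearMap.mk₂ ℂ (fun q w => ⟨q.1 ⊗ₜ w, AddSubgroup.subset_closure ⟨q.1, q.2, w, rfl⟩⟩)
      (fun q q' w => Subtype.ext (add_tmul q.1 q'.1 w))
      (fun r q w => Subtype.ext (hsmul r q.1 w))
      (fun q w w' => Subtype.ext (tmul_add q.1 w w'))
      (fun c q w => Subtype.ext ((hsmul' c q.1 w).trans (hsmul c q.1 w)))
  have hb : Function.Surjective (TensorProduct.lift b) := by
    have key : ∀ m ∈ freeGr ε τ ρ (d + s), ∃ y, (TensorProduct.lift b y).1 = m := by
      intro m hm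
      induction hm using AddSubgroup.closure_induction with
      | mem m hm =>
        obtain ⟨q, hq, w, rfl⟩ := hm
        exact ⟨(⟨q, hq⟩ : Qu.grading ε τ (d + s)) ⊗ₜ w, by rw [TensorProduct.lift.tmul]; rfl⟩
      | zero => exact ⟨0, by rw [map_zero]; rfl⟩
      | add x y _ _ hx hy =>
        obtain ⟨a, rfl⟩ := hx
        obtain ⟨b, rfl⟩ := hy
        exact ⟨a + b, by rw [map_add]; rfl⟩
      | neg x _ hx =>
        obtain ⟨a, rfl⟩ := hx
        refine ⟨(-1 : ℂ) • a, ?_⟩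
        rw [map_smul, GrMod.Comp.coe_smul, map_neg, map_one, MulOpposite.op_neg, op_one, neg_smul,
          one_smul]
    rintro ⟨m, hm⟩
    obtain ⟨y, hy⟩ := key m hm
    exact ⟨y, Subtype.ext hy⟩
  exact Module.Finite.of_surjective _ hb

/-- A dimension count in a fixed bidegree. -/
theorem injective_of_roof {X A B C : GrMod.{u} ε τ} (s : X ⟶ A) (g : X ⟶ B) (p : B ⟶ C) (f : A ⟶ C)
    {d : ℤ × ℤ} [FiniteDimensional ℂ (C.Comp d)] (hs : ∀ a ∈ A.gr d, a ∈ LinearMap.range s.lin)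
    (hg : ∀ x ∈ X.gr d, g.lin x = 0 → x = 0) (hp : ∀ b ∈ B.gr d, p.lin b = 0 → b = 0)
    (hf : ∀ c ∈ C.gr d, c ∈ LinearMap.range f.lin) (a : A.carrier) (ha : a ∈ A.gr d)
    (h : f.lin a = 0) : a = 0 := by
  -- `X_d` embeds into `C_d` by one route and surjects onto it by the other, so by finite dimension
  -- the surjection is injective. As `s` is onto in this bidegree, so is `f`.
  have h1 : Function.Injective (GrMod.compMap (g ≫ p) d) := by
    rw [injective_iff_map_eq_zero]
    rintro ⟨x, hx⟩ h
    exact Subtype.ext (hg x hx (hp _ (g.map_gr hx) (congrArg Subtype.val h)))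
  have h2 : Function.Surjective (GrMod.compMap (s ≫ f) d) := by
    rintro ⟨c, hc⟩
    obtain ⟨a, ha, rfl⟩ := torIso.surj_deg f hc (hf c hc)
    obtain ⟨x, hx, rfl⟩ := torIso.surj_deg s ha (hs a ha)
    exact ⟨⟨x, hx⟩, rfl⟩
  have hX : FiniteDimensional ℂ (X.Comp d) := Module.Finite.of_injective _ h1
  have hdim : Module.finrank ℂ (X.Comp d) = Module.finrank ℂ (C.Comp d) :=
    le_antisymm (LinearMap.finrank_le_finrank_of_injective h1)
      (LinearMap.finrank_le_finrank_of_surjective h2)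
  have h3 := (LinearMap.injective_iff_surjective_of_finrank_eq_finrank hdim).mpr h2
  obtain ⟨x, hx, rfl⟩ := torIso.surj_deg s ha (hs a ha)
  -- A preimage under `s` of an element of the kernel of `f` lies in the kernel of the composite,
  -- hence is zero.
  have h4 : (⟨x, hx⟩ : X.Comp d) = 0 := h3 ((Subtype.ext h).trans (map_zero _).symm)
  have h5 : x = 0 := congrArg Subtype.val h4
  rw [h5, map_zero]

end Components

/-! ### Saturation and injectivity modulo a central element. -/

section Saturation

open Filter

variable {G : Type} [CommGroup G] [Finite G] {ε : G →* ℂˣ} {τ : MonoidAlgebra ℂ G}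
variable {W : Type u} [AddCommGroup W] [Module ℂ W] [FiniteDimensional ℂ W]

/-- Setting `z = w = 1` is injective on each component and turns multiplication by `t` into the
identity. -/
theorem free_smul_injective (ρ : Representation ℂ G W) {t : Qu ε τ} {e : ℤ × ℤ}
    (he : t ∈ Qu.grading ε τ e) (ht : theta ε τ t = 1)
    {u v : Qu ε τ ⊗[MonoidAlgebra ℂ G] ρ.asModule} (h : op t • u = op t • v) : u = v := by
  rw [← sub_eq_zero]
  let F := freeMod ε τ ρ 0
  refine F.eq_zero_of_proj (m := u - v) fun d => ?_
  have h1 : op t • F.proj d (u - v) = 0 := by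
    have := F.proj_rmul he (d + e) (u - v)
    rw [add_sub_cancel_right] at this
    rw [← this, smul_sub, h, sub_self, map_zero]
  refine toRat_eq_zero (F.proj_mem d _) ?_
  have h2 := congrArg (toRat ε τ ρ) h1
  rwa [toRat_smul, ht, op_one, one_smul, map_zero] at h2

/-- The image of `f` is saturated with respect to `t` in large bidegrees. -/
def Saturated {M F : GrMod.{u} ε τ} (t : Qu ε τ) (f : M ⟶ F) : Prop :=
  ∀ᶠ d in atTop, ∀ v ∈ F.gr d, op t • v ∈ LinearMap.range f.lin → v ∈ LinearMap.range f.lin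

/-- An element of `M/Mt` that dies in `F/Ft` is an element of `M` whose image is `t • v`. It was
already zero exactly when `v` comes from `M`, since `t` can be cancelled on `F` and `f` is injective
in large bidegrees. -/
theorem quotMap_injective_iff_saturated {M : GrMod.{u} ε τ} {ρ : Representation ℂ G W} {s : ℤ × ℤ}
    (f : M ⟶ freeMod ε τ ρ s) (hf : ∀ᶠ d in atTop, ∀ m ∈ M.gr d, f.lin m = 0 → m = 0)
    {t : Qu ε τ} (htc : ∀ q, Commute t q) {e : ℤ × ℤ} (he : t ∈ Qu.grading ε τ e)
    (ht : theta ε τ t = 1) :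
    (∀ᶠ d in atTop, ∀ m ∈ (GrMod.quot t htc e he M).gr d,
      (GrMod.quotMap t htc e he f).lin m = 0 → m = 0) ↔ Saturated t f := by
  constructor
  · intro h
    -- The element `v` has bidegree `d` but the injectivity is applied to `t • v`, hence the shift
    -- by `e`.
    filter_upwards [eventually_add e h] with d hd v hv hr
    obtain ⟨m, hm, hmv⟩ := torIso.surj_deg f ((freeMod ε τ ρ s).smul_mem he hv) hr
    have h0 := hd _ ⟨m, hm, rfl⟩ (by
      refine (Submodule.Quotient.mk_eq_zero _).mpr ⟨v, ?_⟩
      rw [rmul_apply]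
      exact hmv.symm)
    obtain ⟨m', hm'⟩ := (Submodule.Quotient.mk_eq_zero _).mp h0
    rw [rmul_apply] at hm'
    refine ⟨m', free_smul_injective ρ he ht ?_⟩
    rw [← map_smul, hm']
    exact hmv
  · intro h
    filter_upwards [hf, eventually_sub e h] with d hd hs
    rintro _ ⟨m, hm, rfl⟩ h0
    obtain ⟨v, hv⟩ := (Submodule.Quotient.mk_eq_zero _).mp h0
    rw [rmul_apply] at hv
    have h1 : op t • (freeMod ε τ ρ s).proj (d - e) v = f.lin m := by
      have hm' : f.lin m ∈ (freeMod ε τ ρ s).gr d := f.map_gr hm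
      rw [← GrMod.proj_rmul _ he, hv, GrMod.proj_of_mem_gen _ _ _ hm', if_pos rfl]
    have hv' := (freeMod ε τ ρ s).proj_mem (d - e) v
    obtain ⟨m', hm', e'⟩ := torIso.surj_deg f hv' (hs _ hv' ⟨m, h1.symm⟩)
    have h2 : m - op t • m' = 0 := by
      refine hd _ (sub_mem hm ?_) ?_
      · have := M.smul_mem he hm'
        rwa [sub_add_cancel] at this
      · rw [map_sub, map_smul, e', h1, sub_self]
    exact (Submodule.Quotient.mk_eq_zero _).mpr ⟨m', (sub_eq_zero.mp h2).symm⟩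

end Saturation

/-! ### The functors `i^*` and `j^*` on morphisms of graded modules. -/

section Restriction

open Filter

variable {G : Type} [CommGroup G] {ε : G →* ℂˣ} {τ : MonoidAlgebra ℂ G}

theorem restrict_map (g : Qu ε τ) (hg : ∀ q, Commute g q) (e : ℤ × ℤ)
    (he : g ∈ Qu.grading ε τ e) {M N : GrMod.{u} ε τ} (f : M ⟶ N) :
    (restrict g hg e he).map ((piFun ε τ).map f) =
      (torIso.inverseImage (killed.{u} g).ι).Q.map ((quotFun g hg e he).map f) := by
  have := Functor.congr_hom (Localization.Construction.fac
    (quotFun g hg e he ⋙ (torIso.inverseImage (killed.{u} g).ι).Q) (fun _ _ f hf =>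
      MorphismProperty.Q_inverts (torIso.inverseImage (killed.{u} g).ι) _
        (GrMod.quotMap_torIso g hg e he f hf))) f
  exact this.trans ((Category.id_comp _).trans (Category.comp_id _))

theorem jStar_map {M N : GrMod.{u} ε τ} (f : M ⟶ N) :
    (jStar ε τ).map ((piFun ε τ).map f) = (jFun ε τ).map f := by
  have := Functor.congr_hom (Localization.Construction.fac (jFun ε τ) (W := torIso)
    (fun _ _ f hf => by
      rw [ConcreteCategory.isIso_iff_bijective]
      exact jMap_bijective hf)) f
  exact this.trans ((Category.id_comp _).trans (Category.comp_id _))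

end Restriction

end NCQuadric
end

noncomputable section

namespace NCQuadric

/-! ### The submodule of a sheaf in terms of a graded representative. -/

section Auxiliary

open Filter

variable {G : Type} [CommGroup G] {ε : G →* ℂˣ} {τ : MonoidAlgebra ℂ G}
variable {W : Type u} [AddCommGroup W] [Module ℂ W] [FiniteDimensional ℂ W]

theorem Qu.z_mem : Qu.z ε τ ∈ Qu.grading ε τ (1, 0) := Qu.gen_mem ε τ .z
theorem Qu.w_mem : Qu.w ε τ ∈ Qu.grading ε τ (0, 1) := Qu.gen_mem ε τ .w

/-- In large bidegrees every element of `F(b)` is a multiple of `P` modulo `z`. -/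
theorem eventually_exists_eq {k : ℕ} (P : SemiInv ε k) (ρ ρ' : Representation ℂ G W)
    (hW : ∀ g w, ρ' g w = ((ε g ^ k : ℂˣ) : ℂ) • ρ g w) (a b : ℤ) (hab : b = a + k) :
    ∀ᶠ d in atTop, ∀ v ∈ (freeMod ε τ ρ' (b, 0)).gr d, ∃ u ∈ (freeMod ε τ ρ (a, 0)).gr d,
      ∃ u₂, v = (mulMod τ P ρ ρ' hW a b hab).lin u + op (Qu.z ε τ) • u₂ := by
  refine eventually_bidegree.mpr ⟨k - b, fun d h1 _ v hv => ?_⟩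
  obtain ⟨u, hu, u₂, rfl⟩ := freeGr_exists_eq P ρ ρ' hW (d := d + (b, 0)) (by
    rw [Prod.fst_add]; show (k : ℤ) ≤ d.1 + b; omega) hv
  refine ⟨u, ?_, u₂, rfl⟩
  have : d + (b, 0) - ((k : ℤ), 0) = d + (a, 0) := by
    subst hab
    ext
    · show d.1 + (a + k) - k = d.1 + a
      ring
    · show d.2 + 0 - 0 = d.2 + 0
      ring
  rwa [this] at hu

theorem finiteDimensional_quot (g : Qu ε τ) (hg : ∀ q, Commute g q) (e : ℤ × ℤ)
    (he : g ∈ Qu.grading ε τ e) (M : GrMod.{u} ε τ) (d : ℤ × ℤ) [FiniteDimensional ℂ (M.Comp d)] :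
    FiniteDimensional ℂ ((GrMod.quot g hg e he M).Comp d) := by
  let π : M ⟶ GrMod.quot g hg e he M := ⟨Submodule.mkQ _, fun hm => ⟨_, hm, rfl⟩⟩
  refine Module.Finite.of_surjective (GrMod.compMap π d) ?_
  rintro ⟨_, m, hm, rfl⟩
  exact ⟨⟨m, hm⟩, rfl⟩

variable {ρ : Representation ℂ G W}

variable (ε τ ρ) in
/-- The bigraded module of `(W ⊗ ε^n) ⊗ O(n,0)`. -/
abbrev shiftMod (n : ℤ) : GrMod.{u} ε τ := freeMod ε τ (twist ρ (ε ^ n)) (n, 0)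

variable (ε τ ρ) in
/-- Multiplication by a semiinvariant polynomial. -/
abbrev shiftMul {k : ℕ} (P : SemiInv ε k) (a b : ℤ) (h : b = a + k) :
    shiftMod ε τ ρ a ⟶ shiftMod ε τ ρ b := mulMod τ P _ _ (twist_shift ε ρ h) a b h

/-- Isomorphic sheaves have the same image under `j^*ψ`, so the image may be computed from any
graded module representing `E`; there it consists of the values of `f` at `z = w = 1`. -/
theorem Triv.mem_toSubmodule (t : Triv.{u} ε τ ρ) {M : GrMod.{u} ε τ}
    (e : (piFun ε τ).obj M ≅ t.E) (f : M ⟶ shiftMod ε τ ρ t.n)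
    (h : e.hom ≫ t.ψ = (piFun ε τ).map f) (hW)
    (u : BRat ε τ ⊗[MonoidAlgebra ℂ G] ρ.asModule) :
    u ∈ t.toSubmodule ↔ ∃ m, toRat ε τ _ (f.lin m) =
      BRat.lmulPoly τ t.P ρ (twist ρ (ε ^ (t.n : ℤ))) hW u := by
  have h1 : (jStar ε τ).map e.hom ≫ (jStar ε τ).map t.ψ = (jFun ε τ).map f := by
    rw [← jStar_map, ← h]
    exact ((jStar ε τ).map_comp _ _).symm
  have h2 : ∀ v, ((jStar ε τ).map t.ψ).hom (((jStar ε τ).map e.hom).hom v) = jMap f v := fun v =>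
    congrArg (fun g => ModuleCat.Hom.hom g v) h1
  constructor
  · rintro ⟨v, hv⟩
    have h3 : ((jStar ε τ).map e.hom).hom (((jStar ε τ).map e.inv).hom v) = v := by
      have : (jStar ε τ).map e.inv ≫ (jStar ε τ).map e.hom = 𝟙 _ := by
        rw [← Functor.map_comp, e.inv_hom_id, CategoryTheory.Functor.map_id]
      exact congrArg (fun g => ModuleCat.Hom.hom g v) this
    obtain ⟨m, hm⟩ := jMk_surj M (((jStar ε τ).map e.inv).hom v)
    have h4 : jMap f (jMk M m) = ((jStar ε τ).map t.ψ).hom v := by rw [hm, ← h2, h3]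
    exact ⟨m, (congrArg (jToRat ε τ _ _) h4).trans hv⟩
  · rintro ⟨m, hm⟩
    exact ⟨((jStar ε τ).map e.hom).hom (jMk M m),
      (congrArg (jToRat ε τ _ _) (h2 (jMk M m))).trans hm⟩

end Auxiliary

/-! ### Trivialized sheaves as saturated graded submodules. -/

section Presentation

open Filter

variable {G : Type} [CommGroup G] [Finite G] {ε : G →* ℂˣ} {τ : MonoidAlgebra ℂ G}
variable {W : Type u} [AddCommGroup W] [Module ℂ W] [FiniteDimensional ℂ W]
variable {ρ : Representation ℂ G W}

/-- The conditions on the graded submodule describing a trivialized sheaf. -/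
structure IsPresentation {n : ℕ} (P : SemiInv ε n) {M : GrMod.{u} ε τ}
    (f : M ⟶ shiftMod ε τ ρ n) : Prop where
  inj : ∀ᶠ d in atTop, ∀ m ∈ M.gr d, f.lin m = 0 → m = 0
  sq_mem : ∀ᶠ d in atTop, ∀ v ∈ (shiftMod ε τ ρ (-n)).gr d,
    (shiftMul ε τ ρ (P.mul P) (-n) n (by push_cast; ring)).lin v ∈ LinearMap.range f.lin
  z_sat : Saturated (Qu.z ε τ) f
  w_sat : Saturated (Qu.w ε τ) f

/-- A reformulation of the regularity of `P` modulo `z`. It holds in all bidegrees. -/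
theorem quotMap_mulMod_injective {k : ℕ} (P : SemiInv ε k) (ρ ρ' : Representation ℂ G W)
    (hW : ∀ g w, ρ' g w = ((ε g ^ k : ℂˣ) : ℂ) • ρ g w) (a b : ℤ) (hab : b = a + k)
    (m : (GrMod.quot (Qu.z ε τ) (Qu.z_comm ε τ) (1, 0) Qu.z_mem
      (freeMod ε τ ρ (a, 0))).carrier)
    (h : (GrMod.quotMap (Qu.z ε τ) (Qu.z_comm ε τ) (1, 0) Qu.z_mem
      (mulMod τ P ρ ρ' hW a b hab)).lin m = 0) : m = 0 := by
  obtain ⟨m, rfl⟩ := Submodule.mkQ_surjective _ m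
  obtain ⟨v, hv⟩ := (Submodule.Quotient.mk_eq_zero _).mp h
  rw [rmul_apply] at hv
  obtain ⟨u, rfl⟩ := lmulPoly_z_regular P ρ ρ' hW hv.symm
  exact (Submodule.Quotient.mk_eq_zero _).mpr ⟨u, rfl⟩

/-- Saturation for `w` is the monomorphy of `i_w^*ψ`. Saturation for `z` has to be derived: the
isomorphism `i_z^*E ≅ W ⊗ O` is arbitrary and unrelated to `ψ`, but it bounds dimensions, and modulo
`z` the map `f` is onto in large bidegrees. -/
theorem exists_presentation {n : ℕ} (P : SemiInv ε n) (M₀ : GrMod.{u} ε τ)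
    (φ : (piFun ε τ).obj (shiftMod ε τ ρ (-n)) ⟶ (piFun ε τ).obj M₀)
    (ψ : (piFun ε τ).obj M₀ ⟶ (piFun ε τ).obj (shiftMod ε τ ρ n)) [Mono ψ]
    (hcomp : φ ≫ ψ =
      (piFun ε τ).map (shiftMul ε τ ρ (P.mul P) (-n) n (by push_cast; ring)))
    (hiz : (izStar ε τ).obj ((piFun ε τ).obj M₀) ≅
      (izStar ε τ).obj ((piFun ε τ).obj (freeMod ε τ ρ (0, 0))))
    (hiw : Mono ((iwStar ε τ).map ψ)) :
    ∃ (M : GrMod.{u} ε τ) (s : M ⟶ M₀) (f : M ⟶ shiftMod ε τ ρ n), torIso s ∧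
      (piFun ε τ).map s ≫ ψ = (piFun ε τ).map f ∧ IsPresentation P f := by
  obtain ⟨M, s, f, hs, hsf⟩ := exists_roof ψ
  have hs' := Localization.inverts (piFun ε τ) torIso _ hs
  have inj : ∀ᶠ d in atTop, ∀ m ∈ M.gr d, f.lin m = 0 → m = 0 := by
    rw [← mono_piFun_iff, ← hsf]
    exact mono_comp _ _
  have sq_mem : ∀ᶠ d in atTop, ∀ v ∈ (shiftMod ε τ ρ (-n)).gr d,
      (shiftMul ε τ ρ (P.mul P) (-n) n (by push_cast; ring)).lin v ∈ LinearMap.range f.lin := by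
    -- A fraction representing `φ`, followed by the inverse of `s`, shows that multiplication by
    -- `P²` factors over `f` after a morphism that is onto in large bidegrees.
    obtain ⟨X, s', g, hs', hg⟩ := exists_roof (φ ≫ inv ((piFun ε τ).map s))
    have h1 : (piFun ε τ).map (s' ≫ shiftMul ε τ ρ (P.mul P) (-n) n (by push_cast; ring)) =
        (piFun ε τ).map (g ≫ f) := by
      rw [Functor.map_comp, Functor.map_comp, ← hg, ← hsf, Category.assoc, Category.assoc,
        IsIso.inv_hom_id_assoc, hcomp]
    rw [piFun_map_eq_iff] at h1
    filter_upwards [h1, (torIso_iff.mp hs').2] with d h1 h2 v hv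
    obtain ⟨x, hx, rfl⟩ := torIso.surj_deg s' hv (h2 v hv)
    exact ⟨g.lin x, (h1 x hx).symm⟩
  refine ⟨M, s, f, hs, hsf, inj, sq_mem, ?_, ?_⟩
  · rw [← quotMap_injective_iff_saturated f inj (Qu.z_comm ε τ) Qu.z_mem
      (theta_gen ε τ .z)]
    let Z := quotFun.{u} (Qu.z ε τ) (Qu.z_comm ε τ) (1, 0) Qu.z_mem
    let L := (torIso.inverseImage (killed.{u} (Qu.z ε τ)).ι).Q
    let j := (izStar ε τ).mapIso (asIso ((piFun ε τ).map s)) ≪≫ hiz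
    let j' : L.obj (Z.obj M) ⟶ L.obj (Z.obj (freeMod ε τ ρ (0, 0))) := j.hom
    have hj' : IsIso j' := inferInstanceAs (IsIso j.hom)
    -- The isomorphism with `W ⊗ O` on the line is written as a fraction; its denominator is onto
    -- and its numerator injective in large bidegrees, as required by `injective_of_roof`.
    obtain ⟨r, hr⟩ := Localization.exists_rightFraction L
      (torIso.inverseImage (killed.{u} (Qu.z ε τ)).ι) j'
    have hrs := Localization.inverts L (torIso.inverseImage (killed.{u} (Qu.z ε τ)).ι) _ r.hs
    have hmono : Mono (L.map r.f) := by
      rw [← r.map_s_comp_map L (Localization.inverts _ _), ← hr]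
      infer_instance
    rw [(subClosed_killed (Qu.z ε τ)).mono_iff] at hmono
    have hrs' : torIso r.s.hom := r.hs
    filter_upwards [(torIso_iff.mp hrs').2, hmono, sq_mem, eventually_exists_eq (P.mul P)
      (twist ρ (ε ^ (-n : ℤ))) (twist ρ (ε ^ (n : ℤ))) (twist_shift ε ρ (by push_cast; ring))
      (-n) n (by push_cast; ring)] with d h1 h2 h3 h4 a ha h5
    have hfin := finiteDimensional_quot (Qu.z ε τ) (Qu.z_comm ε τ) (1, 0) Qu.z_mem
      (shiftMod ε τ ρ n) d
    -- The two routes to `F(n)/zF(n)`: through `F(0)/zF(0)` and multiplication by `P`, which is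
    -- injective, and through `M/Mz` and `f`, which is surjective.
    refine injective_of_roof (C := GrMod.quot (Qu.z ε τ) (Qu.z_comm ε τ) (1, 0)
      Qu.z_mem (shiftMod ε τ ρ n)) r.s.hom r.f.hom
      (GrMod.quotMap _ _ _ _ (mulMod τ P ρ (twist ρ (ε ^ (n : ℤ))) (fun g w => by
        show ((ε g ^ (n : ℤ) : ℂˣ) : ℂ) • ρ g w = _
        rw [zpow_natCast]) 0 n (by simp))) (GrMod.quotMap _ _ _ _ f) h1 h2
      (fun b _ hb => quotMap_mulMod_injective _ _ _ _ _ _ _ b hb) ?_ a ha h5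
    rintro _ ⟨v, hv, rfl⟩
    -- Surjectivity modulo `z`: write `v = P² u + z u₂`, where `P² u` already lies in the image of
    -- `f`.
    obtain ⟨u, hu, u₂, rfl⟩ := h4 v hv
    obtain ⟨m, hm⟩ := h3 u hu
    refine ⟨Submodule.Quotient.mk m, (Submodule.Quotient.eq _).mpr ⟨-u₂, ?_⟩⟩
    rw [hm, rmul_apply, smul_neg]
    exact (sub_add_cancel_left _ _).symm
  · rw [← quotMap_injective_iff_saturated f inj (Qu.w_comm ε τ) Qu.w_mem
      (theta_gen ε τ .w)]
    have h1 : Mono ((iwStar ε τ).map ((piFun ε τ).map f)) := by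
      rw [← hsf, Functor.map_comp]
      exact mono_comp _ _
    have h2 := restrict_map (Qu.w ε τ) (Qu.w_comm ε τ) (0, 1) Qu.w_mem f
    exact (subClosed_killed (Qu.w ε τ)).mono_iff.mp (h2 ▸ h1)

/-- Every trivialized sheaf is given by a graded module over `F(n)`. -/
theorem Triv.exists_presentation (t : Triv.{u} ε τ ρ) :
    ∃ (M : GrMod.{u} ε τ) (e : (piFun ε τ).obj M ≅ t.E) (f : M ⟶ shiftMod ε τ ρ t.n),
      e.hom ≫ t.ψ = (piFun ε τ).map f ∧ IsPresentation t.P f := by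
  obtain ⟨E, n, P, φ, ψ, hφ, hψ, hcomp, ⟨hiz⟩, hiw⟩ := t
  have hE : ∃ M₀, (piFun ε τ).obj M₀ = E := (Localization.Construction.objEquiv _).surjective E
  obtain ⟨M₀, rfl⟩ := hE
  have hψ' : Mono (Y := (piFun ε τ).obj (shiftMod ε τ ρ n)) ψ := hψ
  obtain ⟨M, s, f, hs, hsf, h⟩ := NCQuadric.exists_presentation P M₀ φ ψ hcomp hiz hiw
  have := Localization.inverts (piFun ε τ) torIso _ hs
  exact ⟨M, asIso ((piFun ε τ).map s), f, hsf, h⟩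

end Presentation

end NCQuadric
end

noncomputable section

namespace NCQuadric

/-! ### Invariant denominators and extraction of square roots. -/

section Denominators

variable {G : Type} [CommGroup G] {ε : G →* ℂˣ} {τ : MonoidAlgebra ℂ G}
variable {W : Type u} [AddCommGroup W] [Module ℂ W]

theorem IsInvPoly.mul {p q : Polynomial ℂ} (hp : IsInvPoly ε p) (hq : IsInvPoly ε q) :
    IsInvPoly ε (p * q) :=
  ⟨mul_ne_zero hp.1 hq.1, fun g => by rw [Polynomial.mul_comp, hp.2, hq.2]⟩

theorem BRat.lmulInv_tmul {p : Polynomial ℂ} (hp : IsInvPoly ε p) (ρ : Representation ℂ G W)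
    (q : BRat ε τ) (w : ρ.asModule) : BRat.lmulInv τ hp ρ (q ⊗ₜ w) =
      (BRat.num ε τ (Polynomial.aeval (Bt.x ε τ) p) * q) ⊗ₜ[MonoidAlgebra ℂ G] w := rfl

theorem BRat.lmulInv_mul {p q : Polynomial ℂ} (hp : IsInvPoly ε p) (hq : IsInvPoly ε q)
    (ρ : Representation ℂ G W) (u : BRat ε τ ⊗[MonoidAlgebra ℂ G] ρ.asModule) :
    BRat.lmulInv τ (hp.mul hq) ρ u = BRat.lmulInv τ hp ρ (BRat.lmulInv τ hq ρ u) := by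
  induction u using TensorProduct.induction_on with
  | zero => simp only [map_zero]
  | add a b ha hb => simp only [map_add, ha, hb]
  | tmul a w =>
    rw [BRat.lmulInv_tmul, BRat.lmulInv_tmul, BRat.lmulInv_tmul, map_mul, map_mul, mul_assoc]

theorem BRat.lmulInv_comm {p q : Polynomial ℂ} (hp : IsInvPoly ε p) (hq : IsInvPoly ε q)
    (ρ : Representation ℂ G W) (u : BRat ε τ ⊗[MonoidAlgebra ℂ G] ρ.asModule) :
    BRat.lmulInv τ hp ρ (BRat.lmulInv τ hq ρ u) = BRat.lmulInv τ hq ρ (BRat.lmulInv τ hp ρ u) := by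
  rw [← BRat.lmulInv_mul, ← BRat.lmulInv_mul]
  congr 2
  exact mul_comm _ _

theorem BRat.lmulInv_injective {p : Polynomial ℂ} (hp : IsInvPoly ε p) (ρ : Representation ℂ G W) :
    Function.Injective (BRat.lmulInv τ hp ρ) :=
  (lmulAdd_bijective (BRat.ofCG ε τ) (fun _ _ => rfl) _ hp.isUnit (fun _ => 1)
    (fun g c => by
      have := congrArg (BRat.num ε τ) (hp.ofCG_comm (τ := τ) (.single g c)).symm.eq
      rw [map_mul, map_mul] at this
      simpa [BRat.ofCG] using this) ρ ρ (fun g w => by simp)).1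

/-- On the generators `1 ⊗ w`, left multiplication by an invariant `p(x)` coincides with the right
action of `p(x)`; the rest follows by right linearity. -/
theorem lmulInv_mem_lattice {p : Polynomial ℂ} (hp : IsInvPoly ε p) (ρ : Representation ℂ G W)
    {u : BRat ε τ ⊗[MonoidAlgebra ℂ G] ρ.asModule} (hu : u ∈ lattice ε τ ρ) :
    BRat.lmulInv τ hp ρ u ∈ lattice ε τ ρ := by
  induction hu using Submodule.span_induction with
  | mem u hu =>
    obtain ⟨w, rfl⟩ := hu
    have h : BRat.lmulInv τ hp ρ (1 ⊗ₜ w) = op (Polynomial.aeval (Bt.x ε τ) p) •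
        ((1 : BRat ε τ) ⊗ₜ[MonoidAlgebra ℂ G] w) := by
      rw [BRat.lmulInv_tmul, smul_tmul', BRat.op_smul, one_mul, mul_one]
    rw [h]
    exact Submodule.smul_mem _ _ (Submodule.subset_span ⟨w, rfl⟩)
  | zero => rw [map_zero]; exact zero_mem _
  | add a b _ _ ha hb => rw [map_add]; exact add_mem ha hb
  | smul b u _ hu => rw [map_smul]; exact Submodule.smul_mem _ _ hu

/-- Elements of `W ⊗ B_rat` have invariant denominators. -/
theorem exists_lmulInv_mem_lattice (ρ : Representation ℂ G W)
    (u : BRat ε τ ⊗[MonoidAlgebra ℂ G] ρ.asModule) :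
    ∃ (p : Polynomial ℂ) (hp : IsInvPoly ε p), BRat.lmulInv τ hp ρ u ∈ lattice ε τ ρ := by
  induction u using TensorProduct.induction_on with
  | zero => exact ⟨1, ⟨one_ne_zero, by simp⟩, by rw [map_zero]; exact zero_mem _⟩
  | add a b ha hb =>
    obtain ⟨p, hp, ha⟩ := ha
    obtain ⟨q, hq, hb⟩ := hb
    refine ⟨p * q, hp.mul hq, ?_⟩
    rw [map_add]
    refine add_mem ?_ ?_
    · rw [BRat.lmulInv_mul hp hq, BRat.lmulInv_comm]
      exact lmulInv_mem_lattice hq ρ ha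
    · rw [BRat.lmulInv_mul hp hq]
      exact lmulInv_mem_lattice hp ρ hb
  | tmul q w =>
    have key : ∀ (r : Bt ε τ) (s : invS ε τ) (q : BRat ε τ),
        q = (r /ₒ s : OreLocalization (invS ε τ) (Bt ε τ)) →
          BRat.num ε τ s * q = BRat.num ε τ r := by
      rintro r s _ rfl
      exact OreLocalization.mul_cancel
    have hq : ∃ (r : Bt ε τ) (s : invS ε τ), BRat.num ε τ s * q = BRat.num ε τ r := by
      revert q
      exact OreLocalization.ind fun r s => ⟨r, s, key r s _ rfl⟩
    obtain ⟨r, ⟨_, p, hp, rfl⟩, h⟩ := hq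
    refine ⟨p, hp, ?_⟩
    have h2 : BRat.lmulInv τ hp ρ (q ⊗ₜ w) = op r • ((1 : BRat ε τ) ⊗ₜ[MonoidAlgebra ℂ G] w) := by
      rw [BRat.lmulInv_tmul, h, smul_tmul', BRat.op_smul, one_mul]
    rw [h2]
    exact Submodule.smul_mem _ _ (Submodule.subset_span ⟨w, rfl⟩)

theorem BRat.lmulPoly_tmul {n : ℕ} (P : SemiInv ε n) (ρ ρ' : Representation ℂ G W)
    (hW : ∀ g w, ρ' g w = ((ε g ^ n : ℂˣ) : ℂ) • ρ g w) (q : BRat ε τ) (w : ρ.asModule) :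
    BRat.lmulPoly τ P ρ ρ' hW (q ⊗ₜ w) = (BRat.num ε τ (Bt.evalPoly ε τ P.poly) * q)
      ⊗ₜ[MonoidAlgebra ℂ G] ρ'.asModuleEquiv.symm (ρ.asModuleEquiv w) := rfl

theorem BRat.lmulInv_lmulPoly {p : Polynomial ℂ} (hp : IsInvPoly ε p) {n : ℕ} (P : SemiInv ε n)
    (ρ ρ' : Representation ℂ G W) (hW : ∀ g w, ρ' g w = ((ε g ^ n : ℂˣ) : ℂ) • ρ g w)
    (u : BRat ε τ ⊗[MonoidAlgebra ℂ G] ρ.asModule) :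
    BRat.lmulInv τ hp ρ' (BRat.lmulPoly τ P ρ ρ' hW u) =
      BRat.lmulPoly τ P ρ ρ' hW (BRat.lmulInv τ hp ρ u) := by
  induction u using TensorProduct.induction_on with
  | zero => simp only [map_zero]
  | add a b ha hb => simp only [map_add, ha, hb]
  | tmul a w =>
    rw [BRat.lmulPoly_tmul, BRat.lmulInv_tmul, BRat.lmulInv_tmul, BRat.lmulPoly_tmul, P.evalPoly_eq,
      ← mul_assoc, ← mul_assoc, ← map_mul, ← map_mul, ← map_mul, ← map_mul, mul_comm]

/-- If `A² = B²` on the lattice for normalized semiinvariant polynomials `A`, `B` of the same degree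
then `A = B` on `W ⊗ B_rat`. -/
theorem lmulPoly_eq_of_sq [Finite G] {n n' : ℕ} (A : SemiInv ε n) (B : SemiInv ε n') (hn : n' = n)
    (ρ₁ ρ₂ ρ₃ : Representation ℂ G W) (h₁ : ∀ g w, ρ₂ g w = ((ε g ^ n : ℂˣ) : ℂ) • ρ₁ g w)
    (h₂ : ∀ g w, ρ₃ g w = ((ε g ^ n : ℂˣ) : ℂ) • ρ₂ g w) (h₂')
    (h₃ h₃') (h : ∀ v ∈ lattice ε τ ρ₁, BRat.lmulPoly τ (A.mul A) ρ₁ ρ₃ h₃ v =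
      BRat.lmulPoly τ (B.mul B) ρ₁ ρ₃ h₃' v) (u : BRat ε τ ⊗[MonoidAlgebra ℂ G] ρ₂.asModule) :
    BRat.lmulPoly τ A ρ₂ ρ₃ h₂ u = BRat.lmulPoly τ B ρ₂ ρ₃ h₂' u := by
  subst hn
  have h' : ∀ v, BRat.lmulPoly τ (A.mul A) ρ₁ ρ₃ h₃ v = BRat.lmulPoly τ (B.mul B) ρ₁ ρ₃ h₃' v := by
    intro v
    -- The equality of squares extends from the lattice to all of `W ⊗ B_rat` by clearing an
    -- invariant denominator.
    obtain ⟨p, hp, hv⟩ := exists_lmulInv_mem_lattice ρ₁ v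
    apply BRat.lmulInv_injective hp ρ₃
    rw [BRat.lmulInv_lmulPoly, BRat.lmulInv_lmulPoly, h _ hv]
  -- The average of `A` and `B` is again normalized and semiinvariant, hence invertible on `W ⊗
  -- B_rat`. From `2 S (A - B) = A² - B² = 0` it follows that `A = B` as operators; they need not be
  -- equal as polynomials when `W = 0`.
  let S : SemiInv ε n' :=
    { poly := MvPolynomial.C (1 / 2 : ℂ) * (A.poly + B.poly)
      homog := by
        have := (MvPolynomial.isHomogeneous_C (Fin 2) (1 / 2 : ℂ)).mul (A.homog.add B.homog)
        rwa [zero_add] at this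
      semi := ⟨fun g => (ε g : ℂ) ^ n', fun g => by
        rw [map_mul, map_add, A.act, B.act, MvPolynomial.algHom_C]
        simp only [MvPolynomial.algebraMap_eq]
        ring⟩
      normalized := by
        rw [map_mul, map_add, A.normalized, B.normalized, MvPolynomial.eval_C]
        norm_num }
  obtain ⟨v, rfl⟩ := (BRat.lmulPoly_bijective (τ := τ) S ρ₁ ρ₂ h₁).2 u
  have h₄ : ∀ g w, ρ₃ g w = ((ε g ^ (n' + n') : ℂˣ) : ℂ) • ρ₁ g w := h₃
  rw [BRat.lmulPoly_comp S A (S.mul A) rfl ρ₁ ρ₂ ρ₃ h₁ h₂ h₄,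
    BRat.lmulPoly_comp S B (S.mul B) rfl ρ₁ ρ₂ ρ₃ h₁ h₂' h₄]
  -- The identity `2SA + B² = 2SB + A²`, kept free of subtraction because differences of normalized
  -- polynomials are not normalized.
  have key : ∀ v, BRat.lmulPoly τ (S.mul A) ρ₁ ρ₃ h₄ v + BRat.lmulPoly τ (S.mul A) ρ₁ ρ₃ h₄ v +
      BRat.lmulPoly τ (B.mul B) ρ₁ ρ₃ h₃' v = BRat.lmulPoly τ (S.mul B) ρ₁ ρ₃ h₄ v +
      BRat.lmulPoly τ (S.mul B) ρ₁ ρ₃ h₄ v + BRat.lmulPoly τ (A.mul A) ρ₁ ρ₃ h₃ v := by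
    intro v
    induction v using TensorProduct.induction_on with
    | zero => simp only [map_zero]
    | add a b ha hb =>
      simp only [map_add]
      have e : ∀ x x' y y' : BRat ε τ ⊗[MonoidAlgebra ℂ G] ρ₃.asModule,
          x + x' + (x + x') + (y + y') = x + x + y + (x' + x' + y') := fun x x' y y' => by abel
      rw [e, e, ha, hb]
    | tmul q w =>
      simp only [BRat.lmulPoly_tmul, ← add_tmul, ← add_mul, ← map_add]
      congr 4
      have hc : (MvPolynomial.C (1 / 2 : ℂ) : MvPolynomial (Fin 2) ℂ) + MvPolynomial.C (1 / 2) = 1 := by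
        rw [← map_add, ← MvPolynomial.C_1]
        norm_num
      show MvPolynomial.C (1 / 2 : ℂ) * (A.poly + B.poly) * A.poly +
        MvPolynomial.C (1 / 2 : ℂ) * (A.poly + B.poly) * A.poly + B.poly * B.poly =
        MvPolynomial.C (1 / 2 : ℂ) * (A.poly + B.poly) * B.poly +
        MvPolynomial.C (1 / 2 : ℂ) * (A.poly + B.poly) * B.poly + A.poly * A.poly
      linear_combination (A.poly ^ 2 - B.poly ^ 2) * hc
  have h2 := key v
  rw [h', add_left_inj] at h2
  have half : ∀ x : BRat ε τ ⊗[MonoidAlgebra ℂ G] ρ₃.asModule,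
      op (algebraMap ℂ (Bt ε τ) (1 / 2)) • (x + x) = x := fun x => by
    rw [smul_add, ← add_smul, ← MulOpposite.op_add, ← map_add, add_halves, map_one, op_one,
      one_smul]
  rw [← half (BRat.lmulPoly τ (S.mul A) ρ₁ ρ₃ h₄ v), h2, half]

end Denominators

end NCQuadric
end

noncomputable section

namespace NCQuadric

/-- Stated in an abstract category: it transports the relation between `ψ` and `ψ'` to graded
representatives along the chosen isomorphisms. -/
theorem comp_eq_of_isos {C : Type*} [Category C] {X A B E E' S T U : C} {σ : X ⟶ A} {g : X ⟶ B}
    (i : A ≅ E) (e : E ≅ E') (i' : B ≅ E') {ψ : E ⟶ S} {ψ' : E' ⟶ T} {f : A ⟶ S} {f' : B ⟶ T}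
    {a : S ⟶ U} {b : T ⟶ U} (hg : σ ≫ i.hom ≫ e.hom ≫ i'.inv = g) (hf : i.hom ≫ ψ = f)
    (hf' : i'.hom ≫ ψ' = f') (h : ψ ≫ a = e.hom ≫ ψ' ≫ b) : σ ≫ f ≫ a = g ≫ f' ≫ b := by
  rw [← hg, ← hf, ← hf']
  simp [h]

/-! ### Characters, twists, and powers of `P`. -/

section Twists

open Filter

theorem exists_large {p : ℤ × ℤ → Prop} (h : ∀ᶠ d in atTop, p d) (k : ℤ) :
    ∃ d : ℤ × ℤ, k ≤ d.1 ∧ k ≤ d.2 ∧ p d := by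
  obtain ⟨d, h1, h2⟩ := (h.and (eventually_ge_atTop (k, k))).exists
  exact ⟨d, h2.1, h2.2, h1⟩

variable {G : Type} [CommGroup G] {ε : G →* ℂˣ} {τ : MonoidAlgebra ℂ G}
variable {W : Type u} [AddCommGroup W] [Module ℂ W]

theorem twist_natCast (ρ : Representation ℂ G W) (n : ℕ) (g : G) (w : W) :
    twist ρ (ε ^ (n : ℤ)) g w = ((ε g ^ n : ℂˣ) : ℂ) • ρ g w := by
  show ((ε g ^ (n : ℤ) : ℂˣ) : ℂ) • ρ g w = _
  rw [zpow_natCast]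

theorem twist_neg (ρ : Representation ℂ G W) (n : ℕ) (g : G) (w : W) :
    ρ g w = ((ε g ^ n : ℂˣ) : ℂ) • twist ρ (ε ^ (-n : ℤ)) g w := by
  show ρ g w = ((ε g ^ n : ℂˣ) : ℂ) • ((ε g ^ (-n : ℤ) : ℂˣ) : ℂ) • ρ g w
  rw [smul_smul, ← Units.val_mul, zpow_neg, zpow_natCast, mul_inv_cancel, Units.val_one, one_smul]

theorem comp_char {ρ₁ ρ₂ ρ₃ : Representation ℂ G W} {a b : ℕ}
    (h₁ : ∀ g w, ρ₂ g w = ((ε g ^ a : ℂˣ) : ℂ) • ρ₁ g w)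
    (h₂ : ∀ g w, ρ₃ g w = ((ε g ^ b : ℂˣ) : ℂ) • ρ₂ g w) (g : G) (w : W) :
    ρ₃ g w = ((ε g ^ (a + b) : ℂˣ) : ℂ) • ρ₁ g w := by
  rw [h₂, h₁, smul_smul, ← Units.val_mul, pow_add, mul_comm]

variable [Finite G]

/-- Since `ε^|G| = 1`, twisting by `ε^((|G|-1)n)` undoes twisting by `ε^n`; this makes `P^(|G|-1)` a
map in the direction opposite to `P`. -/
theorem pred_char {ρ₁ ρ₂ : Representation ℂ G W} {n : ℕ}
    (h : ∀ g w, ρ₂ g w = ((ε g ^ n : ℂˣ) : ℂ) • ρ₁ g w) (g : G) (w : W) :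
    ρ₁ g w = ((ε g ^ ((Nat.card G - 1) * n) : ℂˣ) : ℂ) • ρ₂ g w := by
  rw [h, smul_smul, ← Units.val_mul, ← pow_add]
  have : (Nat.card G - 1) * n + n = Nat.card G * n := by
    rw [← Nat.succ_mul, Nat.succ_eq_add_one, Nat.sub_add_cancel Nat.card_pos]
  rw [this, pow_mul, pow_card_char, one_pow, Units.val_one, one_smul]

theorem card_char (ρ : Representation ℂ G W) (n : ℕ) (g : G) (w : W) :
    ρ g w = ((ε g ^ (Nat.card G * n) : ℂˣ) : ℂ) • ρ g w := by
  rw [pow_mul, pow_card_char, one_pow, Units.val_one, one_smul]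

/-- The invariant polynomial `P^|G|` factored as `P` followed by `P^(|G|-1)`: this gives the upper
bound in fatness, as `P u` lies in a lattice. -/
theorem lmulInv_pow_card {n : ℕ} (P : SemiInv ε n) (hf : IsInvPoly ε (P.dehom ^ Nat.card G))
    (ρ ρ' : Representation ℂ G W) (h : ∀ g w, ρ' g w = ((ε g ^ n : ℂˣ) : ℂ) • ρ g w)
    (u : BRat ε τ ⊗[MonoidAlgebra ℂ G] ρ.asModule) :
    BRat.lmulInv τ hf ρ u = BRat.lmulPoly τ (P.pow (Nat.card G - 1)) ρ' ρ (pred_char h)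
      (BRat.lmulPoly τ P ρ ρ' h u) := by
  rw [BRat.lmulPoly_comp P (P.pow (Nat.card G - 1)) (P.pow (Nat.card G)) ?_ ρ ρ' ρ h (pred_char h)
    (card_char ρ n)]
  · exact BRat.lmulInv_eq (P.pow (Nat.card G)) hf (map_pow _ _ _).symm ρ (card_char ρ n) u
  · show P.poly ^ Nat.card G = P.poly * P.poly ^ (Nat.card G - 1)
    rw [← pow_succ', Nat.sub_add_cancel Nat.card_pos]

/-- The factorization `P · P^|G| = P² · P^(|G|-1)`: this gives the lower bound in fatness, as `P²`
maps `F(-n)` into the sheaf. -/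
theorem lmulInv_pow_card' {n : ℕ} (P : SemiInv ε n) (hf : IsInvPoly ε (P.dehom ^ Nat.card G))
    (ρ₁ ρ ρ₂ : Representation ℂ G W) (h₁ : ∀ g w, ρ g w = ((ε g ^ n : ℂˣ) : ℂ) • ρ₁ g w)
    (h₂ : ∀ g w, ρ₂ g w = ((ε g ^ n : ℂˣ) : ℂ) • ρ g w)
    (u : BRat ε τ ⊗[MonoidAlgebra ℂ G] ρ.asModule) :
    BRat.lmulPoly τ P ρ ρ₂ h₂ (BRat.lmulInv τ hf ρ u) =
      BRat.lmulPoly τ (P.mul P) ρ₁ ρ₂ (comp_char h₁ h₂)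
        (BRat.lmulPoly τ (P.pow (Nat.card G - 1)) ρ ρ₁ (pred_char h₁) u) := by
  rw [BRat.lmulInv_eq (P.pow (Nat.card G)) hf (map_pow _ _ _).symm ρ (card_char ρ n) u,
    BRat.lmulPoly_comp (P.pow (Nat.card G)) P ((P.pow (Nat.card G)).mul P) rfl ρ ρ ρ₂
      (card_char ρ n) h₂ (comp_char (card_char ρ n) h₂),
    BRat.lmulPoly_comp (P.pow (Nat.card G - 1)) (P.mul P) ((P.pow (Nat.card G)).mul P) ?_ ρ ρ₁ ρ₂
      (pred_char h₁) (comp_char h₁ h₂) (comp_char (card_char ρ n) h₂)]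
  show P.poly ^ Nat.card G * P.poly = P.poly ^ (Nat.card G - 1) * (P.poly * P.poly)
  have h : P.poly ^ Nat.card G = P.poly ^ (Nat.card G - 1) * P.poly := by
    rw [← pow_succ, Nat.sub_add_cancel Nat.card_pos]
  rw [h, mul_assoc]

end Twists

/-! ### The submodule of a trivialized sheaf is fat. -/

section Fat

open Filter

variable {G : Type} [CommGroup G] [Finite G] {ε : G →* ℂˣ} {τ : MonoidAlgebra ℂ G}
variable {W : Type u} [AddCommGroup W] [Module ℂ W] [FiniteDimensional ℂ W]
variable {ρ : Representation ℂ G W}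

theorem Triv.isFat (t : Triv.{u} ε τ ρ) : IsFat ε τ t.toSubmodule := by
  obtain ⟨M, e, f, hef, hf⟩ := t.exists_presentation
  have hinv := t.P.isInvPoly (k := Nat.card G) fun g => by rw [pow_mul, pow_card_char, one_pow]
  -- The polynomial `P(x,1)` itself is only semiinvariant; its power with exponent `|G|` is an
  -- invariant denominator.
  refine ⟨t.P.dehom ^ Nat.card G, hinv, ?_, ?_⟩
  · rintro _ ⟨l, hl, rfl⟩
    rw [t.mem_toSubmodule e f hef (twist_natCast ρ t.n)]
    rw [lmulInv_pow_card' t.P hinv _ ρ _ (twist_neg ρ t.n) (twist_natCast ρ t.n)]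
    obtain ⟨x, hx⟩ := exists_toRat_eq (lmulPoly_mem_lattice (t.P.pow (Nat.card G - 1)) ρ _
      (pred_char (twist_neg ρ t.n)) hl)
    -- `P² F(-n)` lies in the image of `f` only in large bidegrees, so a representative is moved
    -- there without changing its value at `z = w = 1`.
    obtain ⟨k, hk⟩ := exists_homogeneous_toRat (𝟙 (shiftMod ε τ ρ (-t.n))) x
    obtain ⟨d, h1, h2, h3⟩ := exists_large hf.sq_mem k
    obtain ⟨x', hx', e'⟩ := hk d h1 h2
    obtain ⟨m, hm⟩ := h3 x' hx'
    refine ⟨m, ?_⟩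
    rw [hm, ← hx]
    refine (toRat_lmulPoly _ _ _ _ _).trans ?_
    exact congrArg _ e'
  · intro u hu
    obtain ⟨m, hm⟩ := (t.mem_toSubmodule e f hef (twist_natCast ρ t.n) u).mp hu
    show BRat.lmulInv τ hinv ρ u ∈ lattice ε τ ρ
    rw [lmulInv_pow_card t.P hinv ρ _ (twist_natCast ρ t.n), ← hm]
    exact lmulPoly_mem_lattice _ _ _ _ (toRat_mem_lattice _ _)

end Fat

/-! ### Equivalent trivializations give the same submodule. -/

section WellDefined

open Filter

variable {G : Type} [CommGroup G] [Finite G] {ε : G →* ℂˣ} {τ : MonoidAlgebra ℂ G}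
variable {W : Type u} [AddCommGroup W] [Module ℂ W] [FiniteDimensional ℂ W]
variable {ρ : Representation ℂ G W}

theorem Triv.toSubmodule_le_of_equivalent {s t : Triv.{u} ε τ ρ} (h : s.Equivalent t) :
    s.toSubmodule ≤ t.toSubmodule := by
  obtain ⟨e, k, l, N, q, r, h₁, h₂, e₁, e₂⟩ := h
  obtain ⟨M, i, f, hif, hf⟩ := s.exists_presentation
  obtain ⟨M', i', f', hif', hf'⟩ := t.exists_presentation
  have hs : (N : ℤ) = s.n + k := by rw [h₁]; push_cast; ring
  have ht : (N : ℤ) = t.n + l := by rw [h₂]; push_cast; ring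
  let A := s.P.mul q
  let B := t.P.mul r
  -- Both `(Pq)²` and `(P'r)²` are the composite `q ∘ ψ ∘ φ ∘ q`, transported by `e`. Equivalence
  -- gives no direct relation between `Pq` and `P'r`, so one is obtained from the squares.
  have hsq : mulPoly τ (A.mul A) ρ (-N) N (by push_cast; omega) =
      mulPoly τ (B.mul B) ρ (-N) N (by push_cast; omega) := by
    rw [← mulPoly_comp q (s.P.mul A) (A.mul A)
        (by show s.P.poly * q.poly * (s.P.poly * q.poly) = q.poly * (s.P.poly * (s.P.poly * q.poly))
            ring) (-N) (-s.n) N (by omega) (by push_cast; omega),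
      ← mulPoly_comp (s.P.mul s.P) q (s.P.mul A)
        (by show s.P.poly * (s.P.poly * q.poly) = s.P.poly * s.P.poly * q.poly; ring)
        (-s.n) s.n N (by push_cast; omega) hs, ← s.comp,
      ← mulPoly_comp r (t.P.mul B) (B.mul B)
        (by show t.P.poly * r.poly * (t.P.poly * r.poly) = r.poly * (t.P.poly * (t.P.poly * r.poly))
            ring) (-N) (-t.n) N (by omega) (by push_cast; omega),
      ← mulPoly_comp (t.P.mul t.P) r (t.P.mul B)
        (by show t.P.poly * (t.P.poly * r.poly) = t.P.poly * t.P.poly * r.poly; ring)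
        (-t.n) t.n N (by push_cast; omega) ht, ← t.comp, Category.assoc, Category.assoc, e₂]
    have := congrArg (fun x => x ≫ t.ψ ≫ mulPoly τ r ρ t.n N ht) e₁
    simpa only [Category.assoc] using this
  replace hsq := piFun_map_eq_iff.mp hsq
  have hA := comp_char (twist_natCast (ε := ε) ρ s.n) (twist_shift ε ρ hs)
  have hB := comp_char (twist_natCast (ε := ε) ρ t.n) (twist_shift ε ρ ht)
  have hAB : ∀ u, BRat.lmulPoly τ A ρ (twist ρ (ε ^ (N : ℤ))) hA u = BRat.lmulPoly τ B ρ _ hB u := by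
    refine lmulPoly_eq_of_sq A B (by omega) (twist ρ (ε ^ (-N : ℤ))) ρ _ ?_ hA hB
      (twist_shift ε ρ (by push_cast; omega)) (twist_shift ε ρ (by push_cast; omega)) fun v hv => ?_
    · rw [← h₁]; exact twist_neg ρ N
    · obtain ⟨x, hx⟩ := exists_toRat_eq hv
      obtain ⟨k, hk⟩ := exists_homogeneous_toRat (𝟙 (shiftMod ε τ ρ (-N))) x
      obtain ⟨d, h1, h2, h3⟩ := exists_large hsq k
      obtain ⟨x', hx', e'⟩ := hk d h1 h2
      have h4 := congrArg (toRat ε τ _) (h3 x' hx')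
      replace e' : toRat ε τ _ x' = toRat ε τ _ x := e'
      have h5 := (toRat_lmulPoly _ _ _ _ _).symm.trans (h4.trans (toRat_lmulPoly _ _ _ _ _))
      rwa [e', hx] at h5
  -- A fraction representing the isomorphism of the sheaves shows that, in large bidegrees, the
  -- image of `q f` is contained in that of `r f'`.
  have hle : ∀ᶠ d in atTop, ∀ m ∈ M.gr d, ∃ m', (shiftMul ε τ ρ r t.n N ht).lin (f'.lin m') =
      (shiftMul ε τ ρ q s.n N hs).lin (f.lin m) := by
    obtain ⟨X, σ, g, hσ, hg⟩ := exists_roof (i.hom ≫ e.hom ≫ i'.inv)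
    have h3 : (piFun ε τ).map (σ ≫ f ≫ shiftMul ε τ ρ q s.n N hs) =
        (piFun ε τ).map (g ≫ f' ≫ shiftMul ε τ ρ r t.n N ht) := by
      rw [Functor.map_comp, Functor.map_comp, Functor.map_comp, Functor.map_comp]
      exact comp_eq_of_isos i e i' hg hif hif' e₂
    rw [piFun_map_eq_iff] at h3
    filter_upwards [h3, (torIso_iff.mp hσ).2] with d h3 h4 m hm
    obtain ⟨x, hx, rfl⟩ := torIso.surj_deg σ hm (h4 m hm)
    exact ⟨g.lin x, (h3 x hx).symm⟩
  intro u hu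
  obtain ⟨m, hm⟩ := (s.mem_toSubmodule i f hif (twist_natCast ρ s.n) u).mp hu
  obtain ⟨k', hk⟩ := exists_homogeneous_toRat f m
  obtain ⟨d, h3, h4, h5⟩ := exists_large hle k'
  obtain ⟨x, hx, hxm⟩ := hk d h3 h4
  obtain ⟨m', hm'⟩ := h5 x hx
  refine (t.mem_toSubmodule i' f' hif' (twist_natCast ρ t.n) u).mpr ⟨m', ?_⟩
  -- After multiplication by the invertible `r`, the claim is `r f'(m') = r P' u = q P u = q f(m)`,
  -- where the middle equality is `hAB`.
  apply (BRat.lmulPoly_bijective r _ _ (twist_shift ε ρ ht)).1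
  rw [BRat.lmulPoly_comp t.P r B rfl _ _ _ (twist_natCast ρ t.n) (twist_shift ε ρ ht) hB, ← hAB,
    ← BRat.lmulPoly_comp s.P q A rfl _ _ _ (twist_natCast ρ s.n) (twist_shift ε ρ hs) hA, ← hm,
    ← hxm, ← toRat_lmulPoly, ← toRat_lmulPoly]
  exact congrArg _ hm'

theorem Triv.toSubmodule_eq_of_equivalent {s t : Triv.{u} ε τ ρ} (h : s.Equivalent t) :
    s.toSubmodule = t.toSubmodule :=
  le_antisymm (toSubmodule_le_of_equivalent h)
    (toSubmodule_le_of_equivalent (Triv.equivalent_equivalence.symm h))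

end WellDefined

end NCQuadric
end

noncomputable section

namespace NCQuadric

/-! ### The class is determined by its submodule. -/

section Injectivity

open Filter

variable {G : Type} [CommGroup G] {ε : G →* ℂˣ} {τ : MonoidAlgebra ℂ G}

/-- The bound on bidegrees is uniform in `k`, because multiplication by `z` and `w` only increases
the bidegree. -/
theorem Saturated.pow {M F : GrMod.{u} ε τ} {f : M ⟶ F} (hz : Saturated (Qu.z ε τ) f)
    (hw : Saturated (Qu.w ε τ) f) : ∀ᶠ d in atTop, ∀ (k : ℕ), ∀ v ∈ F.gr d,
      op ((Qu.z ε τ * Qu.w ε τ) ^ k) • v ∈ LinearMap.range f.lin → v ∈ LinearMap.range f.lin := by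
  obtain ⟨c, hc⟩ := eventually_bidegree.mp (hz.and hw)
  refine eventually_bidegree.mpr ⟨c, fun d h1 h2 k => ?_⟩
  induction k generalizing d with
  | zero => intro v _ h; rwa [pow_zero, op_one, one_smul] at h
  | succ k ih =>
    intro v hv h
    rw [pow_succ', op_mul, op_mul, mul_smul, mul_smul] at h
    have hz' := F.smul_mem Qu.z_mem hv
    have h1' : c < (d + (1, 0)).1 := by rw [Prod.fst_add]; show c < d.1 + 1; omega
    have h2' : c < (d + (1, 0)).2 := by rw [Prod.snd_add]; show c < d.2 + 0; omega
    have h1'' : c < (d + (1, 0) + (0, 1)).1 := by rw [Prod.fst_add]; show c < (d + (1, 0)).1 + 0; omega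
    have h2'' : c < (d + (1, 0) + (0, 1)).2 := by rw [Prod.snd_add]; show c < (d + (1, 0)).2 + 1; omega
    exact (hc d h1 h2).1 v hv ((hc _ h1' h2').2 _ hz'
      (ih _ h1'' h2'' _ (F.smul_mem Qu.w_mem hz') h))

variable [Finite G]
variable {W : Type u} [AddCommGroup W] [Module ℂ W] [FiniteDimensional ℂ W]
variable {ρ : Representation ℂ G W}

/-- If `P f(m) = g v`, regularity of `P` modulo `g` gives `f(m) = g u`; saturation puts `u` in the
image of `f`, and cancelling `g` gives `v = P u`. -/
theorem Saturated.comp_shiftMul {M : GrMod.{u} ε τ} {n : ℤ} {f : M ⟶ shiftMod ε τ ρ n}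
    {g : Qu ε τ} {e : ℤ × ℤ} (he : g ∈ Qu.grading ε τ e)
    (hθ : theta ε τ g = 1) (hs : Saturated g f) {k : ℕ} (P : SemiInv ε k) (N : ℤ) (h : N = n + k)
    (hreg : ∀ u v, (shiftMul ε τ ρ P n N h).lin u = op g • v → ∃ u', u = op g • u') :
    Saturated g (f ≫ shiftMul ε τ ρ P n N h) := by
  filter_upwards [hs] with d hd v hv hr
  obtain ⟨m, hm, hmv⟩ := torIso.surj_deg _ (GrMod.smul_mem _ he hv) hr
  replace hmv : (shiftMul ε τ ρ P n N h).lin (f.lin m) = op g • v := hmv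
  obtain ⟨u, hu⟩ := hreg _ _ hmv
  have hproj : (shiftMod ε τ ρ n).proj (d + e) (f.lin m) = f.lin m := by
    rw [GrMod.proj_of_mem_gen _ _ _ (f.map_gr hm), if_pos rfl]
  have h1 : op g • (shiftMod ε τ ρ n).proj d u = f.lin m := by
    rw [← hproj, hu, GrMod.proj_rmul _ he,
      add_sub_cancel_right]
  obtain ⟨m', hm'⟩ := hd _ (GrMod.proj_mem _ d u) ⟨m, h1.symm⟩
  refine ⟨m', free_smul_injective _ he hθ ?_⟩
  show op g • (shiftMul ε τ ρ P n N h).lin (f.lin m') = op g • v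
  rw [hm', ← map_smul, h1, hmv]

/-- If `v = P' f(m)` and `f(m) = P u`, then `u` lies in the first submodule, hence `P' u = f'(m')`
and `v = P f'(m')` at `z = w = 1`. Some `(zw)^k v` is then in the image of `P f'`, and saturation
removes the factor. -/
theorem eventually_range_le {n n' : ℕ} {P : SemiInv ε n} {P' : SemiInv ε n'} {M M' : GrMod.{u} ε τ}
    {f : M ⟶ shiftMod ε τ ρ n} {f' : M' ⟶ shiftMod ε τ ρ n'} (hf' : IsPresentation P' f')
    (h : ∀ u, (∃ m, toRat ε τ _ (f.lin m) =
        BRat.lmulPoly τ P ρ (twist ρ (ε ^ (n : ℤ))) (twist_natCast ρ n) u) →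
      ∃ m, toRat ε τ _ (f'.lin m) =
        BRat.lmulPoly τ P' ρ (twist ρ (ε ^ (n' : ℤ))) (twist_natCast ρ n') u)
    (N : ℤ) (hn : N = n + n') (hn' : N = n' + n) :
    ∀ᶠ d in atTop, ∀ v ∈ (shiftMod ε τ ρ N).gr d,
      v ∈ LinearMap.range (f ≫ shiftMul ε τ ρ P' n N hn).lin →
      v ∈ LinearMap.range (f' ≫ shiftMul ε τ ρ P n' N hn').lin := by
  have hz := hf'.z_sat.comp_shiftMul Qu.z_mem (theta_gen ε τ .z) P N hn'
    (fun u v h => lmulPoly_z_regular _ _ _ _ h)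
  have hw := hf'.w_sat.comp_shiftMul Qu.w_mem (theta_gen ε τ .w) P N hn'
    (fun u v h => lmulPoly_w_regular _ _ _ _ h)
  filter_upwards [hz.pow hw] with d hd v hv ⟨m, hm⟩
  replace hm : (shiftMul ε τ ρ P' n N hn).lin (f.lin m) = v := hm
  obtain ⟨u, hu⟩ := (BRat.lmulPoly_bijective P ρ _ (twist_natCast ρ n)).2 (toRat ε τ _ (f.lin m))
  obtain ⟨m', hm'⟩ := h u ⟨m, hu.symm⟩
  have h1 : toRat ε τ _ ((f' ≫ shiftMul ε τ ρ P n' N hn').lin m') = toRat ε τ _ v := by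
    rw [← hm]
    refine (toRat_lmulPoly P _ _ (twist_shift ε ρ hn') _).trans ?_
    refine Eq.trans ?_ (toRat_lmulPoly P' _ _ (twist_shift ε ρ hn) _).symm
    rw [hm', ← hu, BRat.lmulPoly_comp P P' (P.mul P') rfl _ _ _ _ _
      (comp_char (twist_natCast ρ n) (twist_shift ε ρ hn)),
      BRat.lmulPoly_comp P' P (P.mul P') (mul_comm _ _)]
  obtain ⟨c, hc⟩ := exists_homogeneous_toRat (f' ≫ shiftMul ε τ ρ P n' N hn') m'
  -- Large enough for a homogeneous representative of bidegree `d + (k,k)` to exist. That is the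
  -- bidegree of `(zw)^k v`, so injectivity of `toRat` on components applies.
  let k : ℕ := (max (c - d.1) (c - d.2)).toNat
  obtain ⟨m₁, hm₁, h2⟩ := hc (d + ((k : ℤ), (k : ℤ))) (by rw [Prod.fst_add]; show c ≤ d.1 + k; omega)
    (by rw [Prod.snd_add]; show c ≤ d.2 + k; omega)
  refine hd k v hv ⟨m₁, ?_⟩
  have hv' := (shiftMod ε τ ρ N).smul_mem (Qu.zw_pow_mem k) hv
  refine toRat_injOn ((f' ≫ shiftMul ε τ ρ P n' N hn').map_gr hm₁) hv' ?_
  rw [h2, h1, toRat_smul]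
  rw [map_pow, map_mul]
  have e1 : theta ε τ (Qu.z ε τ) = 1 := theta_gen ε τ .z
  have e2 : theta ε τ (Qu.w ε τ) = 1 := theta_gen ε τ .w
  rw [e1, e2, mul_one, one_pow, op_one, one_smul]

theorem shiftMul_injective {k : ℕ} (P : SemiInv ε k) (a b : ℤ) (h : b = a + k) {d : ℤ × ℤ}
    {v : (shiftMod ε τ ρ a).carrier} (hv : v ∈ (shiftMod ε τ ρ a).gr d)
    (h0 : (shiftMul ε τ ρ P a b h).lin v = 0) : v = 0 := by
  refine toRat_eq_zero hv ((BRat.lmulPoly_bijective P _ _ (twist_shift ε ρ h)).1 ?_)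
  rw [← toRat_lmulPoly, map_zero]
  exact (congrArg (toRat ε τ _) h0).trans (map_zero _)

theorem mono_mulPoly {k : ℕ} (P : SemiInv ε k) (a b : ℤ) (h : b = a + k) :
    Mono (mulPoly τ P ρ a b h) :=
  mono_piFun_iff.mpr (Eventually.of_forall fun _ _ hv => shiftMul_injective P a b h hv)

theorem comp_eq_of_iso {C : Type*} [Category C] {A A' E E' S T U : C} (i : A ≅ E) (i' : A' ≅ E')
    (e : A ≅ A') {ψ : E ⟶ S} {ψ' : E' ⟶ T} {f : A ⟶ S} {f' : A' ⟶ T} {a : S ⟶ U} {b : T ⟶ U}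
    (hf : i.hom ≫ ψ = f) (hf' : i'.hom ≫ ψ' = f') (h : e.hom ≫ f' ≫ b = f ≫ a) :
    ψ ≫ a = (i.symm ≪≫ e ≪≫ i').hom ≫ ψ' ≫ b := by
  subst hf hf'
  simp only [Category.assoc] at h
  simp [h]

theorem comp_eq_of_mono {C : Type*} [Category C] {E E' R S T U V X : C} {e : E ⟶ E'} {ψ : E ⟶ S}
    {ψ' : E' ⟶ T} {φ : R ⟶ E} {φ' : X ⟶ E'} {a : S ⟶ U} {b : T ⟶ U} {q : V ⟶ R} {r : V ⟶ X}
    [Mono ψ'] [Mono b] (h : ψ ≫ a = e ≫ ψ' ≫ b)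
    (h' : q ≫ (φ ≫ ψ) ≫ a = r ≫ (φ' ≫ ψ') ≫ b) : q ≫ φ ≫ e = r ≫ φ' := by
  rw [← cancel_mono ψ', ← cancel_mono b]
  simp only [Category.assoc] at h' ⊢
  rw [← h, h']

theorem Triv.equivalent_of_toSubmodule_eq {s t : Triv.{u} ε τ ρ}
    (h : s.toSubmodule = t.toSubmodule) : s.Equivalent t := by
  obtain ⟨M, i, f, hif, hf⟩ := s.exists_presentation
  obtain ⟨M', i', f', hif', hf'⟩ := t.exists_presentation
  have hs : ((s.n + t.n : ℕ) : ℤ) = s.n + t.n := Nat.cast_add _ _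
  have ht : ((s.n + t.n : ℕ) : ℤ) = t.n + s.n := by push_cast; ring
  have key : ∀ u, (∃ m, toRat ε τ _ (f.lin m) = BRat.lmulPoly τ s.P ρ _ (twist_natCast ρ s.n) u) ↔
      ∃ m, toRat ε τ _ (f'.lin m) = BRat.lmulPoly τ t.P ρ _ (twist_natCast ρ t.n) u := fun u => by
    rw [← s.mem_toSubmodule i f hif, ← t.mem_toSubmodule i' f' hif', h]
  obtain ⟨e, he⟩ := exists_iso_of_range
    (f ≫ shiftMul ε τ ρ t.P s.n (s.n + t.n : ℕ) hs) (f' ≫ shiftMul ε τ ρ s.P t.n _ ht)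
    (hf.inj.mono fun d hd m hm h0 => hd m hm (shiftMul_injective _ _ _ hs (f.map_gr hm) h0))
    (hf'.inj.mono fun d hd m hm h0 => hd m hm (shiftMul_injective _ _ _ ht (f'.map_gr hm) h0))
    (by
      filter_upwards [eventually_range_le hf' (fun u => (key u).mp) _ hs ht,
        eventually_range_le hf (fun u => (key u).mpr) _ ht hs] with d h1 h2 v hv
      exact ⟨h1 v hv, h2 v hv⟩)
  rw [Functor.map_comp, Functor.map_comp] at he
  have h₂ : s.ψ ≫ mulPoly τ t.P ρ s.n (s.n + t.n : ℕ) hs =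
    (i.symm ≪≫ e ≪≫ i').hom ≫ t.ψ ≫ mulPoly τ s.P ρ t.n _ ht := comp_eq_of_iso i i' e hif hif' he
  have := t.mono_ψ
  have := mono_mulPoly (τ := τ) (ρ := ρ) s.P t.n _ ht
  -- The polynomials of the equivalence are the denominators exchanged, `q = P'` and `q' = P`. The
  -- relation for `ψ` comes from equality of images in large bidegrees.
  refine ⟨i.symm ≪≫ e ≪≫ i', t.n, s.n, s.n + t.n, t.P, s.P, rfl, Nat.add_comm _ _, ?_, h₂⟩
  -- The relation for `φ` follows by cancelling the monomorphisms `ψ'` and `P`: both sides then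
  -- become multiplication by `(P P')²`.
  refine comp_eq_of_mono h₂ ?_
  rw [s.comp, t.comp,
    mulPoly_comp (s.P.mul s.P) t.P ((s.P.mul s.P).mul t.P) rfl _ _ _ _ _ (by push_cast; ring),
    mulPoly_comp (t.P.mul t.P) s.P ((t.P.mul t.P).mul s.P) rfl _ _ _ _ _ (by push_cast; ring),
    mulPoly_comp t.P _ ((s.P.mul t.P).mul (s.P.mul t.P)) ?_ _ _ _ _ _ (by push_cast; ring),
    mulPoly_comp s.P _ ((s.P.mul t.P).mul (s.P.mul t.P)) ?_ _ _ _ _ _ (by push_cast; ring)]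
  · show s.P.poly * t.P.poly * (s.P.poly * t.P.poly) = s.P.poly * (t.P.poly * t.P.poly * s.P.poly)
    ring
  · show s.P.poly * t.P.poly * (s.P.poly * t.P.poly) = t.P.poly * (s.P.poly * s.P.poly * t.P.poly)
    ring

end Injectivity

end NCQuadric
end

noncomputable section

namespace NCQuadric

/-! ### Invariant polynomials in `x` as semiinvariants in `x, z`. -/

section Homogenization

open Polynomial

variable {G : Type} [CommGroup G] {ε : G →* ℂˣ}

/-- Compare leading coefficients in `p(ε(g)x) = p(x)`. Consequently the twists by `ε` to the power
`natDegree p` are trivial. -/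
theorem IsInvPoly.char_pow {p : ℂ[X]} (hp : IsInvPoly ε p) (g : G) : ε g ^ p.natDegree = 1 := by
  have h := congrArg (fun q => q.coeff p.natDegree) (hp.2 g)
  simp only [comp_C_mul_X_coeff, coeff_natDegree] at h
  have h0 : p.leadingCoeff ≠ 0 := leadingCoeff_ne_zero.mpr hp.1
  refine Units.ext ?_
  rw [Units.val_pow_eq_pow_val, Units.val_one]
  exact mul_left_cancel₀ h0 (h.trans (mul_one _).symm)

/-- The homogenization of a monic invariant polynomial. -/
def IsInvPoly.semiInv {p : ℂ[X]} (hp : IsInvPoly ε p) (hm : p.Monic) :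
    SemiInv ε p.natDegree where
  poly := p.homogenize p.natDegree
  homog := isHomogeneous_homogenize p
  semi := by
    refine ⟨fun _ => 1, fun g => ?_⟩
    rw [MvPolynomial.C_1, one_mul]
    refine (homogenize_eq_of_isHomogeneous ?_ ?_).symm
    · have h := (isHomogeneous_homogenize (n := p.natDegree) p).aeval
        (![MvPolynomial.C (ε g : ℂ) * MvPolynomial.X 0, MvPolynomial.X 1] :
          Fin 2 → MvPolynomial (Fin 2) ℂ) (n := 1) (by
        intro i
        fin_cases i
        · exact MvPolynomial.isHomogeneous_C_mul_X _ _
        · exact MvPolynomial.isHomogeneous_X _ _)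
      rwa [one_mul] at h
    · have h : (MvPolynomial.aeval ![(X : ℂ[X]), 1]).comp (polyAct ε g) =
          MvPolynomial.aeval ![C (ε g : ℂ) * X, 1] := by
        apply MvPolynomial.algHom_ext
        intro i
        fin_cases i
        · simp [polyAct]
        · simp [polyAct]
      have h2 := congrArg (fun f => f (p.homogenize p.natDegree)) h
      refine h2.trans ((aeval_homogenize_of_eq_one le_rfl _ rfl).trans ?_)
      exact hp.2 g
  normalized := by
    rw [homogenize, map_sum, Finset.sum_eq_single (p.natDegree, 0)]
    · simpa [MvPolynomial.eval_monomial, Finsupp.prod_fintype] using hm.leadingCoeff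
    · rintro ⟨a, b⟩ hab hne
      have hb : b ≠ 0 := by
        rintro rfl
        exact hne (Prod.ext (by simpa using hab) rfl)
      simp [MvPolynomial.eval_monomial, Finsupp.prod_fintype, hb]
    · simp

theorem IsInvPoly.semiInv_dehom {p : ℂ[X]} (hp : IsInvPoly ε p) (hm : p.Monic) :
    (hp.semiInv hm).dehom = p := aeval_homogenize_X_one p le_rfl

end Homogenization

/-! ### Homogeneous denominators of fat submodules. -/

section Lattice

open Filter Polynomial

variable {G : Type} [CommGroup G] {ε : G →* ℂˣ} {τ : MonoidAlgebra ℂ G}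
variable {W : Type u} [AddCommGroup W] [Module ℂ W]
variable {ρ : Representation ℂ G W}

/-- The denominator of a fat submodule may be taken monic. -/
theorem IsFat.exists_monic
    {N : Submodule (Bt ε τ)ᵐᵒᵖ (BRat ε τ ⊗[MonoidAlgebra ℂ G] ρ.asModule)} (hN : IsFat ε τ N) :
    ∃ (p : ℂ[X]) (hp : IsInvPoly ε p), p.Monic ∧
      (∀ l ∈ lattice ε τ ρ, BRat.lmulInv τ hp ρ l ∈ N) ∧
      ∀ u ∈ N, BRat.lmulInv τ hp ρ u ∈ lattice ε τ ρ := by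
  obtain ⟨p, hp, h1, h2⟩ := hN
  have hc : IsInvPoly ε (C p.leadingCoeff⁻¹) :=
    ⟨C_ne_zero.mpr (inv_ne_zero (leadingCoeff_ne_zero.mpr hp.1)), fun g => C_comp⟩
  refine ⟨_, hp.mul hc, monic_mul_leadingCoeff_inv hp.1, fun l hl => ?_, fun u hu => ?_⟩
  · rw [BRat.lmulInv_mul hp hc]
    exact h1 ⟨_, lmulInv_mem_lattice hc ρ hl, rfl⟩
  · rw [BRat.lmulInv_mul hp hc, BRat.lmulInv_comm]
    exact lmulInv_mem_lattice hc ρ (h2 hu)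

/-- A fat submodule lies between `P (W ⊗ B)` and `P⁻¹ (W ⊗ B)` for a normalized semiinvariant
polynomial `P`. -/
theorem IsFat.exists_semiInv
    {N : Submodule (Bt ε τ)ᵐᵒᵖ (BRat ε τ ⊗[MonoidAlgebra ℂ G] ρ.asModule)} (hN : IsFat ε τ N) :
    ∃ (n : ℕ) (P : SemiInv ε n),
      (∀ l ∈ lattice ε τ (twist ρ (ε ^ (-n : ℤ))),
        BRat.lmulPoly τ P (twist ρ (ε ^ (-n : ℤ))) ρ (twist_neg ρ n) l ∈ N) ∧
      ∀ u ∈ N, BRat.lmulPoly τ P ρ (twist ρ (ε ^ (n : ℤ))) (twist_natCast ρ n) u ∈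
        lattice ε τ (twist ρ (ε ^ (n : ℤ))) := by
  obtain ⟨p, hp, hm, h1, h2⟩ := hN.exists_monic
  -- The twists by `ε^(±n)` act as `ρ` but are different terms. Multiplication by the constant `1`,
  -- of degree `0`, identifies the corresponding lattices.
  have h (g : G) (w : W) : ρ g w = ((ε g ^ p.natDegree : ℂˣ) : ℂ) • ρ g w := by
    rw [hp.char_pow, Units.val_one, one_smul]
  have e1 (g : G) (w : W) : ρ g w = ((ε g ^ 0 : ℂˣ) : ℂ) •
      twist ρ (ε ^ (-p.natDegree : ℤ)) g w := by
    rw [twist_neg ρ p.natDegree, hp.char_pow, pow_zero]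
  have e2 (g : G) (w : W) : twist ρ (ε ^ (p.natDegree : ℤ)) g w =
      ((ε g ^ 0 : ℂˣ) : ℂ) • ρ g w := by
    rw [twist_natCast, hp.char_pow, pow_zero]
  refine ⟨p.natDegree, hp.semiInv hm, fun l hl => ?_, fun u hu => ?_⟩
  · rw [← BRat.lmulPoly_comp (SemiInv.one ε) (hp.semiInv hm) (hp.semiInv hm) (one_mul _).symm
      _ ρ ρ e1 h, ← BRat.lmulInv_eq _ hp (hp.semiInv_dehom hm).symm ρ h]
    exact h1 _ (lmulPoly_mem_lattice _ _ _ e1 hl)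
  · rw [← BRat.lmulPoly_comp (hp.semiInv hm) (SemiInv.one ε) (hp.semiInv hm) (mul_one _).symm
      ρ ρ _ h e2, ← BRat.lmulInv_eq _ hp (hp.semiInv_dehom hm).symm ρ h]
    exact lmulPoly_mem_lattice _ _ _ e2 (h2 u hu)

end Lattice

/-! ### Graded submodules cut out by a submodule of `W ⊗ B_rat`. -/

section Closure

variable {G : Type} [CommGroup G] {ε : G →* ℂˣ} {τ : MonoidAlgebra ℂ G}
variable {W : Type u} [AddCommGroup W] [Module ℂ W] [FiniteDimensional ℂ W]
variable {ρ : Representation ℂ G W}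

/-- The largest graded submodule of `W ⊗ Q(s)` whose restriction to the affine plane lies in
`K`. -/
def gradedClosure (s : ℤ × ℤ)
    (K : Submodule (Bt ε τ)ᵐᵒᵖ (BRat ε τ ⊗[MonoidAlgebra ℂ G] ρ.asModule)) :
    Submodule (Qu ε τ)ᵐᵒᵖ (freeMod ε τ ρ s).carrier where
  carrier := {m | ∀ d, toRat ε τ ρ ((freeMod ε τ ρ s).proj d m) ∈ K}
  add_mem' ha hb d := by
    rw [map_add, map_add]
    exact add_mem (ha d) (hb d)
  zero_mem' d := by
    rw [map_zero, map_zero]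
    exact zero_mem _
  smul_mem' q m hm := by
    have hom {q : Qu ε τ} {e : ℤ × ℤ} (hq : q ∈ Qu.grading ε τ e) (m : (freeMod ε τ ρ s).carrier)
        (hm : ∀ d, toRat ε τ ρ ((freeMod ε τ ρ s).proj d m) ∈ K) (d : ℤ × ℤ) :
        toRat ε τ ρ ((freeMod ε τ ρ s).proj d (op q • m)) ∈ K := by
      rw [GrMod.proj_rmul _ hq]
      refine (congrArg (· ∈ K) (toRat_smul ε τ ρ q _)).mpr ?_
      exact K.smul_mem _ (hm _)
    obtain ⟨q, rfl⟩ := op_surjective q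
    induction q using Qu.gen_induction generalizing m with
    | hs c => exact hom (Qu.algebraMap_mem c) m hm
    | hg t => exact hom (Qu.gen_mem ε τ t) m hm
    | hm a b ha hb =>
      rw [op_mul, mul_smul]
      exact hb _ (ha _ hm)
    | ha a b ha hb =>
      intro d
      rw [MulOpposite.op_add, add_smul, map_add, map_add]
      exact add_mem (ha _ hm d) (hb _ hm d)

variable {s : ℤ × ℤ} {K : Submodule (Bt ε τ)ᵐᵒᵖ (BRat ε τ ⊗[MonoidAlgebra ℂ G] ρ.asModule)}

theorem proj_mem_gradedClosure (d : ℤ × ℤ) (m) (hm : m ∈ gradedClosure s K) :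
    (freeMod ε τ ρ s).proj d m ∈ gradedClosure s K := fun e => by
  rw [GrMod.proj_of_mem_gen _ _ _ (GrMod.proj_mem _ d m)]
  split_ifs
  · exact hm d
  · rw [map_zero]; exact zero_mem _

/-- On homogeneous elements, membership is a condition on the value at `z = w = 1` only. Saturation
under `z` and `w` is then automatic. -/
theorem mem_gradedClosure_iff {d : ℤ × ℤ} {m : (freeMod ε τ ρ s).carrier}
    (hm : m ∈ (freeMod ε τ ρ s).gr d) : m ∈ gradedClosure s K ↔ toRat ε τ ρ m ∈ K := by
  constructor
  · intro h
    have := h d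
    rwa [GrMod.proj_of_mem_gen _ _ _ hm, if_pos rfl] at this
  · intro h e
    rw [GrMod.proj_of_mem_gen _ _ _ hm]
    split_ifs
    · exact h
    · rw [map_zero]; exact zero_mem _

theorem toRat_mem_of_mem_gradedClosure {m : (freeMod ε τ ρ s).carrier}
    (hm : m ∈ gradedClosure s K) : toRat ε τ ρ m ∈ K := by
  obtain ⟨t, ht⟩ := (freeMod ε τ ρ s).exists_sum_proj m
  rw [← ht t (Finset.Subset.refl t), map_sum]
  exact sum_mem fun d _ => hm d

end Closure

end NCQuadric
end

noncomputable section

namespace NCQuadric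

/-! ### Every fat submodule comes from a trivialized sheaf. -/

section Surjectivity

open Filter

variable {G : Type} [CommGroup G] {ε : G →* ℂˣ} {τ : MonoidAlgebra ℂ G}

theorem isIso_restrict_map (g : Qu ε τ) (hg : ∀ q, Commute g q) (e : ℤ × ℤ)
    (he : g ∈ Qu.grading ε τ e) {M N : GrMod.{u} ε τ} {f : M ⟶ N}
    (hf : torIso (GrMod.quotMap g hg e he f)) :
    IsIso ((restrict g hg e he).map ((piFun ε τ).map f)) := by
  rw [restrict_map]
  exact MorphismProperty.Q_inverts (torIso.inverseImage (killed.{u} g).ι) _ hf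

variable [Finite G]
variable {W : Type u} [AddCommGroup W] [Module ℂ W] [FiniteDimensional ℂ W]
variable {ρ : Representation ℂ G W}

theorem mono_restrict_map (g : Qu ε τ) (hg : ∀ q, Commute g q) (e : ℤ × ℤ)
    (he : g ∈ Qu.grading ε τ e) {M N : GrMod.{u} ε τ} {f : M ⟶ N}
    (hf : ∀ᶠ d in atTop, ∀ m ∈ (GrMod.quot g hg e he M).gr d,
      (GrMod.quotMap g hg e he f).lin m = 0 → m = 0) :
    Mono ((restrict g hg e he).map ((piFun ε τ).map f)) := by
  rw [restrict_map]
  exact (subClosed_killed g).mono_iff.mpr hf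

/-- Modulo `z`, the map `f` is injective in large bidegrees by saturation, and onto there because
the image contains `P² F(-n)` and `F(n) = P² F(-n) + z F(n)`. -/
theorem isIso_izStar_map {M : GrMod.{u} ε τ} {n : ℕ} {P : SemiInv ε n} {f : M ⟶ shiftMod ε τ ρ n}
    (hf : IsPresentation P f) : IsIso ((izStar ε τ).map ((piFun ε τ).map f)) := by
  refine isIso_restrict_map (Qu.z ε τ) (Qu.z_comm ε τ) (1, 0) Qu.z_mem (torIso_iff.mpr ⟨(quotMap_injective_iff_saturated f hf.inj (Qu.z_comm ε τ) Qu.z_mem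
    (theta_gen ε τ .z)).mpr hf.z_sat, ?_⟩)
  filter_upwards [hf.sq_mem, eventually_exists_eq (P.mul P) (twist ρ (ε ^ (-n : ℤ)))
    (twist ρ (ε ^ (n : ℤ))) (twist_shift ε ρ (by push_cast; ring)) (-n) n (by push_cast; ring)]
    with d h1 h2
  rintro _ ⟨v, hv, rfl⟩
  obtain ⟨u, hu, u₂, rfl⟩ := h2 v hv
  obtain ⟨m, hm⟩ := h1 u hu
  refine ⟨Submodule.Quotient.mk m, (Submodule.Quotient.eq _).mpr ⟨-u₂, ?_⟩⟩
  rw [hm, rmul_apply, smul_neg]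
  exact (sub_add_cancel_left _ _).symm

/-- Near `z = 0` multiplication by `P` is invertible. Combined with `isIso_izStar_map` it
trivializes a presentation along the line, `E` and `W ⊗ O` both being identified with `F(n)` there.
-/
theorem isIso_izStar_map_mulMod {k : ℕ} (P : SemiInv ε k) (ρ ρ' : Representation ℂ G W)
    (hW : ∀ g w, ρ' g w = ((ε g ^ k : ℂˣ) : ℂ) • ρ g w) (a b : ℤ) (hab : b = a + k) :
    IsIso ((izStar ε τ).map ((piFun ε τ).map (mulMod τ P ρ ρ' hW a b hab))) := by
  refine isIso_restrict_map (Qu.z ε τ) (Qu.z_comm ε τ) (1, 0) Qu.z_mem (torIso_iff.mpr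
    ⟨Eventually.of_forall fun d m _ h => quotMap_mulMod_injective _ _ _ _ _ _ _ m h, ?_⟩)
  filter_upwards [eventually_exists_eq P ρ ρ' hW a b hab] with d hd
  rintro _ ⟨v, hv, rfl⟩
  obtain ⟨u, hu, u₂, rfl⟩ := hd v hv
  refine ⟨Submodule.Quotient.mk u, (Submodule.Quotient.eq _).mpr ⟨-u₂, ?_⟩⟩
  rw [rmul_apply, smul_neg]
  exact (sub_add_cancel_left _ _).symm

theorem mono_iwStar_map {M : GrMod.{u} ε τ} {n : ℕ} {P : SemiInv ε n} {f : M ⟶ shiftMod ε τ ρ n}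
    (hf : IsPresentation P f) : Mono ((iwStar ε τ).map ((piFun ε τ).map f)) := by
  exact mono_restrict_map (Qu.w ε τ) (Qu.w_comm ε τ) (0, 1) Qu.w_mem ((quotMap_injective_iff_saturated f hf.inj (Qu.w_comm ε τ) Qu.w_mem
    (theta_gen ε τ .w)).mpr hf.w_sat)

/-- The trivialized sheaf given by a graded module over `F(n)`. -/
def IsPresentation.triv {n : ℕ} {P : SemiInv ε n} {M : GrMod.{u} ε τ} {f : M ⟶ shiftMod ε τ ρ n}
    (hf : IsPresentation P f) (g : shiftMod ε τ ρ (-n) ⟶ M)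
    (hg : g ≫ f = shiftMul ε τ ρ (P.mul P) (-n) n (by push_cast; ring)) : Triv.{u} ε τ ρ where
  E := (piFun ε τ).obj M
  n := n
  P := P
  φ := (piFun ε τ).map g
  ψ := (piFun ε τ).map f
  mono_φ := by
    refine mono_piFun_iff.mpr (Eventually.of_forall fun d v hv h => ?_)
    refine shiftMul_injective (P.mul P) (-n) n (by push_cast; ring) hv ?_
    rw [← hg]
    exact (congrArg f.lin h).trans (map_zero _)
  mono_ψ := mono_piFun_iff.mpr hf.inj
  comp := ((piFun ε τ).map_comp _ _).symm.trans (congrArg _ hg)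
  iz := by
    have := isIso_izStar_map hf
    have := isIso_izStar_map_mulMod (τ := τ) P ρ (twist ρ (ε ^ (n : ℤ))) (twist_natCast ρ n) 0 n
      (zero_add _).symm
    exact ⟨asIso ((izStar ε τ).map ((piFun ε τ).map f)) ≪≫
      (asIso ((izStar ε τ).map ((piFun ε τ).map (mulMod τ P ρ _ (twist_natCast ρ n) 0 n
        (zero_add _).symm)))).symm⟩
  iw := mono_iwStar_map hf

theorem exists_triv {N : Submodule (Bt ε τ)ᵐᵒᵖ (BRat ε τ ⊗[MonoidAlgebra ℂ G] ρ.asModule)}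
    (hN : IsFat ε τ N) : ∃ t : Triv.{u} ε τ ρ, t.toSubmodule = N := by
  obtain ⟨n, P, h1, h2⟩ := hN.exists_semiInv
  -- `K = P N` lies in the lattice of `W ⊗ ε^n`, so it can be homogenized inside `F(n)`.
  let K := N.map (BRat.lmulPoly τ P ρ (twist ρ (ε ^ (n : ℤ))) (twist_natCast ρ n))
  let f := (shiftMod ε τ ρ n).subIncl (gradedClosure (n, 0) K) proj_mem_gradedClosure
  -- `P² v = P (P v)`, where `P v` is in `N` by the lower bound in fatness.
  have hsq (v : (shiftMod ε τ ρ (-n)).carrier) : (shiftMul ε τ ρ (P.mul P) (-n) n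
      (by push_cast; ring)).lin v ∈ gradedClosure (τ := τ) (n, 0) K := fun d => by
    rw [← GrMod.lin_proj]
    refine (congrArg (· ∈ K) (toRat_lmulPoly _ _ _ _ _)).mpr ?_
    rw [← BRat.lmulPoly_comp P P (P.mul P) rfl _ _ _ (twist_neg ρ n) (twist_natCast ρ n)]
    exact ⟨_, h1 _ (toRat_mem_lattice _ _), rfl⟩
  have hsat {g : Qu ε τ} {e : ℤ × ℤ} (he : g ∈ Qu.grading ε τ e) (hg : theta ε τ g = 1) :
      Saturated g f := Eventually.of_forall fun d v hv => by
    rintro ⟨m, hm⟩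
    have hmem : op g • v ∈ gradedClosure (τ := τ) (n, 0) K := hm ▸ m.2
    rw [mem_gradedClosure_iff (GrMod.smul_mem _ he hv)] at hmem
    have := toRat_smul ε τ (twist ρ (ε ^ (n : ℤ))) g v
    rw [hg, op_one, one_smul] at this
    exact ⟨⟨v, (mem_gradedClosure_iff hv).mpr (this ▸ hmem)⟩, rfl⟩
  have hf : IsPresentation P f :=
    ⟨Eventually.of_forall fun _ _ _ h => Subtype.ext h,
      Eventually.of_forall fun _ v _ => ⟨⟨_, hsq v⟩, rfl⟩,
      hsat Qu.z_mem (theta_gen ε τ .z), hsat Qu.w_mem (theta_gen ε τ .w)⟩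
  let g : shiftMod ε τ ρ (-n) ⟶ (shiftMod ε τ ρ n).sub (gradedClosure (n, 0) K)
      proj_mem_gradedClosure :=
    ⟨(shiftMul ε τ ρ (P.mul P) (-n) n (by push_cast; ring)).lin.codRestrict _ hsq,
      fun h => GrMod.Hom.map_gr (shiftMul ε τ ρ (P.mul P) (-n) n (by push_cast; ring)) h⟩
  refine ⟨hf.triv g rfl, Submodule.ext fun u => ?_⟩
  refine ((hf.triv g rfl).mem_toSubmodule (Iso.refl _) f (Category.id_comp _)
    (twist_natCast ρ n) u).trans ⟨?_, fun hu => ?_⟩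
  · rintro ⟨m, hm⟩
    -- Values of the closure lie in `P N`, and `P` is invertible on `W ⊗ B_rat`.
    obtain ⟨u', hu', h⟩ := toRat_mem_of_mem_gradedClosure m.2
    have := (BRat.lmulPoly_bijective P _ _ (twist_natCast ρ n)).1 (h.trans hm)
    exact this ▸ hu'
  -- Conversely `P u` is in the lattice by the upper bound in fatness, so it has a homogeneous
  -- representative, which belongs to the closure by definition.
  · obtain ⟨m, hm⟩ := exists_toRat_eq (h2 u hu)
    obtain ⟨c, hc⟩ := exists_homogeneous_toRat (𝟙 (shiftMod ε τ ρ n)) m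
    obtain ⟨m', hm', h⟩ := hc (c, c) le_rfl le_rfl
    replace h := h.trans hm
    exact ⟨⟨m', (mem_gradedClosure_iff hm').mpr ⟨u, hu, h.symm⟩⟩, h⟩

end Surjectivity

end NCQuadric
end

/-- For the algebra `B = B_τ` of the noncommutative affine plane and the noncommutative
quadric attached to `μ_m`, a faithful character `ε` and `τ ∈ ℂ[μ_m]`, the restriction functor
`j^*` induces a bijection from the set of equivalence classes of trivialized sheaves onto the set
of fat right `B`-submodules of `W ⊗ B_rat`. -/
theorem theorem2p3 (m : ℕ) (hm : 0 < m) (ε : rootsOfUnity m ℂ →* ℂˣ)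
    (hε : Function.Injective ε) (τ : MonoidAlgebra ℂ (rootsOfUnity m ℂ))
    {W : Type u} [AddCommGroup W] [Module ℂ W] [FiniteDimensional ℂ W]
    (ρ : Representation ℂ (rootsOfUnity m ℂ) W) :
    ∃ F : NCQuadric.GrP ε τ ρ → NCQuadric.GrB ε τ ρ,
      Function.Bijective F ∧
        ∀ t : NCQuadric.Triv ε τ ρ,
          (F (Quotient.mk (NCQuadric.Triv.setoid ε τ ρ) t)).1 = t.toSubmodule := by
  have : NeZero m := ⟨hm.ne'⟩
  let F : NCQuadric.GrP ε τ ρ → NCQuadric.GrB ε τ ρ :=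
    Quotient.lift (fun t => ⟨t.toSubmodule, t.isFat⟩)
      fun _ _ h => Subtype.ext (NCQuadric.Triv.toSubmodule_eq_of_equivalent h)
  refine ⟨F, ⟨?_, ?_⟩, fun _ => rfl⟩
  · rintro ⟨s⟩ ⟨t⟩ h
    exact Quotient.sound (NCQuadric.Triv.equivalent_of_toSubmodule_eq (congrArg Subtype.val h))
  · rintro ⟨N, hN⟩
    obtain ⟨t, rfl⟩ := NCQuadric.exists_triv hN
    exact ⟨Quotient.mk _ t, rfl⟩
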